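/- **Nets.** A labelled Petri net over $\mathrm{Act}\uplus\{\tau\}$ is a tuple $N=(S,T,F,M_0,\ell)$ with disjoint sets $S$ of places and $T$ of transitions, arc weights $F:(S\times T)\cup(T\times S)\to\mathbb N$, an initial marking $M_0\in\mathbb N^S$ and a labelling $\ell:T\to\mathrm{Act}\uplus\{\tau\}$. Put ${}^\bullet x(y)=F(y,x)$ and $x^\bullet(y)=F(x,y)$, extended additively to finite multisets of transitions; sets are identified with multisets, and $\cap,\cup$ of multisets are the pointwise minimum and maximum. A non-empty finite multiset $G$ of transitions is a step from $M$ to $M'$, written $M[G\rangle M'$, if ${}^\bullet G\le M$ and $M'=M-{}^\bullet G+G^\bullet$; $[M_0\rangle$ is the least set of markings that contains $M_0$ and is closed under steps. $N$ is - *plain* if $\ell$ is injective and never $\tau$; - a *structural conflict net* if ${}^\bullet t\cap{}^\bullet u=\emptyset$ whenever $t,u\in T$ and some $M\in[M_0\rangle$ enables $\{t\}+\{u\}$; - *finitary* if ${}^\bullet t\neq\emptyset$ for all $t\in T$, and every reachable marking is finite and enables only finitely many transitions. $N$ has a *fully reachable pure $\mathsf M$* if there are $t,u,v\in T$ with ${}^\bullet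 t\cap{}^\bullet u\ne\emptyset$, ${}^\bullet u\cap{}^\bullet v\neq\emptyset$, ${}^\bullet t\cap{}^\bullet v=\emptyset$ and ${}^\bullet t\cup{}^\bullet u\cup{}^\bullet v\le M$ for some $M\in[M_0\rangle$. Write $i\mathrel\#j$ if $i\ne j$ and ${}^\bullet i\cap{}^\bullet j\neq\emptyset$ (*conflict*), and $\overset{\#}{=}$ for its reflexive closure. **Equivalence.** An ST-marking of $N$ is a pair $(M,U)\in\mathbb N^S\times T^*$; initially $(M_0,\varepsilon)$. The ST-transitions are: $(M,U)\xrightarrow{a^+}(M-{}^\bullet t,Ut)$ if $\ell(t)=a\in\mathrm{Act}$ and ${}^\bullet t\le M$; $(M,U)\xrightarrow{a^{-n}}(M+t^\bullet,U^{-n})$ if $t$ is the $n$-th element of $U$, $\ell(t)=a\in\mathrm{Act}$, and $U^{-n}$ is $U$ without its $n$-th element; $(M,U)\xrightarrow{\tau}(M',U)$ if $M[\{t\}\rangle M'$ with $\ell(t)=\tau$. Let $\Rightarrow$ be the reflexive-transitive closure of $\xrightarrow{\tau}$, and let $p\xrightarrow{(\alpha)}q$ mean $p\xrightarrow{\alpha}q$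 or ($\alpha=\tau$ and $p=q$). Two nets are *branching ST-bisimilar with explicit divergence*, $N_1\approx^\Delta_{bSTb}N_2$, if there is a relation $\mathcal B$ between their ST-markings that relates the initial ones and is such that, whenever $p\mathrel{\mathcal B}q$: - if $p\xrightarrow{\alpha}p'$, then $q\Rightarrow q_1\xrightarrow{(\alpha)}q'$ for some $q_1,q'$ with $p\mathrel{\mathcal B}q_1$ and $p'\mathrel{\mathcal B}q'$; - if $p=p_0\xrightarrow{\tau}p_1\xrightarrow{\tau}\cdots$ is infinite with $p_m\mathrel{\mathcal B}q$ for all $m$, then there is an infinite $q=q_0\xrightarrow{\tau}q_1\xrightarrow{\tau}\cdots$ with $p_m\mathrel{\mathcal B}q_n$ for all $m,n$; - the same two conditions hold with the roles of the two sides exchanged. **Nets with reversible transitions.** Such a net has places $S$, transitions $T$, a set $\Omega$ of undo interfaces, each linked to some of the transitions, a marking $M_0$, labels, multisets $t^{in},t^{early},t^{late},t^{out},t^{far}\in\mathbb N^S$ for $t\in T$, and places $\mathsf{undo}_\omega(t),\mathsf{reset}_\omega(t),\mathsf{ack}_\omega(t)\in S$ for each $\omega$ linked to $t$. Transitions without interfaces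 (*standard* ones) have only $t^{in}$ and $t^{out}$ non-empty; the others are *reversible*. It denotes the Petri net that consists of $S$ (marked by $M_0$), the standard transitions (with ${}^\bullet t=t^{in}$, $t^\bullet=t^{out}$) and, for all reversible $t$, $\omega$ linked to $t$, and $f\in t^{far}$, new unmarked places $\mathsf{fired}(t),\mathsf{keep}_\omega(t),\mathsf{take}(f,t),\mathsf{took}(f,t),\rho(t)$ and the following transitions, where $t\cdot\mathsf{fire}$ is labelled $\ell(t)$ and the others are labelled $\tau$: | transition | preplaces | postplaces | |---|---|---| | $t\cdot\mathsf{fire}$ | $t^{in}+t^{early}+t^{late}$ | $\mathsf{fired}(t)$, $t^{out}+t^{far}$ | | $t\cdot\mathsf{undo}_\omega$ | $\mathsf{undo}_\omega(t)$, $\mathsf{fired}(t)$ | $\mathsf{keep}_\omega(t)$, $\mathsf{take}(f,t)$ for all $f\in t^{far}$ | | $t\cdot\mathsf{undo}(f)$ | $\mathsf{take}(f,t)$, $t^{far}(f)\cdot f$ | $\mathsf{took}(f,t)$ | | $t\cdot\mathsf{undone}$ | $\mathsf{took}(f,t)$ for all $f\in t^{far}$ | $\rho(t)$, $t^{early}$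 | | $t\cdot\mathsf{reset}_\omega$ | $\mathsf{reset}_\omega(t)$, $\mathsf{keep}_\omega(t)$, $\rho(t)$ | $t^{late}$, $\mathsf{ack}_\omega(t)$ | | $t\cdot\mathsf{elide}_\omega$ | $\mathsf{undo}_\omega(t)$, $\mathsf{reset}_\omega(t)$ | $\mathsf{ack}_\omega(t)$ | **The conflict replicating implementation.** Fix a well-ordering $<$ of $T$; write $i<^\#j$ if $i<j$ and $i\mathrel\#j$, and $i\le^\#j$ if $i<^\#j$ or $i=j$. The implementation $\mathcal I(N)$ is the following net with reversible transitions, resp. the Petri net that it denotes. Its interfaces are the elements of $T$; the interface $i$ is linked to the transitions in $$\Omega_i=\{\mathsf{ini}_c\mid c\overset{\#}{=}i\}\cup\{\mathsf{trans}^b_c\mid b<^\#c\overset{\#}{=}i\}.$$ Its places are the $p\in S$ (marked by $M_0$); $p_j$ for $p\in{}^\bullet j$; $\pi_j$ for $j\in T$ and $\pi_{j\#l}$ for $j\le^\#l$ (each marked with one token); and, unmarked, $\mathsf{pre}^j_k$ for $j\le^\#k$; $\mathsf{trans}^h_j\text{-in}$ and $\mathsf{trans}^h_j\text{-out}$ for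 $h<^\#j$; $\mathsf{fetch}^{p,c}_{i,j}\text{-in}$ and $\mathsf{fetch}^{p,c}_{i,j}\text{-out}$ for $i\le^\#j$, $p\in{}^\bullet i$, $c\in p^\bullet$; and $\mathsf{undo}_i(t),\mathsf{reset}_i(t),\mathsf{ack}_i(t)$ for $t\in\Omega_i$. Its transitions, for all $p\in S$ with $p^\bullet\ne\emptyset$, $h<^\#j$ and $i\le^\#j$ (and $q\in{}^\bullet i$, $c\in q^\bullet$), with arcs of weight 1 unless indicated, are the following. - $\mathsf{dist}_p$ (standard): from $p$ to $p_c$ for all $c\in p^\bullet$. - $\mathsf{ini}_j$ (reversible): early $F(p,j)\cdot p_j$ for all $p\in{}^\bullet j$; late $\pi_j$; far $\mathsf{pre}^j_k$ for all $k\ge^\#j$ and $\mathsf{trans}^h_j\text{-in}$ for all $h<^\#j$. - $\mathsf{trans}^h_j$ (reversible): early $\mathsf{trans}^h_j\text{-in}$; late $\pi_{h\#j}$; far $\mathsf{trans}^h_j\text{-out}$. - $\mathsf{exec}^i_j$ (standard): from $\mathsf{pre}^i_j$, $\mathsf{trans}^h_j\text{-out}$ for all $h<^\#j$, and $\pi_{j\#l}$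 for all $l\ge^\#j$; to $\mathsf{pre}^i_j$, $\mathsf{trans}^h_j\text{-out}$ for all $h<^\#j$, $\mathsf{fetch}^{q,c}_{i,j}\text{-in}$ for all $q\in{}^\bullet i$, $c\in q^\bullet$, and $\mathsf{undo}_i(t)$ for all $t\in\Omega_i$. - $\mathsf{fetch}^{q,c}_{i,j}$ (standard): from $\mathsf{fetch}^{q,c}_{i,j}\text{-in}$ and $F(q,i)\cdot q_c$; to $\mathsf{fetch}^{q,c}_{i,j}\text{-out}$. - $\mathsf{fetched}^i_j$ (standard): from $\mathsf{fetch}^{q,c}_{i,j}\text{-out}$ for all $q\in{}^\bullet i$, $c\in q^\bullet$; to $\pi_{j\#l}$ for all $l\ge^\#j$ and $\mathsf{reset}_i(t)$ for all $t\in\Omega_i$. - $\mathsf{complete}_i$ (standard), for $i\in T$: from $\mathsf{ack}_i(t)$ for all $t\in\Omega_i$; to $F(i,r)\cdot r$ for all $r\in i^\bullet$. The transition $\mathsf{exec}^i_j$ is labelled $\ell(i)$; all others are labelled $\tau$. **Theorem.** Let $N$ be a finitary plain structural conflict net without a fully reachable pure $\mathsf M$, in which every transition is in conflict with only finitely many transitions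 (as is automatic in a finite net). Then, for every well-ordering of its transitions, $\mathcal I(N)\approx^\Delta_{bSTb}N$. -/

import Mathlib

universe u v w v' w'

/-! ## Labelled place/transition systems with arc weights -/

/-- The multiset identified with the set `A`: multiplicity `1` on `A` and `0` elsewhere. -/
noncomputable def setMultiset {X : Type*} (A : Set X) : X → ℕ := A.indicator 1

/-- A labelled Petri net over `Act ∪ {τ}`; the label `none` is the invisible action `τ`.
`pre t s` is the arc weight `F(s,t)` and `post t s` is the arc weight `F(t,s)`. -/
structure PetriNet (Act : Type u) where
  /-- places -/
  S : Type v
  /-- transitions -/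
  T : Type w
  pre : T → S → ℕ
  post : T → S → ℕ
  /-- the initial marking -/
  M₀ : S → ℕ
  /-- the labelling -/
  label : T → Option Act

namespace PetriNet

variable {Act : Type u} (N : PetriNet.{u, v, w} Act)

/-- The preplaces of a finite multiset of transitions, counted with multiplicity. -/
def preOf (G : N.T →₀ ℕ) : N.S → ℕ := G.sum fun t n => n • N.pre t

/-- The postplaces of a finite multiset of transitions, counted with multiplicity. -/
def postOf (G : N.T →₀ ℕ) : N.S → ℕ := G.sum fun t n => n • N.post t

/-- The non-empty finite multiset `G` of transitions is a step from `M` to `M'`. -/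
def Step (M : N.S → ℕ) (G : N.T →₀ ℕ) (M' : N.S → ℕ) : Prop :=
  G ≠ 0 ∧ N.preOf G ≤ M ∧ M' = (M - N.preOf G) + N.postOf G

/-- The multiset `G` of transitions is enabled under `M`. -/
def Enabled (M : N.S → ℕ) (G : N.T →₀ ℕ) : Prop := ∃ M', N.Step M G M'

/-- The reachable markings: the smallest set that contains `M₀` and is closed under steps. -/
inductive Reachable : (N.S → ℕ) → Prop
  | init : Reachable N.M₀
  | step {M M' : N.S → ℕ} {G : N.T →₀ ℕ} : Reachable M → N.Step M G M' → Reachable M'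

/-- The concurrency relation `t ⌣ u`. -/
def Concurrent (t u : N.T) : Prop :=
  ∃ M, N.Reachable M ∧ N.Enabled M (Finsupp.single t 1 + Finsupp.single u 1)

/-- Concurrent transitions share no preplaces; in particular (as presets of transitions of
finitary nets are non-empty) no transition of a finitary net is concurrent with itself. -/
def IsStructuralConflictNet : Prop :=
  ∀ t u : N.T, N.Concurrent t u → N.pre t ⊓ N.pre u = 0

/-- A plain net: no transition is silent and different transitions have different labels. -/
def IsPlain : Prop :=
  Function.Injective N.label ∧ ∀ t, N.label t ≠ none

/-- Every transition has a preplace, and every reachable marking is finite and enables only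
finitely many transitions. -/
def IsFinitary : Prop :=
  (∀ t : N.T, N.pre t ≠ 0) ∧
  ∀ M, N.Reachable M →
    {s | M s ≠ 0}.Finite ∧ {t | N.Enabled M (Finsupp.single t 1)}.Finite

/-- A fully reachable pure M. -/
def HasFullyReachablePureM : Prop :=
  ∃ t u v : N.T, N.pre t ⊓ N.pre u ≠ 0 ∧ N.pre u ⊓ N.pre v ≠ 0 ∧ N.pre t ⊓ N.pre v = 0 ∧
    ∃ M, N.Reachable M ∧ N.pre t ⊔ N.pre u ⊔ N.pre v ≤ M

/-- `i # j`: different transitions with a common preplace. -/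
def Conflict (i j : N.T) : Prop := i ≠ j ∧ N.pre i ⊓ N.pre j ≠ 0

/-- The reflexive closure of the conflict relation. -/
def ConflictEq (i j : N.T) : Prop := N.Conflict i j ∨ i = j

/-- Every transition is in conflict with only finitely many transitions. -/
def IsConflictFinite : Prop := ∀ i : N.T, {j | N.Conflict i j}.Finite

end PetriNet

/-! ## Labelled transition systems and branching bisimilarity with explicit divergence -/

/-- A labelled transition system over `A ∪ {τ}`; the label `none` is `τ`. -/
structure LTS (A : Type u) where
  State : Type v
  Tr : State → Option A → State → Prop
  start : State

namespace LTS

variable {A : Type u}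

/-- The reflexive and transitive closure of the `τ`-transition relation. -/
def TauStar (L : LTS.{u, v} A) : L.State → L.State → Prop :=
  Relation.ReflTransGen fun p q => L.Tr p none q

/-- A transition labelled `α` that is optional (may be skipped) if `α = τ`. -/
def OptTr (L : LTS.{u, v} A) (p : L.State) (α : Option A) (q : L.State) : Prop :=
  L.Tr p α q ∨ (α = none ∧ p = q)

/-- An infinite sequence of `τ`-transitions. -/
def IsTauPath (L : LTS.{u, v} A) (σ : ℕ → L.State) : Prop :=
  ∀ n, L.Tr (σ n) none (σ (n + 1))

/-- `B` is a branching bisimulation between `L₁` and `L₂`. -/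
structure IsBranchingBisimulation (L₁ : LTS.{u, v} A) (L₂ : LTS.{u, w} A)
    (B : L₁.State → L₂.State → Prop) : Prop where
  start : B L₁.start L₂.start
  forth : ∀ p q α p', B p q → L₁.Tr p α p' →
    ∃ q₁ q', L₂.TauStar q q₁ ∧ L₂.OptTr q₁ α q' ∧ B p q₁ ∧ B p' q'
  back : ∀ p q α q', B p q → L₂.Tr q α q' →
    ∃ p₁ p', L₁.TauStar p p₁ ∧ L₁.OptTr p₁ α p' ∧ B p₁ q ∧ B p' q'

/-- `B` respects divergence: an infinite `τ`-path whose states are all related to one and the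
same state `q` is matched by an infinite `τ`-path from `q`, with all states related;
and likewise in the other direction. -/
structure RespectsDivergence (L₁ : LTS.{u, v} A) (L₂ : LTS.{u, w} A)
    (B : L₁.State → L₂.State → Prop) : Prop where
  forth : ∀ (σ : ℕ → L₁.State) (q : L₂.State), L₁.IsTauPath σ → (∀ n, B (σ n) q) →
    ∃ ρ : ℕ → L₂.State, ρ 0 = q ∧ L₂.IsTauPath ρ ∧ ∀ m n, B (σ m) (ρ n)
  back : ∀ (p : L₁.State) (ρ : ℕ → L₂.State), L₂.IsTauPath ρ → (∀ n, B p (ρ n)) →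
    ∃ σ : ℕ → L₁.State, σ 0 = p ∧ L₁.IsTauPath σ ∧ ∀ m n, B (σ m) (ρ n)

/-- Branching bisimilarity with explicit divergence. -/
def BranchingBisimilarDiv (L₁ : LTS.{u, v} A) (L₂ : LTS.{u, w} A) : Prop :=
  ∃ B : L₁.State → L₂.State → Prop,
    IsBranchingBisimulation L₁ L₂ B ∧ RespectsDivergence L₁ L₂ B

end LTS

/-! ## ST-semantics of Petri nets -/

/-- Visible action phases: `start a` is `a⁺`, and `finish a n` is the termination of the
currently firing transition at position `n` (counted from `0`), provided it is labelled `a`. -/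
inductive Phase (Act : Type u) : Type u
  | start (a : Act)
  | finish (a : Act) (n : ℕ)

namespace PetriNet

variable {Act : Type u} (N : PetriNet.{u, v, w} Act)

/-- The transitions between ST-markings: pairs of a marking and the sequence of transitions
that are currently firing. -/
inductive STTr : (N.S → ℕ) × List N.T → Option (Phase Act) → (N.S → ℕ) × List N.T → Prop
  | start {M : N.S → ℕ} {U : List N.T} {t : N.T} {a : Act} :
      N.label t = some a → N.Enabled M (Finsupp.single t 1) →
      STTr (M, U) (some (.start a)) (M - N.pre t, U ++ [t])
  | finish {M : N.S → ℕ} {U : List N.T} {t : N.T} {a : Act} {n : ℕ} :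
      U[n]? = some t → N.label t = some a →
      STTr (M, U) (some (.finish a n)) (M + N.post t, U.eraseIdx n)
  | tau {M M' : N.S → ℕ} {U : List N.T} {t : N.T} :
      N.label t = none → N.Step M (Finsupp.single t 1) M' →
      STTr (M, U) none (M', U)

/-- The ST-LTS associated to a Petri net. -/
def stLTS : LTS (Phase Act) where
  State := (N.S → ℕ) × List N.T
  Tr := N.STTr
  start := (N.M₀, [])

end PetriNet

/-- Branching ST-bisimilarity with explicit divergence of Petri nets. -/
def BranchingSTBisimilarDiv {Act : Type u} (N₁ : PetriNet.{u, v, w} Act)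
    (N₂ : PetriNet.{u, v', w'} Act) : Prop :=
  LTS.BranchingBisimilarDiv N₁.stLTS N₂.stLTS

/-! ## Petri nets with reversible transitions -/

/-- The types of arcs between places and (reversible) transitions. -/
inductive ArcType
  | inn
  | early
  | late
  | out
  | far

/-- A Petri net with reversible transitions. The arcs of type `inn`, `early`, `late` lead from
the place to the transition, those of type `out`, `far` from the transition to the place. -/
structure RevNet (Act : Type u) where
  /-- places -/
  S : Type v
  /-- transitions -/
  T : Type w
  /-- undo interfaces -/
  Ω : Type w'
  /-- the relation that links interfaces to transitions -/
  link : Ω → T → Prop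
  /-- the flow: `flow t type s` is the arc weight `F(s,t,type)` -/
  flow : T → ArcType → S → ℕ
  undo : ∀ (ω : Ω) (t : T), link ω t → S
  reset : ∀ (ω : Ω) (t : T), link ω t → S
  ack : ∀ (ω : Ω) (t : T), link ω t → S
  M₀ : S → ℕ
  label : T → Option Act
  /-- transitions without interfaces have only arcs of types `inn` and `out` -/
  standard : ∀ t, (∀ ω, ¬ link ω t) →
    flow t .early = 0 ∧ flow t .late = 0 ∧ flow t .far = 0

namespace RevNet

variable {Act : Type u} (R : RevNet.{u, v, w, w'} Act)

/-- A transition with at least one undo interface is reversible. -/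
def Reversible (t : R.T) : Prop := ∃ ω, R.link ω t

/-- The places of the net that results from expanding the reversible transitions. -/
inductive Place : Type (max v w w')
  | base (s : R.S)
  | fired (t : R.T) (h : R.Reversible t)
  | keep (ω : R.Ω) (t : R.T) (h : R.link ω t)
  | take (f : R.S) (t : R.T) (h : R.Reversible t) (hf : R.flow t .far f ≠ 0)
  | took (f : R.S) (t : R.T) (h : R.Reversible t) (hf : R.flow t .far f ≠ 0)
  | rho (t : R.T) (h : R.Reversible t)

/-- The transitions of the net that results from expanding the reversible transitions:
the standard transitions, and for each reversible transition `t` the transitions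
`t·fire`, `t·undo_ω`, `t·undo(f)`, `t·undone`, `t·reset_ω` and `t·elide_ω`. -/
inductive Trans : Type (max v w w')
  | std (t : R.T) (h : ¬ R.Reversible t)
  | fire (t : R.T) (h : R.Reversible t)
  | undo (ω : R.Ω) (t : R.T) (h : R.link ω t)
  | undoFar (f : R.S) (t : R.T) (h : R.Reversible t) (hf : R.flow t .far f ≠ 0)
  | undone (t : R.T) (h : R.Reversible t)
  | reset (ω : R.Ω) (t : R.T) (h : R.link ω t)
  | elide (ω : R.Ω) (t : R.T) (h : R.link ω t)

variable {R}

/-- A multiset of places of the given net, as a multiset of places of the expanded net. -/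
def lift (m : R.S → ℕ) : R.Place → ℕ
  | .base s => m s
  | _ => 0

/-- The preplaces of the transitions of the expanded net. -/
noncomputable def expandPre : R.Trans → R.Place → ℕ
  | .std t _ => lift (R.flow t .inn)
  | .fire t _ => lift (R.flow t .inn + R.flow t .early + R.flow t .late)
  | .undo ω t h => setMultiset {.base (R.undo ω t h)} + setMultiset {.fired t ⟨ω, h⟩}
  | .undoFar f t h hf =>
      setMultiset {.take f t h hf} + R.flow t .far f • setMultiset {.base f}
  | .undone t h => setMultiset {s | ∃ f hf, s = .took f t h hf}
  | .reset ω t h => setMultiset {.base (R.reset ω t h)} + setMultiset {.keep ω t h} +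
      setMultiset {.rho t ⟨ω, h⟩}
  | .elide ω t h =>
      setMultiset {.base (R.undo ω t h)} + setMultiset {.base (R.reset ω t h)}

/-- The postplaces of the transitions of the expanded net. -/
noncomputable def expandPost : R.Trans → R.Place → ℕ
  | .std t _ => lift (R.flow t .out)
  | .fire t h => setMultiset {.fired t h} + lift (R.flow t .out + R.flow t .far)
  | .undo ω t h =>
      setMultiset {.keep ω t h} + setMultiset {s | ∃ f hf, s = .take f t ⟨ω, h⟩ hf}
  | .undoFar f t h hf => setMultiset {.took f t h hf}
  | .undone t h => setMultiset {.rho t h} + lift (R.flow t .early)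
  | .reset ω t h => lift (R.flow t .late) + setMultiset {.base (R.ack ω t h)}
  | .elide ω t h => setMultiset {.base (R.ack ω t h)}

/-- The labels of the transitions of the expanded net. -/
def expandLabel : R.Trans → Option Act
  | .std t _ => R.label t
  | .fire t _ => R.label t
  | _ => none

variable (R)

/-- The Petri net denoted by a net with reversible transitions. -/
noncomputable def expand : PetriNet.{u, max v w w', max v w w'} Act where
  S := R.Place
  T := R.Trans
  pre := expandPre
  post := expandPost
  M₀ := lift R.M₀
  label := expandLabel

end RevNet

/-! ## The conflict replicating implementation -/

namespace PetriNet

variable {Act : Type u} (N : PetriNet.{u, v, w} Act) [LT N.T]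

/-- `i <# j`: `i` and `j` are in conflict and `i < j`. -/
def LtC (i j : N.T) : Prop := i < j ∧ N.Conflict i j

/-- `i ≤# j`: the reflexive closure of `<#`. -/
def LeC (i j : N.T) : Prop := N.LtC i j ∨ i = j

/-- The transitions of the conflict replicating implementation
(before expanding the reversible ones `initialise j` and `transfer h j`). -/
inductive ImplTrans : Type (max v w)
  | distribute (p : N.S) (h : ∃ j, N.pre j p ≠ 0)
  | initialise (j : N.T)
  | transfer (h j : N.T) (hj : N.LtC h j)
  | execute (i j : N.T) (hij : N.LeC i j)
  | fetch (i j : N.T) (hij : N.LeC i j) (p : N.S) (c : N.T)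
      (hi : N.pre i p ≠ 0) (hc : N.pre c p ≠ 0)
  | fetched (i j : N.T) (hij : N.LeC i j)
  | complete (i : N.T)

/-- `Ω_i`: the transitions that have the undo interface `i`. -/
def undoSet (i : N.T) : Set N.ImplTrans :=
  {t | (∃ c, N.ConflictEq c i ∧ t = .initialise c) ∨
    ∃ b c h, N.ConflictEq c i ∧ t = .transfer b c h}

/-- The places of the conflict replicating implementation. -/
inductive ImplPlace : Type (max v w)
  /-- a place of the original net -/
  | orig (p : N.S)
  /-- the copy `p_j` of `p` at the location of `j` -/
  | copy (p : N.S) (j : N.T) (h : N.pre j p ≠ 0)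
  /-- `π_j` -/
  | ready (j : N.T)
  /-- `pre^j_k` -/
  | enabling (j k : N.T) (h : N.LeC j k)
  /-- `trans^h_j-in` -/
  | transferIn (h j : N.T) (hj : N.LtC h j)
  /-- `trans^h_j-out` -/
  | transferOut (h j : N.T) (hj : N.LtC h j)
  /-- `π_{j#l}` -/
  | permit (j l : N.T) (h : N.LeC j l)
  | fetchIn (i j : N.T) (hij : N.LeC i j) (p : N.S) (c : N.T)
      (hi : N.pre i p ≠ 0) (hc : N.pre c p ≠ 0)
  | fetchOut (i j : N.T) (hij : N.LeC i j) (p : N.S) (c : N.T)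
      (hi : N.pre i p ≠ 0) (hc : N.pre c p ≠ 0)
  | undo (i : N.T) (t : N.ImplTrans) (h : t ∈ N.undoSet i)
  | reset (i : N.T) (t : N.ImplTrans) (h : t ∈ N.undoSet i)
  | ack (i : N.T) (t : N.ImplTrans) (h : t ∈ N.undoSet i)

variable {N}

open Classical in
/-- The multiset that puts `m p` on the copy `p_j` of each preplace `p` of `j`. -/
noncomputable def liftCopy (j : N.T) (m : N.S → ℕ) : N.ImplPlace → ℕ
  | .copy p j' _ => if j' = j then m p else 0
  | _ => 0

/-- A multiset of original places, as a multiset of places of the implementation. -/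
def liftOrig (m : N.S → ℕ) : N.ImplPlace → ℕ
  | .orig p => m p
  | _ => 0

/-- The flow of the conflict replicating implementation. -/
noncomputable def implFlow : N.ImplTrans → ArcType → N.ImplPlace → ℕ
  | .distribute p _, .inn => setMultiset {.orig p}
  | .distribute p _, .out => setMultiset {s | ∃ c hc, s = .copy p c hc}
  | .initialise j, .early => liftCopy j (N.pre j)
  | .initialise j, .late => setMultiset {.ready j}
  | .initialise j, .far =>
      setMultiset ({s | ∃ k hk, s = .enabling j k hk} ∪ {s | ∃ h hh, s = .transferIn h j hh})
  | .transfer h j hj, .early => setMultiset {.transferIn h j hj}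
  | .transfer h j hj, .late => setMultiset {.permit h j (.inl hj)}
  | .transfer h j hj, .far => setMultiset {.transferOut h j hj}
  | .execute i j hij, .inn =>
      setMultiset ({.enabling i j hij} ∪ {s | ∃ h hh, s = .transferOut h j hh} ∪
        {s | ∃ l hl, s = .permit j l hl})
  | .execute i j hij, .out =>
      setMultiset ({.enabling i j hij} ∪ {s | ∃ h hh, s = .transferOut h j hh} ∪
        {s | ∃ p c hi hc, s = .fetchIn i j hij p c hi hc} ∪
        {s | ∃ t ht, s = .undo i t ht})
  | .fetch i j hij p c hi hc, .inn =>
      setMultiset {.fetchIn i j hij p c hi hc} + N.pre i p • setMultiset {.copy p c hc}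
  | .fetch i j hij p c hi hc, .out => setMultiset {.fetchOut i j hij p c hi hc}
  | .fetched i j hij, .inn => setMultiset {s | ∃ p c hi hc, s = .fetchOut i j hij p c hi hc}
  | .fetched i j _, .out =>
      setMultiset ({s | ∃ l hl, s = .permit j l hl} ∪ {s | ∃ t ht, s = .reset i t ht})
  | .complete i, .inn => setMultiset {s | ∃ t ht, s = .ack i t ht}
  | .complete i, .out => liftOrig (N.post i)
  | _, _ => 0

/-- The initial marking of the conflict replicating implementation. -/
def implM₀ : N.ImplPlace → ℕ
  | .orig p => N.M₀ p
  | .ready _ => 1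
  | .permit _ _ _ => 1
  | _ => 0

/-- The labels of the transitions of the conflict replicating implementation. -/
def implLabel : N.ImplTrans → Option Act
  | .execute i _ _ => N.label i
  | _ => none

variable (N)

/-- The conflict replicating implementation, as a net with reversible transitions. -/
noncomputable def implRev : RevNet.{u, max v w, max v w, w} Act where
  S := N.ImplPlace
  T := N.ImplTrans
  Ω := N.T
  link i t := t ∈ N.undoSet i
  flow := implFlow
  undo := .undo
  reset := .reset
  ack := .ack
  M₀ := implM₀
  label := implLabel
  standard t ht := by
    cases t with
    | initialise j => exact absurd (Or.inl ⟨j, Or.inr rfl, rfl⟩) (ht j)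
    | transfer h j hj => exact absurd (Or.inr ⟨h, j, hj, Or.inr rfl, rfl⟩) (ht j)
    | _ => exact ⟨rfl, rfl, rfl⟩

/-- The conflict replicating implementation, as an ordinary Petri net. -/
noncomputable def impl : PetriNet.{u, max v w, max v w} Act := N.implRev.expand

end PetriNet

/-!
Every reachable marking of the implementation is described by a *configuration* `C : Config N`:
the control state of each reversible transition `ini_c`, `trans^h_j`, the phase of each transition
`i` of `N` (idle, firing at a location `j`, fetching tokens, or resetting its conflict class), the
tokens on the places `p` and on their copies `p_c`, and a marking `C.mt` of `N`. The marking
`C.mt` counts only the transitions whose implementation has run to its end in `complete`, so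
the active transitions (those that are not idle) are still enabled in it. The marking of the
implementation is recovered as `conc C`.

The invariant `Config.WF` says, besides bookkeeping, that `C.mt` is reachable, that the active
transitions are pairwise conflict-free, and that each place `p` and each `c` in `p^•` satisfy a
token balance: the tokens of `C.mt p` are on `p`, on `p_c`, held by `ini_c`, or have been fetched
from `p_c` by active transitions. Two consequences of the hypotheses on `N` carry the argument:

* without a fully reachable pure M, conflict is transitive among the transitions enabled under one
  marking (`ConflictEq.trans`), so that each conflict class at `C.mt` contains at most one active
  transition (`Config.WF.act_unique`);
* in a structural conflict net, `ini_c` cannot hold its tokens while a transition in conflict with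
  `c` has already fetched its own (`Config.WF.not_holding_of_resetting`).

*Safety.* If `exec^i_j` is enabled, then `i` is in conflict with no active transition
(`Config.WF.exec_conflict_free`): an active transition `k` at location `l` in the same class would
compete with it for one of the places `π_{j#l}` and `π_{l#j}`, and one that has fetched all its
tokens is excluded because `ini_i` holds those of `i`.

*Liveness.* If no silent transition is enabled, then all active transitions are still visibly
firing (`Config.WF.exists_exec_of_quiet`), and each transition `i` that is enabled and in conflict
with none of them can start by `exec^i_j`, where `j` is the largest enabled transition in the
class of `i` (`Config.WF.exists_exec_le_conc_of_quiet`).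

*Termination.* Silent steps either complete an active transition or decrease the natural number
`Config.weight` (`Config.Tau.decreases`), so there are no infinite sequences of them.

The relation `Simulates` relates the implementation to the marking of `N` in which also the
transitions between their visible start and `complete` are taken into account; it is invariant
under silent steps. It is a branching bisimulation: visible transitions of the implementation are
matched directly by safety, and those of `N` are matched after running silent steps of the
implementation until none is left, by liveness. Divergence is respected as neither side has any.
-/

/-! ### Configurations of the implementation -/

namespace PetriNet

variable {Act : Type u} {N : PetriNet.{u, v, w} Act} [LT N.T]

/-- The control state of a reversible transition `t` of the implementation: not fired, fired,
being undone from the interface `ω` with the far places in `A` emptied so far, or undone from the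
interface `ω` and waiting for its reset. -/
inductive RState (N : PetriNet.{u, v, w} Act) [LT N.T]
  | idle
  | fired
  | undoing (ω : N.T) (A : Set N.ImplPlace)
  | undone (ω : N.T)

namespace RState

/-- The transition has not fired since its last reset. -/
def IsIdle : RState N → Prop
  | idle => True
  | _ => False

/-- The place `fired(t)` is marked. -/
def IsFired : RState N → Prop
  | fired => True
  | _ => False

/-- The place `ρ(t)` is marked. -/
def IsUndone : RState N → Prop
  | undone _ => True
  | _ => False

/-- The tokens of the early places have been consumed and not been returned. -/
def Holding : RState N → Prop
  | fired => True
  | undoing _ _ => True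
  | _ => False

/-- The token that firing produced for the far place `f` has not been taken back (although it may
be in use by another transition). -/
def Has : RState N → N.ImplPlace → Prop
  | fired, _ => True
  | undoing _ A, f => f ∉ A
  | _, _ => False

/-- The place `take(f,t)` is marked. -/
def Take : RState N → N.ImplPlace → Prop
  | undoing _ A, f => f ∉ A
  | _, _ => False

/-- The place `took(f,t)` is marked. -/
def Took : RState N → N.ImplPlace → Prop
  | undoing _ A, f => f ∈ A
  | _, _ => False

/-- The place `keep_ω(t)` is marked. -/
def KeptBy : RState N → N.T → Prop
  | undoing ω' _, ω => ω' = ω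
  | undone ω', ω => ω' = ω
  | _, _ => False

end RState

/-- The phase of a transition `i` of the original net: idle; visibly firing at the location `j`,
that is, between start and end of `exec^i_j`; fetching its tokens at the location `j`, those for
the pairs `(p, c)` in `D` being fetched already; or resetting the transitions in `Ω_i`, those in
`A` having been acknowledged already. -/
inductive TPhase (N : PetriNet.{u, v, w} Act) [LT N.T]
  | idle
  | exec (j : N.T)
  | fetching (j : N.T) (D : Set (N.S × N.T))
  | resetting (A : Set N.ImplTrans)

namespace TPhase

/-- The transition `exec^i_j` is currently firing. -/
def ExecAt : TPhase N → N.T → Prop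
  | exec j', j => j' = j
  | _, _ => False

/-- The tokens of the places `π_{j#l}` are in the possession of `i`. -/
def Locks : TPhase N → N.T → Prop
  | exec j', j => j' = j
  | fetching j' _, j => j' = j
  | _, _ => False

/-- The place `fetch^{p,c}_{i,j}-in` is marked, for `p` a preplace of `i` and `c`. -/
def FetchIn : TPhase N → N.T → N.S → N.T → Prop
  | fetching j' D, j, p, c => j' = j ∧ (p, c) ∉ D
  | _, _, _, _ => False

/-- The place `fetch^{p,c}_{i,j}-out` is marked, for `p` a preplace of `i` and `c`. -/
def FetchOut : TPhase N → N.T → N.S → N.T → Prop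
  | fetching j' D, j, p, c => j' = j ∧ (p, c) ∈ D
  | _, _, _, _ => False

/-- The tokens that `i` needs from `p` have been removed from the copy `p_c`. -/
def Fetched : TPhase N → N.S → N.T → Prop
  | fetching _ D, p, c => (p, c) ∈ D
  | resetting _, _, _ => True
  | _, _, _ => False

/-- The token for `undo_i(t)` has been produced and not yet been used up; between `undo` and
`reset` it is represented by a token on `keep_i(t)`. -/
def Undo : TPhase N → N.ImplTrans → Prop
  | fetching _ _, _ => True
  | resetting A, t => t ∉ A
  | _, _ => False

/-- The place `reset_i(t)` is marked. -/
def Reset : TPhase N → N.ImplTrans → Prop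
  | resetting A, t => t ∉ A
  | _, _ => False

/-- The place `ack_i(t)` is marked. -/
def Ack : TPhase N → N.ImplTrans → Prop
  | resetting A, t => t ∈ A
  | _, _ => False

/-- The transition has visibly terminated, but has not been completed. -/
def Pending : TPhase N → Prop
  | fetching _ _ => True
  | resetting _ => True
  | _ => False

end TPhase

/-- A structured description of a state of the implementation. Values at arguments that
correspond to no place of the implementation, such as `copy p c` if `p` is not a preplace of `c`,
or `rst t` if `t` is not reversible, have no meaning. -/
structure Config (N : PetriNet.{u, v, w} Act) [LT N.T] where
  /-- the number of tokens on the place `p` -/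
  orig : N.S → ℕ
  /-- the number of tokens on the copy `p_c` -/
  copy : N.S → N.T → ℕ
  /-- the control states of the reversible transitions -/
  rst : N.ImplTrans → RState N
  /-- the phases of the transitions of the original net -/
  ph : N.T → TPhase N
  /-- the marking of the original net in which exactly the completed transitions have fired -/
  mt : N.S → ℕ
  /-- the transitions of the original net that are not idle -/
  act : Finset N.T

open Classical in
/-- The number of tokens on a place that is marked with one token if `P` holds, and else empty. -/
noncomputable def tok (P : Prop) : ℕ := if P then 1 else 0

/-- The marking of the implementation described by a configuration. The tokens on far places of
reversible transitions and on the places `π_{j#l}` are not on their place while in use by another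
transition. -/
noncomputable def conc (C : Config N) : N.implRev.Place → ℕ
  | .base (.orig p) => C.orig p
  | .base (.copy p j _) => C.copy p j
  | .base (.ready j) => tok (C.rst (.initialise j)).IsIdle
  | .base (.enabling j k h) =>
      tok ((C.rst (.initialise j)).Has (.enabling j k h) ∧ ¬ (C.ph j).ExecAt k)
  | .base (.transferIn h j hj) =>
      tok ((C.rst (.initialise j)).Has (.transferIn h j hj) ∧ ¬ (C.rst (.transfer h j hj)).Holding)
  | .base (.transferOut h j hj) =>
      tok ((C.rst (.transfer h j hj)).Has (.transferOut h j hj) ∧ ∀ i, ¬ (C.ph i).ExecAt j)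
  | .base (.permit j l _) =>
      tok ((∀ h, (C.rst (.transfer j l h)).IsIdle) ∧ ∀ i, ¬ (C.ph i).Locks j)
  | .base (.fetchIn i j _ p c _ _) => tok ((C.ph i).FetchIn j p c)
  | .base (.fetchOut i j _ p c _ _) => tok ((C.ph i).FetchOut j p c)
  | .base (.undo i t _) => tok ((C.ph i).Undo t ∧ ¬ (C.rst t).KeptBy i)
  | .base (.reset i t _) => tok ((C.ph i).Reset t)
  | .base (.ack i t _) => tok ((C.ph i).Ack t)
  | .fired t _ => tok (C.rst t).IsFired
  | .keep ω t _ => tok ((C.rst t).KeptBy ω)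
  | .take f t _ _ => tok ((C.rst t).Take f)
  | .took f t _ _ => tok ((C.rst t).Took f)
  | .rho t _ => tok (C.rst t).IsUndone

/-! ### The arcs of the implementation, place by place -/

/-- The preplaces of the transitions of the implementation, tabulated place by place. -/
noncomputable def ipre : N.implRev.Trans → N.implRev.Place → ℕ
  | .std (.distribute p _) _ => fun s => match s with
    | .base (.orig p') => tok (p' = p)
    | _ => 0
  | .std (.execute i j _) _ => fun s => match s with
    | .base (.enabling i' k _) => tok (i' = i ∧ k = j)
    | .base (.transferOut _ j' _) => tok (j' = j)
    | .base (.permit j' _ _) => tok (j' = j)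
    | _ => 0
  | .std (.fetch i j _ p c _ _) _ => fun s => match s with
    | .base (.fetchIn i' j' _ p' c' _ _) => tok (i' = i ∧ j' = j ∧ p' = p ∧ c' = c)
    | .base (.copy p' c' _) => N.pre i p * tok (p' = p ∧ c' = c)
    | _ => 0
  | .std (.fetched i j _) _ => fun s => match s with
    | .base (.fetchOut i' j' _ _ _ _ _) => tok (i' = i ∧ j' = j)
    | _ => 0
  | .std (.complete i) _ => fun s => match s with
    | .base (.ack i' _ _) => tok (i' = i)
    | _ => 0
  | .fire (.initialise j) _ => fun s => match s with
    | .base (.copy p j' _) => N.pre j p * tok (j' = j)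
    | .base (.ready j') => tok (j' = j)
    | _ => 0
  | .fire (.transfer h j _) _ => fun s => match s with
    | .base (.transferIn h' j' _) => tok (h' = h ∧ j' = j)
    | .base (.permit h' j' _) => tok (h' = h ∧ j' = j)
    | _ => 0
  | .undo ω t _ => fun s => match s with
    | .base (.undo ω' t' _) => tok (ω' = ω ∧ t' = t)
    | .fired t' _ => tok (t' = t)
    | _ => 0
  | .undoFar f t _ _ => fun s => match s with
    | .take f' t' _ _ => tok (f' = f ∧ t' = t)
    | .base f' => tok (f' = f)
    | _ => 0
  | .undone t _ => fun s => match s with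
    | .took _ t' _ _ => tok (t' = t)
    | _ => 0
  | .reset ω t _ => fun s => match s with
    | .base (.reset ω' t' _) => tok (ω' = ω ∧ t' = t)
    | .keep ω' t' _ => tok (ω' = ω ∧ t' = t)
    | .rho t' _ => tok (t' = t)
    | _ => 0
  | .elide ω t _ => fun s => match s with
    | .base (.undo ω' t' _) => tok (ω' = ω ∧ t' = t)
    | .base (.reset ω' t' _) => tok (ω' = ω ∧ t' = t)
    | _ => 0
  | _ => fun _ => 0

/-- The postplaces of the transitions of the implementation, tabulated place by place. -/
noncomputable def ipost : N.implRev.Trans → N.implRev.Place → ℕ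
  | .std (.distribute p _) _ => fun s => match s with
    | .base (.copy p' _ _) => tok (p' = p)
    | _ => 0
  | .std (.execute i j _) _ => fun s => match s with
    | .base (.enabling i' k _) => tok (i' = i ∧ k = j)
    | .base (.transferOut _ j' _) => tok (j' = j)
    | .base (.fetchIn i' j' _ _ _ _ _) => tok (i' = i ∧ j' = j)
    | .base (.undo i' _ _) => tok (i' = i)
    | _ => 0
  | .std (.fetch i j _ p c _ _) _ => fun s => match s with
    | .base (.fetchOut i' j' _ p' c' _ _) => tok (i' = i ∧ j' = j ∧ p' = p ∧ c' = c)
    | _ => 0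
  | .std (.fetched i j _) _ => fun s => match s with
    | .base (.permit j' _ _) => tok (j' = j)
    | .base (.reset i' _ _) => tok (i' = i)
    | _ => 0
  | .std (.complete i) _ => fun s => match s with
    | .base (.orig p) => N.post i p
    | _ => 0
  | .fire (.initialise j) _ => fun s => match s with
    | .fired t' _ => tok (t' = .initialise j)
    | .base (.enabling j' _ _) => tok (j' = j)
    | .base (.transferIn _ j' _) => tok (j' = j)
    | _ => 0
  | .fire (.transfer h j hj) _ => fun s => match s with
    | .fired t' _ => tok (t' = .transfer h j hj)
    | .base (.transferOut h' j' _) => tok (h' = h ∧ j' = j)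
    | _ => 0
  | .undo ω t _ => fun s => match s with
    | .keep ω' t' _ => tok (ω' = ω ∧ t' = t)
    | .take _ t' _ _ => tok (t' = t)
    | _ => 0
  | .undoFar f t _ _ => fun s => match s with
    | .took f' t' _ _ => tok (f' = f ∧ t' = t)
    | _ => 0
  | .undone (.initialise j) _ => fun s => match s with
    | .rho t' _ => tok (t' = .initialise j)
    | .base (.copy p j' _) => N.pre j p * tok (j' = j)
    | _ => 0
  | .undone (.transfer h j hj) _ => fun s => match s with
    | .rho t' _ => tok (t' = .transfer h j hj)
    | .base (.transferIn h' j' _) => tok (h' = h ∧ j' = j)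
    | _ => 0
  | .reset ω (.initialise j) _ => fun s => match s with
    | .base (.ready j') => tok (j' = j)
    | .base (.ack ω' t' _) => tok (ω' = ω ∧ t' = .initialise j)
    | _ => 0
  | .reset ω (.transfer h j hj) _ => fun s => match s with
    | .base (.permit h' j' _) => tok (h' = h ∧ j' = j)
    | .base (.ack ω' t' _) => tok (ω' = ω ∧ t' = .transfer h j hj)
    | _ => 0
  | .elide ω t _ => fun s => match s with
    | .base (.ack ω' t' _) => tok (ω' = ω ∧ t' = t)
    | _ => 0
  | _ => fun _ => 0

theorem setMultiset_apply {X : Type*} (A : Set X) (x : X) : setMultiset A x = tok (x ∈ A) := by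
  classical
  simp [setMultiset, tok, Set.indicator_apply]

theorem tok_true {P : Prop} (h : P) : tok P = 1 := by simp [tok, h]

theorem tok_false {P : Prop} (h : ¬ P) : tok P = 0 := by simp [tok, h]

@[simp] theorem tok_False : tok False = 0 := by simp [tok]

@[simp] theorem tok_True : tok True = 1 := by simp [tok]

theorem tok_congr {P Q : Prop} (h : P ↔ Q) : tok P = tok Q := congrArg tok (propext h)

theorem tok_le_tok {P Q : Prop} : tok P ≤ tok Q ↔ (P → Q) := by
  by_cases P <;> by_cases Q <;> simp_all [tok]

theorem tok_ite (P : Prop) [Decidable P] (n : ℕ) : (if P then n else 0) = n * tok P := by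
  by_cases h : P <;> simp [tok, h]

theorem reversible_iff {t : N.ImplTrans} : N.implRev.Reversible t ↔
    (∃ j, t = .initialise j) ∨ ∃ h j hj, t = .transfer h j hj := by
  constructor
  · rintro ⟨ω, (⟨c, -, rfl⟩ | ⟨b, c, h, -, rfl⟩)⟩
    exacts [Or.inl ⟨_, rfl⟩, Or.inr ⟨_, _, _, rfl⟩]
  · rintro (⟨j, rfl⟩ | ⟨h, j, hj, rfl⟩)
    exacts [⟨j, Or.inl ⟨j, Or.inr rfl, rfl⟩⟩, ⟨j, Or.inr ⟨h, j, hj, Or.inr rfl, rfl⟩⟩]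

theorem far_eq_one {t : N.ImplTrans} {f : N.ImplPlace} (h : implFlow t .far f ≠ 0) :
    implFlow t .far f = 1 := by
  cases t <;> simp_all [implFlow, setMultiset_apply, tok]

theorem setMultiset_fun {X : Type*} (A : Set X) : setMultiset A = fun x => tok (x ∈ A) :=
  funext (setMultiset_apply A)

theorem expandPre_eq (t : N.implRev.Trans) : RevNet.expandPre t = ipre t := by
  funext s
  rcases t with ⟨t, ht⟩ | ⟨t, ht⟩ | ⟨ω, t, ht⟩ | ⟨f, t, ht, hf⟩ | ⟨t, ht⟩ | ⟨ω, t, ht⟩ | ⟨ω, t, ht⟩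
  · rcases s with s | s | s | s | s | s
    · change implFlow t .inn s = _
      rcases t <;> rcases s
      all_goals simp [ipre, implFlow, setMultiset_fun]
      all_goals exact tok_congr (by grind)
    all_goals rcases t <;> rfl
  · rcases reversible_iff.1 ht with ⟨j, rfl⟩ | ⟨h, j, hj, rfl⟩
    · rcases s with s | s | s | s | s | s
      · change implFlow (N := N) (.initialise j) .inn s +
        implFlow (N := N) (.initialise j) .early s + implFlow (N := N) (.initialise j) .late s = _
        rcases s
        all_goals simp [ipre, implFlow, setMultiset_fun, liftCopy, tok_ite]
      all_goals simp [RevNet.expandPre, RevNet.lift, ipre]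
    · rcases s with s | s | s | s | s | s
      · change implFlow (N := N) (.transfer h j hj) .inn s +
        implFlow (N := N) (.transfer h j hj) .early s +
          implFlow (N := N) (.transfer h j hj) .late s = _
        rcases s
        all_goals simp [ipre, implFlow, setMultiset_fun]
        all_goals exact tok_congr (by grind)
      all_goals simp [RevNet.expandPre, RevNet.lift, ipre]
  · rcases s with (_|_|_|_|_|_|_|_|_|_|_|_) | s | s | s | s | s
    all_goals simp [RevNet.expandPre, ipre, setMultiset_apply]
    all_goals try simp [implRev]
    · exact tok_congr ⟨by rintro ⟨⟩; exact ⟨rfl, rfl⟩, by rintro ⟨rfl, rfl⟩; rfl⟩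
    · exact tok_congr ⟨by rintro ⟨⟩; rfl, by rintro ⟨⟩; rfl⟩
  · rcases s with s | s | s | s | s | s
    · have h1 : N.implRev.flow t .far f = 1 := far_eq_one hf
      simp [RevNet.expandPre, ipre, setMultiset_apply, h1]
    all_goals simp [RevNet.expandPre, ipre, setMultiset_apply]
  · rcases s with s | s | s | s | s | s
    rotate_left 4
    · simp only [RevNet.expandPre, setMultiset_apply, ipre]
      refine tok_congr ⟨?_, ?_⟩
      · rintro ⟨f, hf, h⟩
        cases h
        rfl
      · rintro rfl
        exact ⟨_, _, rfl⟩
    all_goals simp [RevNet.expandPre, ipre, setMultiset_apply]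
  · rcases s with (_|_|_|_|_|_|_|_|_|_|_|_) | s | s | s | s | s
    all_goals simp [RevNet.expandPre, ipre, setMultiset_apply]
    all_goals try simp [implRev]
    · exact tok_congr ⟨by rintro ⟨⟩; exact ⟨rfl, rfl⟩, by rintro ⟨rfl, rfl⟩; rfl⟩
    · exact tok_congr ⟨by rintro ⟨⟩; rfl, by rintro ⟨⟩; rfl⟩
  · rcases s with (_|_|_|_|_|_|_|_|_|_|_|_) | s | s | s | s | s
    all_goals simp [RevNet.expandPre, ipre, setMultiset_apply]
    all_goals try simp [implRev]
    all_goals exact tok_congr ⟨by rintro ⟨⟩; exact ⟨rfl, rfl⟩, by rintro ⟨rfl, rfl⟩; rfl⟩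

theorem expandPost_eq (t : N.implRev.Trans) : RevNet.expandPost t = ipost t := by
  funext s
  rcases t with ⟨t, ht⟩ | ⟨t, ht⟩ | ⟨ω, t, ht⟩ | ⟨f, t, ht, hf⟩ | ⟨t, ht⟩ | ⟨ω, t, ht⟩ | ⟨ω, t, ht⟩
  · rcases s with s | s | s | s | s | s
    · change implFlow t .out s = _
      rcases t <;> rcases s
      all_goals simp [ipost, implFlow, setMultiset_fun, liftOrig]
      all_goals exact tok_congr (by grind)
    all_goals rcases t <;> rfl
  · rcases reversible_iff.1 ht with ⟨j, rfl⟩ | ⟨h, j, hj, rfl⟩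
    · rcases s with s | s | s | s | s | s
      · change setMultiset _ (RevNet.Place.base (R := N.implRev) s) +
        (implFlow (N := N) (.initialise j) .out s + implFlow (N := N) (.initialise j) .far s) = _
        rcases s
        all_goals simp [ipost, implFlow, setMultiset_fun]
        all_goals exact tok_congr (by grind)
      all_goals simp [RevNet.expandPost, RevNet.lift, ipost, setMultiset_apply]
      all_goals exact tok_congr ⟨by rintro ⟨⟩; rfl, by rintro ⟨⟩; rfl⟩
    · rcases s with s | s | s | s | s | s
      · change setMultiset _ (RevNet.Place.base (R := N.implRev) s) +
        (implFlow (N := N) (.transfer h j hj) .out s +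
          implFlow (N := N) (.transfer h j hj) .far s) = _
        rcases s
        all_goals simp [ipost, implFlow, setMultiset_fun]
      all_goals simp [RevNet.expandPost, RevNet.lift, ipost, setMultiset_apply]
      all_goals exact tok_congr ⟨by rintro ⟨⟩; rfl, by rintro ⟨⟩; rfl⟩
  · rcases s with s | s | s | s | s | s
    rotate_left 3
    · simp only [RevNet.expandPost, Pi.add_apply, setMultiset_apply, ipost]
      rw [tok_false (by simp), zero_add]
      refine tok_congr ⟨?_, ?_⟩
      · rintro ⟨f, hf, h⟩
        cases h
        rfl
      · rintro rfl
        exact ⟨_, _, rfl⟩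
    all_goals simp [RevNet.expandPost, ipost, setMultiset_apply]
  · rcases s with s | s | s | s | s | s
    all_goals simp [RevNet.expandPost, ipost, setMultiset_apply]
  · rcases reversible_iff.1 ht with ⟨j, rfl⟩ | ⟨h, j, hj, rfl⟩
    · rcases s with s | s | s | s | s | s
      · change setMultiset _ (RevNet.Place.base (R := N.implRev) s) +
        implFlow (N := N) (.initialise j) .early s = _
        rcases s
        all_goals simp [ipost, implFlow, setMultiset_fun, liftCopy, tok_ite]
      all_goals simp [RevNet.expandPost, RevNet.lift, ipost, setMultiset_apply]
      all_goals exact tok_congr ⟨by rintro ⟨⟩; rfl, by rintro ⟨⟩; rfl⟩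
    · rcases s with s | s | s | s | s | s
      · change setMultiset _ (RevNet.Place.base (R := N.implRev) s) +
        implFlow (N := N) (.transfer h j hj) .early s = _
        rcases s
        all_goals simp [ipost, implFlow, setMultiset_fun]
      all_goals simp [RevNet.expandPost, RevNet.lift, ipost, setMultiset_apply]
      all_goals exact tok_congr ⟨by rintro ⟨⟩; rfl, by rintro ⟨⟩; rfl⟩
  · rcases reversible_iff.1 ⟨ω, ht⟩ with ⟨j, rfl⟩ | ⟨h, j, hj, rfl⟩
    · rcases s with s | s | s | s | s | s
      · change implFlow (N := N) (.initialise j) .late s +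
          setMultiset {RevNet.Place.base (ImplPlace.ack _ _ ht)} (RevNet.Place.base (R := N.implRev) s) = _
        rcases s
        all_goals simp [ipost, implFlow, setMultiset_fun]
        all_goals try simp [implRev]
        all_goals exact tok_congr ⟨by rintro ⟨⟩; exact ⟨rfl, rfl⟩, by rintro ⟨rfl, rfl⟩; rfl⟩
      all_goals simp [RevNet.expandPost, RevNet.lift, ipost, setMultiset_apply]
    · rcases s with s | s | s | s | s | s
      · change implFlow (N := N) (.transfer h j hj) .late s +
          setMultiset {RevNet.Place.base (ImplPlace.ack _ _ ht)} (RevNet.Place.base (R := N.implRev) s) = _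
        rcases s
        all_goals simp [ipost, implFlow, setMultiset_fun]
        all_goals try simp [implRev]
        all_goals exact tok_congr ⟨by rintro ⟨⟩; exact ⟨rfl, rfl⟩, by rintro ⟨rfl, rfl⟩; rfl⟩
      all_goals simp [RevNet.expandPost, RevNet.lift, ipost, setMultiset_apply]
  · rcases s with (_|_|_|_|_|_|_|_|_|_|_|_) | s | s | s | s | s
    all_goals simp [RevNet.expandPost, ipost, setMultiset_apply]
    all_goals try simp [implRev]
    all_goals exact tok_congr ⟨by rintro ⟨⟩; exact ⟨rfl, rfl⟩, by rintro ⟨rfl, rfl⟩; rfl⟩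

end PetriNet

/-! ### Enabledness of the transitions of the implementation -/

namespace PetriNet

variable {Act : Type u} {N : PetriNet.{u, v, w} Act} [LT N.T]

/-- A property of places of the implementation, split into one condition for each kind of place. -/
theorem forall_place {P : N.implRev.Place → Prop} : (∀ s, P s) ↔
    (∀ p, P (.base (.orig p))) ∧ (∀ p j h, P (.base (.copy p j h))) ∧
    (∀ j, P (.base (.ready j))) ∧ (∀ j k h, P (.base (.enabling j k h))) ∧
    (∀ h j hj, P (.base (.transferIn h j hj))) ∧ (∀ h j hj, P (.base (.transferOut h j hj))) ∧
    (∀ j l h, P (.base (.permit j l h))) ∧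
    (∀ i j hij p c hi hc, P (.base (.fetchIn i j hij p c hi hc))) ∧
    (∀ i j hij p c hi hc, P (.base (.fetchOut i j hij p c hi hc))) ∧
    (∀ i t h, P (.base (.undo i t h))) ∧ (∀ i t h, P (.base (.reset i t h))) ∧
    (∀ i t h, P (.base (.ack i t h))) ∧
    (∀ t : N.ImplTrans, ∀ h, P (.fired t h)) ∧
    (∀ ω : N.T, ∀ t : N.ImplTrans, ∀ h, P (.keep ω t h)) ∧
    (∀ f : N.ImplPlace, ∀ t : N.ImplTrans, ∀ h hf, P (.take f t h hf)) ∧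
    (∀ f : N.ImplPlace, ∀ t : N.ImplTrans, ∀ h hf, P (.took f t h hf)) ∧
    (∀ t : N.ImplTrans, ∀ h, P (.rho t h)) := by
  constructor
  · intro h
    refine ⟨?_, ?_, ?_, ?_, ?_, ?_, ?_, ?_, ?_, ?_, ?_, ?_, ?_, ?_, ?_, ?_, ?_⟩
    all_goals intros; apply h
  · rintro ⟨h1, h2, h3, h4, h5, h6, h7, h8, h9, h10, h11, h12, h13, h14, h15, h16, h17⟩
    rintro ((_|_|_|_|_|_|_|_|_|_|_|_) | _ | _ | _ | _ | _)
    exacts [h1 _, h2 _ _ _, h3 _, h4 _ _ _, h5 _ _ _, h6 _ _ _, h7 _ _ _, h8 _ _ _ _ _ _ _,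
      h9 _ _ _ _ _ _ _, h10 _ _ _, h11 _ _ _, h12 _ _ _, h13 _ _, h14 _ _ _, h15 _ _ _ _,
      h16 _ _ _ _, h17 _ _]

theorem RState.isIdle_iff {r : RState N} : r.IsIdle ↔ r = .idle := by
  cases r <;> simp [RState.IsIdle]

theorem RState.isFired_iff {r : RState N} : r.IsFired ↔ r = .fired := by
  cases r <;> simp [RState.IsFired]

theorem RState.isUndone_keptBy {r : RState N} {ω : N.T} :
    r.KeptBy ω ∧ r.IsUndone ↔ r = .undone ω := by
  cases r <;> simp [RState.IsUndone, RState.KeptBy]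

theorem le_conc_dist {C : Config N} {p : N.S} {h ht} :
    ipre (.std (.distribute p h) ht) ≤ conc C ↔ 1 ≤ C.orig p := by
  rw [Pi.le_def, forall_place]
  simp [ipre, conc]
  grind [tok]

theorem le_conc_fire_ini {C : Config N} {j : N.T} {ht} :
    ipre (.fire (.initialise j) ht) ≤ conc C ↔
      (∀ p, N.pre j p ≠ 0 → N.pre j p ≤ C.copy p j) ∧ (C.rst (.initialise j)).IsIdle := by
  rw [Pi.le_def, forall_place]
  simp [ipre, conc, tok_le_tok]
  grind [tok]

theorem le_conc_fire_trans {C : Config N} {h j : N.T} {hj : N.LtC h j} {ht} :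
    ipre (.fire (.transfer h j hj) ht) ≤ conc C ↔
      ((C.rst (.initialise j)).Has (.transferIn h j hj) ∧ ¬ (C.rst (.transfer h j hj)).Holding) ∧
      (C.rst (.transfer h j hj)).IsIdle ∧ ∀ i, ¬ (C.ph i).Locks h := by
  rw [Pi.le_def, forall_place]
  simp [ipre, conc, tok_le_tok]
  grind [LeC]

theorem le_conc_undo {C : Config N} {ω : N.T} {t : N.ImplTrans} {h : t ∈ N.undoSet ω} :
    ipre (.undo ω t h) ≤ conc C ↔
      ((C.ph ω).Undo t ∧ ¬ (C.rst t).KeptBy ω) ∧ (C.rst t).IsFired := by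
  have hr : N.implRev.Reversible t := ⟨ω, h⟩
  rw [Pi.le_def, forall_place]
  simp [ipre, conc, tok_le_tok]
  grind

theorem le_conc_undoFar {C : Config N} {f : N.ImplPlace} {t : N.ImplTrans} {h hf} :
    ipre (.undoFar f t h hf) ≤ conc C ↔ (C.rst t).Take f ∧ 1 ≤ conc C (.base f) := by
  constructor
  · intro H
    constructor
    · have h1 := H (.take f t h hf)
      simp only [ipre, conc, tok_le_tok] at h1
      exact h1 ⟨rfl, rfl⟩
    · exact (tok_true rfl).symm.le.trans (H (.base f))
  · rintro ⟨h1, h2⟩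
    rintro (s | s | s | s | s | s)
    · by_cases hs : s = f
      · subst hs; simpa [ipre] using h2
      · simp [ipre, tok_false hs]
    all_goals simp [ipre, conc, tok_le_tok]
    rintro rfl rfl
    exact h1

theorem le_conc_undone {C : Config N} {t : N.ImplTrans} {h} :
    ipre (.undone t h) ≤ conc C ↔ ∀ f, implFlow t .far f ≠ 0 → (C.rst t).Took f := by
  rw [Pi.le_def, forall_place]
  simp [ipre, conc, tok_le_tok]
  constructor
  · intro H f hf
    exact H f t h hf rfl
  · rintro H f t h hf rfl
    exact H f hf

theorem le_conc_reset {C : Config N} {ω : N.T} {t : N.ImplTrans} {h : t ∈ N.undoSet ω} :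
    ipre (.reset ω t h) ≤ conc C ↔ (C.ph ω).Reset t ∧ C.rst t = .undone ω := by
  have hr : N.implRev.Reversible t := ⟨ω, h⟩
  rw [Pi.le_def, forall_place, ← RState.isUndone_keptBy]
  simp [ipre, conc, tok_le_tok]
  constructor
  · rintro ⟨h1, h2, h3⟩
    exact ⟨h1 _ _ h rfl rfl, h2 _ _ h rfl rfl, h3 _ hr rfl⟩
  · grind

theorem le_conc_elide {C : Config N} {ω : N.T} {t : N.ImplTrans} {h : t ∈ N.undoSet ω} :
    ipre (.elide ω t h) ≤ conc C ↔ (C.ph ω).Reset t ∧ ¬ (C.rst t).KeptBy ω := by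
  rw [Pi.le_def, forall_place]
  simp [ipre, conc, tok_le_tok]
  have : (C.ph ω).Reset t → (C.ph ω).Undo t := by
    cases C.ph ω <;> simp [TPhase.Reset, TPhase.Undo]
  grind

theorem le_conc_fetch {C : Config N} {i j : N.T} {hij} {p : N.S} {c : N.T} {hi hc ht} :
    ipre (.std (.fetch i j hij p c hi hc) ht) ≤ conc C ↔
      (C.ph i).FetchIn j p c ∧ N.pre i p ≤ C.copy p c := by
  rw [Pi.le_def, forall_place]
  simp [ipre, conc, tok_le_tok]
  grind [tok]

theorem le_conc_fetched {C : Config N} {i j : N.T} {hij ht} :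
    ipre (.std (.fetched i j hij) ht) ≤ conc C ↔
      ∀ p c, N.pre i p ≠ 0 → N.pre c p ≠ 0 → (C.ph i).FetchOut j p c := by
  rw [Pi.le_def, forall_place]
  simp [ipre, conc, tok_le_tok]
  grind

theorem le_conc_complete {C : Config N} {i : N.T} {ht} :
    ipre (.std (.complete i) ht) ≤ conc C ↔ ∀ t ∈ N.undoSet i, (C.ph i).Ack t := by
  rw [Pi.le_def, forall_place]
  simp [ipre, conc, tok_le_tok]
  grind

theorem le_conc_exec {C : Config N} {i j : N.T} {hij ht} :
    ipre (.std (.execute i j hij) ht) ≤ conc C ↔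
      ((C.rst (.initialise i)).Has (.enabling i j hij) ∧ ¬ (C.ph i).ExecAt j) ∧
      (∀ h hj, (C.rst (.transfer h j hj)).Has (.transferOut h j hj) ∧
        ∀ i, ¬ (C.ph i).ExecAt j) ∧
      ∀ l, N.LeC j l → (∀ h, (C.rst (.transfer j l h)).IsIdle) ∧ ∀ i, ¬ (C.ph i).Locks j := by
  rw [Pi.le_def, forall_place]
  simp [ipre, conc, tok_le_tok]
  grind

end PetriNet

/-! ### Updates of configurations and the invariant -/

namespace PetriNet

variable {Act : Type u} {N : PetriNet.{u, v, w} Act} [LT N.T]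

open Classical in
/-- Change the control state of the reversible transition `t` to `r`. -/
noncomputable def Config.setRst (C : Config N) (t : N.ImplTrans) (r : RState N) : Config N :=
  { C with rst := fun t' => if t' = t then r else C.rst t' }

open Classical in
/-- Change the phase of the transition `i` to `P`. -/
noncomputable def Config.setPh (C : Config N) (i : N.T) (P : TPhase N) : Config N :=
  { C with ph := fun i' => if i' = i then P else C.ph i' }

open Classical in
/-- The transition `dist_p` fires: one token of `p` is replaced by one on each copy `p_c`. -/
noncomputable def Config.dist (C : Config N) (p : N.S) : Config N :=
  { C with
    orig := fun q => if q = p then C.orig q - 1 else C.orig q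
    copy := fun q c => if q = p then C.copy q c + 1 else C.copy q c }

open Classical in
/-- The transition `ini_j·fire` fires and consumes tokens of the copies `p_j`. -/
noncomputable def Config.fireIni (C : Config N) (j : N.T) : Config N :=
  { C.setRst (.initialise j) .fired with
    copy := fun q c => if c = j then C.copy q c - N.pre j q else C.copy q c }

open Classical in
/-- The transition `ini_j·undone` fires, on behalf of the interface `ω`, and returns the tokens
of the copies `p_j`. -/
noncomputable def Config.undoneIni (C : Config N) (j ω : N.T) : Config N :=
  { C.setRst (.initialise j) (.undone ω) with
    copy := fun q c => if c = j then C.copy q c + N.pre j q else C.copy q c }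

/-- The transition `t·reset_ω` fires, where the transitions in `A` have been acknowledged to `ω`
before. -/
noncomputable def Config.reset (C : Config N) (ω : N.T) (t : N.ImplTrans) (A : Set N.ImplTrans) :
    Config N :=
  (C.setRst t .idle).setPh ω (.resetting (insert t A))

open Classical in
/-- The transition `fetch^{p,c}_{i,j}` fires, where the tokens for the pairs in `D` have been
fetched before. -/
noncomputable def Config.fetch (C : Config N) (i j : N.T) (p : N.S) (c : N.T)
    (D : Set (N.S × N.T)) : Config N :=
  { C.setPh i (.fetching j (insert (p, c) D)) with
    copy := fun q d => if q = p ∧ d = c then C.copy q d - N.pre i q else C.copy q d }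

open Classical in
/-- The transition `complete_i` fires; only now the firing of `i` is accounted for in `mt`. -/
noncomputable def Config.complete (C : Config N) (i : N.T) : Config N :=
  { C.setPh i .idle with
    orig := fun q => C.orig q + N.post i q
    mt := fun q => C.mt q - N.pre i q + N.post i q
    act := C.act.erase i }

open Classical in
/-- The transition `exec^i_j` starts. -/
noncomputable def Config.exec (C : Config N) (i j : N.T) : Config N :=
  { C.setPh i (.exec j) with act := insert i C.act }

/-- The invariant of the configurations that describe reachable states. -/
structure Config.WF (C : Config N) : Prop where
  reach : N.Reachable C.mt
  mem_act : ∀ k, k ∈ C.act ↔ C.ph k ≠ .idle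
  act_le : ∀ k ∈ C.act, N.pre k ≤ C.mt
  act_disj : ∀ k ∈ C.act, ∀ k' ∈ C.act, N.ConflictEq k k' → k = k'
  /-- active transitions are located at enabled transitions -/
  loc : ∀ k j, (C.ph k).Locks j → N.LeC k j ∧ N.pre j ≤ C.mt
  /-- `t` is undone only from interfaces linked to it that still have to reset it -/
  kept : ∀ ω t, (C.rst t).KeptBy ω → (C.ph ω).Undo t ∧ t ∈ N.undoSet ω
  /-- a fired `trans^h_j` uses the token on `trans^h_j-in` that `ini_j` produced -/
  hold : ∀ h j hj, (C.rst (.transfer h j hj)).Holding →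
    (C.rst (.initialise j)).Has (.transferIn h j hj)
  /-- the token on `pre^i_j` that `exec^i_j` is using was produced by `ini_i` -/
  exec_ini : ∀ i j hij, (C.ph i).ExecAt j → (C.rst (.initialise i)).Has (.enabling i j hij)
  /-- the tokens on `trans^h_j-out` that `exec^i_j` is using were produced by `trans^h_j` -/
  exec_trans : ∀ i j, (C.ph i).ExecAt j →
    ∀ h hj, (C.rst (.transfer h j hj)).Has (.transferOut h j hj)
  /-- the token of `π_{j#l}` is not used by `trans^j_l` while it is used at the location `j` -/
  lock_idle : ∀ k j, (C.ph k).Locks j → ∀ l h, C.rst (.transfer j l h) = .idle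
  /-- each location is used by at most one transition -/
  lock_unique : ∀ k k' j, (C.ph k).Locks j → (C.ph k').Locks j → k = k'
  /-- the token of `π_{h#l}` is used by `trans^h_l` while the location `l` is in use -/
  lock_held : ∀ k l, (C.ph k).Locks l → ∀ h hl, C.rst (.transfer h l hl) ≠ .idle
  /-- the token balance of the copy `p_c` -/
  tokens : ∀ p c, N.pre c p ≠ 0 →
    C.orig p + C.copy p c + N.pre c p * tok (C.rst (.initialise c)).Holding +
      ∑ k ∈ C.act, N.pre k p * tok ((C.ph k).Fetched p c) = C.mt p

theorem TPhase.ExecAt.locks {P : TPhase N} {j : N.T} (h : P.ExecAt j) : P.Locks j := by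
  cases P <;> simp_all [TPhase.ExecAt, TPhase.Locks]

/-! ### Effects of the transitions of the implementation -/

/-! Each lemma states `conc C' + ipre t = conc C + ipost t`, where `C'` is the configuration after `t`.
For `exec^i_j`, whose start and end are separate events, there is one lemma for each of them. -/

theorem effect_dist {C : Config N} {p : N.S} {h ht} (h1 : 1 ≤ C.orig p) (s) :
    conc (C.dist p) s + ipre (.std (.distribute p h) ht) s =
      conc C s + ipost (.std (.distribute p h) ht) s := by
  revert s
  rw [forall_place]
  simp [ipre, ipost, conc, Config.dist]
  grind [tok]

theorem effect_fire_ini {C : Config N} (W : C.WF) {j : N.T} {ht}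
    (h1 : ∀ p, N.pre j p ≠ 0 → N.pre j p ≤ C.copy p j) (h2 : C.rst (.initialise j) = .idle) (s) :
    conc (C.fireIni j) s + ipre (.fire (.initialise j) ht) s =
      conc C s + ipost (.fire (.initialise j) ht) s := by
  have h3 : ∀ h hj, ¬ (C.rst (.transfer h j hj)).Holding := by
    intro h hj hh
    simpa [h2, RState.Has] using W.hold h j hj hh
  have h4 : ∀ k, N.LeC j k → ¬ (C.ph j).ExecAt k := by
    intro k hk hh
    simpa [h2, RState.Has] using W.exec_ini j k hk hh
  revert s
  rw [forall_place]
  simp [ipre, ipost, conc, Config.fireIni, Config.setRst]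
  repeat' apply And.intro
  all_goals grind [tok, RState.Has, RState.Holding, RState.KeptBy, RState.Take, RState.Took,
    RState.IsIdle, RState.IsUndone, RState.IsFired]

theorem effect_fire_trans {C : Config N} (W : C.WF) {h j : N.T} {hj : N.LtC h j} {ht}
    (h1 : (C.rst (.initialise j)).Has (.transferIn h j hj))
    (h2 : C.rst (.transfer h j hj) = .idle) (h3 : ∀ i, ¬ (C.ph i).Locks h) (s) :
    conc (C.setRst (.transfer h j hj) .fired) s + ipre (.fire (.transfer h j hj) ht) s =
      conc C s + ipost (.fire (.transfer h j hj) ht) s := by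
  have h4 : ∀ i, ¬ (C.ph i).ExecAt j := by
    intro i hi
    simpa [h2, RState.Has] using W.exec_trans i j hi h hj
  revert s
  rw [forall_place]
  simp [ipre, ipost, conc, Config.setRst]
  repeat' apply And.intro
  all_goals grind [tok, RState.Has, RState.Holding, RState.KeptBy, RState.Take, RState.Took,
    RState.IsIdle, RState.IsUndone, RState.IsFired]

theorem effect_undo {C : Config N} {ω : N.T} {t : N.ImplTrans} {h : t ∈ N.undoSet ω}
    (h1 : (C.ph ω).Undo t) (h2 : C.rst t = .fired) (s) :
    conc (C.setRst t (.undoing ω ∅)) s + ipre (.undo ω t h) s =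
      conc C s + ipost (.undo ω t h) s := by
  revert s
  rw [forall_place]
  simp [ipre, ipost, conc, Config.setRst]
  repeat' apply And.intro
  all_goals grind [tok, RState.Has, RState.Holding, RState.KeptBy, RState.Take, RState.Took,
    RState.IsIdle, RState.IsUndone, RState.IsFired]

theorem effect_undoFar_enabling {C : Config N} {j k ω : N.T} {hk : N.LeC j k}
    {A : Set N.ImplPlace} {h hf}
    (h1 : C.rst (.initialise j) = .undoing ω A) (h2 : .enabling j k hk ∉ A) (h3 : ¬
    (C.ph j).ExecAt k) (s) :
    conc (C.setRst (.initialise j) (.undoing ω (insert (.enabling j k hk) A))) s +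
      ipre (.undoFar (.enabling j k hk) (.initialise j) h hf) s =
      conc C s + ipost (.undoFar (.enabling j k hk) (.initialise j) h hf) s := by
  revert s
  rw [forall_place]
  simp [ipre, ipost, conc, Config.setRst]
  repeat' apply And.intro
  all_goals grind [tok, RState.Has, RState.Holding, RState.KeptBy, RState.Take, RState.Took,
    RState.IsIdle, RState.IsUndone, RState.IsFired]

theorem effect_undoFar_transferIn {C : Config N} {h j ω : N.T} {hj : N.LtC h j}
    {A : Set N.ImplPlace} {hr hf}
    (h1 : C.rst (.initialise j) = .undoing ω A) (h2 : .transferIn h j hj ∉ A)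
    (h3 : ¬ (C.rst (.transfer h j hj)).Holding) (s) :
    conc (C.setRst (.initialise j) (.undoing ω (insert (.transferIn h j hj) A))) s +
      ipre (.undoFar (.transferIn h j hj) (.initialise j) hr hf) s =
      conc C s + ipost (.undoFar (.transferIn h j hj) (.initialise j) hr hf) s := by
  revert s
  rw [forall_place]
  simp [ipre, ipost, conc, Config.setRst]
  repeat' apply And.intro
  all_goals grind [tok, RState.Has, RState.Holding, RState.KeptBy, RState.Take, RState.Took,
    RState.IsIdle, RState.IsUndone, RState.IsFired]

theorem effect_undoFar_transferOut {C : Config N} {h j ω : N.T} {hj : N.LtC h j}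
    {A : Set N.ImplPlace} {hr hf}
    (h1 : C.rst (.transfer h j hj) = .undoing ω A) (h2 : .transferOut h j hj ∉ A)
    (h3 : ∀ i, ¬ (C.ph i).ExecAt j) (s) :
    conc (C.setRst (.transfer h j hj) (.undoing ω (insert (.transferOut h j hj) A))) s +
      ipre (.undoFar (.transferOut h j hj) (.transfer h j hj) hr hf) s =
      conc C s + ipost (.undoFar (.transferOut h j hj) (.transfer h j hj) hr hf) s := by
  revert s
  rw [forall_place]
  simp [ipre, ipost, conc, Config.setRst]
  repeat' apply And.intro
  all_goals grind [tok, RState.Has, RState.Holding, RState.KeptBy, RState.Take, RState.Took,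
    RState.IsIdle, RState.IsUndone, RState.IsFired]

theorem effect_undone_ini {C : Config N} {j ω : N.T} {A : Set N.ImplPlace} {ht}
    (h1 : C.rst (.initialise j) = .undoing ω A)
    (h2 : ∀ f, implFlow (.initialise j) .far f ≠ 0 → f ∈ A) (s) :
    conc (C.undoneIni j ω) s + ipre (.undone (.initialise j) ht) s =
      conc C s + ipost (.undone (.initialise j) ht) s := by
  have h5 : ∀ f : N.ImplPlace, N.implRev.flow (.initialise j : N.ImplTrans) .far f ≠ 0 → f ∈ A := h2
  have h3 : ∀ h hj, .transferIn h j hj ∈ A := fun h hj => h2 _ (by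
    simp [implFlow, setMultiset_apply, tok, hj])
  have h4 : ∀ k hk, .enabling j k hk ∈ A := fun h hj => h2 _ (by
    simp [implFlow, setMultiset_apply, tok, hj])
  revert s
  rw [forall_place]
  simp [ipre, ipost, conc, Config.undoneIni, Config.setRst]
  repeat' apply And.intro
  all_goals grind [tok, RState.Has, RState.Holding, RState.KeptBy, RState.Take, RState.Took,
    RState.IsIdle, RState.IsUndone, RState.IsFired]

theorem effect_undone_trans {C : Config N} (W : C.WF) {h j ω : N.T} {hj : N.LtC h j}
    {A : Set N.ImplPlace} {ht}
    (h1 : C.rst (.transfer h j hj) = .undoing ω A)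
    (h2 : ∀ f, implFlow (.transfer h j hj) .far f ≠ 0 → f ∈ A) (s) :
    conc (C.setRst (.transfer h j hj) (.undone ω)) s + ipre (.undone (.transfer h j hj) ht) s =
      conc C s + ipost (.undone (.transfer h j hj) ht) s := by
  have h5 : ∀ f : N.ImplPlace, N.implRev.flow (.transfer h j hj : N.ImplTrans) .far f ≠ 0 → f ∈ A :=
    h2
  have h3 : .transferOut h j hj ∈ A := h2 _ (by simp [implFlow, setMultiset_apply, tok])
  have h4 := W.hold h j hj (by simp [h1, RState.Holding])
  revert s
  rw [forall_place]
  simp [ipre, ipost, conc, Config.setRst]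
  repeat' apply And.intro
  all_goals grind [tok, RState.Has, RState.Holding, RState.KeptBy, RState.Take, RState.Took,
    RState.IsIdle, RState.IsUndone, RState.IsFired]

theorem effect_reset_ini {C : Config N} {j ω : N.T} {A : Set N.ImplTrans} {ht}
    (h1 : C.ph ω = .resetting A) (h2 : .initialise j ∉ A) (h3 : C.rst (.initialise j) = .undone ω)
    (s) :
    conc (C.reset ω (.initialise j) A) s + ipre (.reset ω (.initialise j) ht) s =
      conc C s + ipost (.reset ω (.initialise j) ht) s := by
  revert s
  rw [forall_place]
  simp [ipre, ipost, conc, Config.reset, Config.setRst, Config.setPh]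
  repeat' apply And.intro
  all_goals grind [tok, RState.Has, RState.Holding, RState.KeptBy, RState.Take, RState.Took,
    RState.IsIdle, RState.IsUndone, RState.IsFired, TPhase.ExecAt, TPhase.Locks, TPhase.FetchIn,
    TPhase.FetchOut, TPhase.Undo, TPhase.Reset, TPhase.Ack]

theorem effect_reset_trans {C : Config N} (W : C.WF) {h j ω : N.T} {hj : N.LtC h j}
    {A : Set N.ImplTrans} {ht}
    (h1 : C.ph ω = .resetting A) (h2 : .transfer h j hj ∉ A)
    (h3 : C.rst (.transfer h j hj) = .undone ω) (s) :
    conc (C.reset ω (.transfer h j hj) A) s + ipre (.reset ω (.transfer h j hj) ht) s =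
      conc C s + ipost (.reset ω (.transfer h j hj) ht) s := by
  have h4 : ∀ k, ¬ (C.ph k).Locks h := by
    intro k hk
    simpa [h3] using W.lock_idle k h hk j hj
  revert s
  rw [forall_place]
  simp [ipre, ipost, conc, Config.reset, Config.setRst, Config.setPh]
  repeat' apply And.intro
  all_goals grind [tok, RState.Has, RState.Holding, RState.KeptBy, RState.Take, RState.Took,
    RState.IsIdle, RState.IsUndone, RState.IsFired, TPhase.ExecAt, TPhase.Locks, TPhase.FetchIn,
    TPhase.FetchOut, TPhase.Undo, TPhase.Reset, TPhase.Ack]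

theorem effect_elide {C : Config N} {ω : N.T} {t : N.ImplTrans} {A : Set N.ImplTrans}
    {h : t ∈ N.undoSet ω}
    (h1 : C.ph ω = .resetting A) (h2 : t ∉ A) (h3 : ¬ (C.rst t).KeptBy ω) (s) :
    conc (C.setPh ω (.resetting (insert t A))) s + ipre (.elide ω t h) s =
      conc C s + ipost (.elide ω t h) s := by
  revert s
  rw [forall_place]
  simp [ipre, ipost, conc, Config.setPh]
  repeat' apply And.intro
  all_goals grind [tok, TPhase.ExecAt, TPhase.Locks, TPhase.FetchIn, TPhase.FetchOut, TPhase.Undo,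
    TPhase.Reset, TPhase.Ack]

theorem effect_fetch {C : Config N} {i j : N.T} {hij} {p : N.S} {c : N.T} {hi hc ht} {D : Set
    (N.S × N.T)}
    (h1 : C.ph i = .fetching j D) (h2 : (p, c) ∉ D) (h3 : N.pre i p ≤ C.copy p c) (s) :
    conc (C.fetch i j p c D) s + ipre (.std (.fetch i j hij p c hi hc) ht) s =
      conc C s + ipost (.std (.fetch i j hij p c hi hc) ht) s := by
  revert s
  rw [forall_place]
  simp [ipre, ipost, conc, Config.fetch, Config.setPh]
  repeat' apply And.intro
  all_goals grind [tok, TPhase.ExecAt, TPhase.Locks, TPhase.FetchIn, TPhase.FetchOut, TPhase.Undo,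
    TPhase.Reset, TPhase.Ack]

theorem effect_fetched {C : Config N} (W : C.WF) {i j : N.T} {hij} {ht} {D : Set (N.S × N.T)}
    (h1 : C.ph i = .fetching j D)
    (h2 : ∀ p c, N.pre i p ≠ 0 → N.pre c p ≠ 0 → (p, c) ∈ D) (s) :
    conc (C.setPh i (.resetting ∅)) s + ipre (.std (.fetched i j hij) ht) s =
      conc C s + ipost (.std (.fetched i j hij) ht) s := by
  have h3 : (C.ph i).Locks j := by simp [h1, TPhase.Locks]
  have h4 : ∀ l h, (C.rst (.transfer j l h)).IsIdle := by
    intro l h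
    simp [W.lock_idle i j h3 l h, RState.IsIdle]
  have h5 := fun k => W.lock_unique k i j
  revert s
  rw [forall_place]
  simp [ipre, ipost, conc, Config.setPh]
  repeat' apply And.intro
  all_goals grind [tok, TPhase.ExecAt, TPhase.Locks, TPhase.FetchIn, TPhase.FetchOut, TPhase.Undo,
    TPhase.Reset, TPhase.Ack]

theorem effect_complete {C : Config N} {i : N.T} {ht} {A : Set N.ImplTrans}
    (h1 : C.ph i = .resetting A) (h2 : ∀ t ∈ N.undoSet i, t ∈ A) (s) :
    conc (C.complete i) s + ipre (.std (.complete i) ht) s =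
      conc C s + ipost (.std (.complete i) ht) s := by
  revert s
  rw [forall_place]
  simp [ipre, ipost, conc, Config.complete, Config.setPh]
  repeat' apply And.intro
  all_goals grind [tok, TPhase.ExecAt, TPhase.Locks, TPhase.FetchIn, TPhase.FetchOut, TPhase.Undo,
    TPhase.Reset, TPhase.Ack]

theorem effect_exec {C : Config N} {i j : N.T} {hij ht} (h1 : C.ph i = .idle)
    (h2 : ipre (.std (.execute i j hij) ht) ≤ conc C) (s) :
    conc (C.exec i j) s + ipre (.std (.execute i j hij) ht) s = conc C s := by
  rw [le_conc_exec] at h2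
  obtain ⟨h2, h3, h4⟩ := h2
  revert s
  rw [forall_place]
  simp [ipre, conc, Config.exec, Config.setPh]
  repeat' apply And.intro
  all_goals grind [tok, TPhase.ExecAt, TPhase.Locks, TPhase.FetchIn, TPhase.FetchOut, TPhase.Undo,
    TPhase.Reset, TPhase.Ack]

theorem effect_finish {C : Config N} (W : C.WF) {i j : N.T} {hij ht} (h1 : C.ph i = .exec j) (s) :
    conc (C.setPh i (.fetching j ∅)) s =
      conc C s + ipost (.std (.execute i j hij) ht) s := by
  have h2 : (C.ph i).ExecAt j := by simp [h1, TPhase.ExecAt]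
  have h3 := W.exec_ini i j hij h2
  have h4 := W.exec_trans i j h2
  have h5 : ∀ k, (C.ph k).ExecAt j → k = i := fun k hk => W.lock_unique k i j hk.locks h2.locks
  have h6 : ∀ t, ¬ (C.rst t).KeptBy i := by
    intro t ht
    simpa [h1, TPhase.Undo] using (W.kept i t ht).1
  revert s
  rw [forall_place]
  simp [ipost, conc, Config.setPh]
  repeat' apply And.intro
  all_goals grind [tok, TPhase.ExecAt, TPhase.Locks, TPhase.FetchIn, TPhase.FetchOut, TPhase.Undo,
    TPhase.Reset, TPhase.Ack]

end PetriNet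

/-! ### Conflict in the original net -/

namespace PetriNet

section Conflict

variable {Act : Type u} {N : PetriNet.{u, v, w} Act}

theorem inf_pre_ne_zero {i j : N.T} :
    N.pre i ⊓ N.pre j ≠ 0 ↔ ∃ p, N.pre i p ≠ 0 ∧ N.pre j p ≠ 0 := by
  rw [Function.ne_iff]
  refine exists_congr fun p => ?_
  simp only [Pi.inf_apply, Pi.zero_apply]
  grind

theorem conflictEq_iff (hfin : N.IsFinitary) {i j : N.T} :
    N.ConflictEq i j ↔ ∃ p, N.pre i p ≠ 0 ∧ N.pre j p ≠ 0 := by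
  rw [← inf_pre_ne_zero]
  constructor
  · rintro (h | rfl)
    · exact h.2
    · simpa using hfin.1 i
  · intro h
    by_cases hij : i = j
    · exact Or.inr hij
    · exact Or.inl ⟨hij, h⟩

theorem ConflictEq.symm {i j : N.T} (h : N.ConflictEq i j) : N.ConflictEq j i := by
  rcases h with ⟨h1, h2⟩ | rfl
  · exact Or.inl ⟨h1.symm, by rwa [inf_comm]⟩
  · exact Or.inr rfl

/-- Without a fully reachable pure M, conflict is transitive on the transitions that are enabled
under one and the same reachable marking. -/
theorem ConflictEq.trans (hfin : N.IsFinitary) (hM : ¬ N.HasFullyReachablePureM) {M : N.S → ℕ}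
    (hr : N.Reachable M) {a b c : N.T} (ha : N.pre a ≤ M) (hb : N.pre b ≤ M) (hc : N.pre c ≤ M)
    (hab : N.ConflictEq a b) (hbc : N.ConflictEq b c) : N.ConflictEq a c := by
  rw [conflictEq_iff hfin, ← inf_pre_ne_zero] at *
  intro h
  exact hM ⟨a, b, c, hab, hbc, h, M, hr, sup_le (sup_le ha hb) hc⟩

theorem preOf_single (t : N.T) : N.preOf (Finsupp.single t 1) = N.pre t := by
  simp [preOf]

theorem postOf_single (t : N.T) : N.postOf (Finsupp.single t 1) = N.post t := by
  simp [postOf]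

theorem step_single {M M' : N.S → ℕ} {t : N.T} :
    N.Step M (Finsupp.single t 1) M' ↔ N.pre t ≤ M ∧ M' = M - N.pre t + N.post t := by
  simp [Step, preOf_single, postOf_single]

theorem enabled_single {M : N.S → ℕ} {t : N.T} :
    N.Enabled M (Finsupp.single t 1) ↔ N.pre t ≤ M := by
  simp [Enabled, step_single]

theorem enabled_pair {M : N.S → ℕ} {t u : N.T} :
    N.Enabled M (Finsupp.single t 1 + Finsupp.single u 1) ↔ N.pre t + N.pre u ≤ M := by
  have h1 : N.preOf (Finsupp.single t 1 + Finsupp.single u 1) = N.pre t + N.pre u := by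
    rw [preOf, Finsupp.sum_add_index', ← preOf, ← preOf, preOf_single, preOf_single]
    · simp
    · intros; rw [add_smul]
  have h2 : Finsupp.single t 1 + Finsupp.single u 1 ≠ (0 : N.T →₀ ℕ) := by
    classical
    intro h
    have := DFunLike.congr_fun h t
    simp at this
  simp [Enabled, Step, h1, h2]

/-- Transitions that are concurrently enabled are not in conflict. -/
theorem not_conflictEq_of_add_le (hfin : N.IsFinitary) (hscn : N.IsStructuralConflictNet)
    {M : N.S → ℕ} (hr : N.Reachable M) {t u : N.T} (h : N.pre t + N.pre u ≤ M) :
    ¬ N.ConflictEq t u := by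
  rw [conflictEq_iff hfin, ← inf_pre_ne_zero, not_not]
  exact hscn t u ⟨M, hr, enabled_pair.2 h⟩

end Conflict

/-! ### Consequences of the invariant -/

variable {Act : Type u} {N : PetriNet.{u, v, w} Act} [LT N.T] {C : Config N}

theorem RState.Has.holding {r : RState N} {f : N.ImplPlace} (h : r.Has f) : r.Holding := by
  cases r <;> simp_all [RState.Has, RState.Holding]

namespace Config.WF

theorem locks_mem (W : C.WF) {k j : N.T} (h : (C.ph k).Locks j) : k ∈ C.act := by
  rw [W.mem_act]
  intro h'
  simp [h', TPhase.Locks] at h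

theorem undo_mem (W : C.WF) {k : N.T} {t : N.ImplTrans} (h : (C.ph k).Undo t) : k ∈ C.act := by
  rw [W.mem_act]
  intro h'
  simp [h', TPhase.Undo] at h

/-- The tokens that an initialised transition holds are present in the represented marking. -/
theorem pre_le_of_holding (W : C.WF) {c : N.T} (h : (C.rst (.initialise c)).Holding) :
    N.pre c ≤ C.mt := by
  intro p
  by_cases hp : N.pre c p = 0
  · simp [hp]
  · have := W.tokens p c hp
    rw [tok_true h] at this
    lia

theorem pre_le_of_transfer_holding (W : C.WF) {h j : N.T} {hj : N.LtC h j}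
    (hh : (C.rst (.transfer h j hj)).Holding) : N.pre j ≤ C.mt :=
  W.pre_le_of_holding (W.hold h j hj hh).holding

/-- At most one active transition is in conflict with a given enabled transition. -/
theorem act_unique (W : C.WF) (hfin : N.IsFinitary) (hM : ¬ N.HasFullyReachablePureM)
    {c k k' : N.T} (hc : N.pre c ≤ C.mt) (hk : k ∈ C.act) (hk' : k' ∈ C.act)
    (h : N.ConflictEq c k) (h' : N.ConflictEq c k') : k = k' :=
  W.act_disj k hk k' hk' (h.symm.trans hfin hM W.reach (W.act_le k hk) hc (W.act_le k' hk') h')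

/-- A transition `k` that is resetting has fetched its tokens from all copies of its preplaces. If
`c` were initialised while in conflict with `k`, then by the token balance `c` and `k` would be
concurrent. -/
theorem not_holding_of_resetting (W : C.WF) (hfin : N.IsFinitary)
    (hscn : N.IsStructuralConflictNet) {k c : N.T} {A : Set N.ImplTrans}
    (hk : C.ph k = .resetting A) (hc : N.ConflictEq c k) :
    ¬ (C.rst (.initialise c)).Holding := by
  intro hh
  have hka : k ∈ C.act := by simp [W.mem_act, hk]
  refine not_conflictEq_of_add_le hfin hscn W.reach (t := c) (u := k) (fun p => ?_) hc
  rw [Pi.add_apply]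
  by_cases hp : N.pre c p = 0
  · rw [hp, zero_add]
    exact W.act_le k hka p
  · have h1 := W.tokens p c hp
    have h2 : N.pre k p * tok ((C.ph k).Fetched p c) ≤
        ∑ k ∈ C.act, N.pre k p * tok ((C.ph k).Fetched p c) :=
      Finset.single_le_sum (f := fun k => N.pre k p * tok ((C.ph k).Fetched p c))
        (fun _ _ => Nat.zero_le _) hka
    rw [tok_true (by simp [hk, TPhase.Fetched]), mul_one] at h2
    rw [tok_true hh] at h1
    lia

theorem locks_or_resetting (W : C.WF) {k : N.T} (hk : k ∈ C.act) :
    (∃ l, (C.ph k).Locks l) ∨ ∃ A, C.ph k = .resetting A := by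
  rw [W.mem_act] at hk
  cases h : C.ph k <;> simp_all [TPhase.Locks]

end Config.WF

end PetriNet

namespace PetriNet.Config.WF

variable {Act : Type u} {N : PetriNet.{u, v, w} Act} [LinearOrder N.T] {C : Config N}

/-- Whenever `exec^i_j` is enabled, both `i` and `j` are initialised. -/
theorem holding_of_exec {i j : N.T} {hij ht}
    (h : ipre (.std (.execute i j hij) ht) ≤ conc C) (W : C.WF) :
    (C.rst (.initialise i)).Holding ∧ (C.rst (.initialise j)).Holding := by
  rw [le_conc_exec] at h
  obtain ⟨⟨h1, -⟩, h2, -⟩ := h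
  refine ⟨h1.holding, ?_⟩
  rcases hij with hij | rfl
  · exact (W.hold i j hij (h2 i hij).1.holding).holding
  · exact h1.holding

/-- If `exec^i_j` is enabled, then no active transition is in conflict with `i`: a resetting one is
excluded because `ini_i` holds its tokens, and any other one owns a location that is equal to `j`
or in conflict with `j`. -/
theorem exec_conflict_free (W : C.WF) (hfin : N.IsFinitary) (hM : ¬ N.HasFullyReachablePureM)
    (hscn : N.IsStructuralConflictNet) {i j : N.T} {hij ht}
    (h : ipre (.std (.execute i j hij) ht) ≤ conc C) {k : N.T} (hk : k ∈ C.act) :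
    ¬ N.ConflictEq i k := by
  intro hik
  obtain ⟨hi, hj⟩ := W.holding_of_exec h
  rcases W.locks_or_resetting hk with ⟨l, hl⟩ | ⟨A, hA⟩
  · obtain ⟨hkl, hle⟩ := W.loc k l hl
    have hcl : N.ConflictEq k l := hkl.imp (fun h => h.2) id
    have hcj : N.ConflictEq i j := hij.imp (fun h => h.2) id
    have hi' := W.pre_le_of_holding hi
    have hj' := W.pre_le_of_holding hj
    have hk' := W.act_le k hk
    have hjl : N.ConflictEq j l :=
      ConflictEq.trans hfin hM W.reach hj' hi' hle hcj.symm
        (ConflictEq.trans hfin hM W.reach hi' hk' hle hik hcl)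
    rw [le_conc_exec] at h
    obtain ⟨-, h2, h3⟩ := h
    -- The locations `j` and `l` compete for one lock, which both would have to own.
    rcases lt_trichotomy j l with hlt | rfl | hlt
    · have hjl' : N.LtC j l := ⟨hlt, hjl.resolve_right hlt.ne⟩
      exact W.lock_held k l hl j hjl' (RState.isIdle_iff.1 ((h3 l (Or.inl hjl')).1 hjl'))
    · exact (h3 j (Or.inr rfl)).2 k hl
    · have hlj' : N.LtC l j := ⟨hlt, hjl.symm.resolve_right hlt.ne⟩
      have h4 := (h2 l hlj').1
      rw [W.lock_idle k l hl j hlj'] at h4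
      exact h4
  · exact W.not_holding_of_resetting hfin hscn hA hik hi

end PetriNet.Config.WF

/-! ### Preservation of the invariant -/

theorem Finset.sum_add_of_eq_off {ι : Type*} {s : Finset ι} {i : ι} (hi : i ∈ s) {f g : ι → ℕ}
    (h : ∀ k ≠ i, g k = f k) : ∑ k ∈ s, g k + f i = ∑ k ∈ s, f k + g i := by
  classical
  rw [← Finset.add_sum_erase s f hi, ← Finset.add_sum_erase s g hi,
    Finset.sum_congr rfl fun k hk => h k (Finset.ne_of_mem_erase hk)]
  lia

namespace PetriNet

variable {Act : Type u} {N : PetriNet.{u, v, w} Act} [LT N.T] {C C' : Config N}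

theorem Config.setRst_self (t : N.ImplTrans) (r : RState N) : (C.setRst t r).rst t = r := by
  simp [setRst]

theorem Config.setRst_of_ne {t t' : N.ImplTrans} (r : RState N) (h : t' ≠ t) :
    (C.setRst t r).rst t' = C.rst t' := by
  simp [setRst, h]

theorem Config.setPh_self (i : N.T) (P : TPhase N) : (C.setPh i P).ph i = P := by
  simp [setPh]

theorem Config.setPh_of_ne {i i' : N.T} (P : TPhase N) (h : i' ≠ i) :
    (C.setPh i P).ph i' = C.ph i' := by
  simp [setPh, h]

@[simp] theorem Config.setPh_orig (i : N.T) (P : TPhase N) : (C.setPh i P).orig = C.orig := rfl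

@[simp] theorem Config.setPh_copy (i : N.T) (P : TPhase N) : (C.setPh i P).copy = C.copy := rfl

@[simp] theorem Config.setRst_orig (t : N.ImplTrans) (r : RState N) :
    (C.setRst t r).orig = C.orig := rfl

@[simp] theorem Config.setRst_copy (t : N.ImplTrans) (r : RState N) :
    (C.setRst t r).copy = C.copy := rfl

theorem Config.mem_complete_act {i k : N.T} : k ∈ (C.complete i).act ↔ k ≠ i ∧ k ∈ C.act := by
  simp [complete]

theorem Config.mem_exec_act {i j k : N.T} : k ∈ (C.exec i j).act ↔ k = i ∨ k ∈ C.act := by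
  simp [exec]

namespace Config.WF

/-- The invariant is preserved by a change of the control state of one reversible transition. -/
theorem of_setRst (W : C.WF) {t : N.ImplTrans} {r : RState N}
    (hrst : C'.rst = (C.setRst t r).rst) (hph : C'.ph = C.ph) (hact : C'.act = C.act)
    (hmt : C'.mt = C.mt)
    (hkept : ∀ ω, r.KeptBy ω → (C.ph ω).Undo t ∧ t ∈ N.undoSet ω)
    (hini : ∀ j, t = .initialise j →
      (∀ h hj, (C.rst (.transfer h j hj)).Holding → r.Has (.transferIn h j hj)) ∧
      ∀ k hk, (C.ph j).ExecAt k → r.Has (.enabling j k hk))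
    (htr : ∀ h j hj, t = .transfer h j hj →
      (r.Holding → (C.rst (.initialise j)).Has (.transferIn h j hj)) ∧
      (∀ i, (C.ph i).ExecAt j → r.Has (.transferOut h j hj)) ∧
      (∀ k, (C.ph k).Locks h → r = .idle) ∧
      (r = .idle → ∀ k, ¬ (C.ph k).Locks j))
    (htok : ∀ p c, N.pre c p ≠ 0 →
      C'.orig p + C'.copy p c + N.pre c p * tok (C'.rst (.initialise c)).Holding +
        ∑ k ∈ C.act, N.pre k p * tok ((C.ph k).Fetched p c) = C.mt p) : C'.WF where
  reach := hmt ▸ W.reach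
  mem_act := by rw [hact, hph]; exact W.mem_act
  act_le := by rw [hact, hmt]; exact W.act_le
  act_disj := by rw [hact]; exact W.act_disj
  loc := by rw [hph, hmt]; exact W.loc
  kept ω t' h := by
    rw [hrst] at h
    rw [hph]
    by_cases ht : t' = t
    · subst ht
      rw [setRst_self] at h
      exact hkept ω h
    · rw [setRst_of_ne _ ht] at h
      exact W.kept ω t' h
  hold h j hj := by
    rw [hrst]
    intro hh
    by_cases ht : .transfer h j hj = t
    · subst ht
      rw [setRst_self] at hh
      rw [setRst_of_ne _ (by simp)]
      exact (htr h j hj rfl).1 hh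
    · rw [setRst_of_ne _ ht] at hh
      by_cases ht' : .initialise j = t
      · subst ht'
        rw [setRst_self]
        exact (hini j rfl).1 h hj hh
      · rw [setRst_of_ne _ ht']
        exact W.hold h j hj hh
  exec_ini i j hij he := by
    rw [hph] at he
    rw [hrst]
    by_cases ht : .initialise i = t
    · subst ht
      rw [setRst_self]
      exact (hini i rfl).2 j hij he
    · rw [setRst_of_ne _ ht]
      exact W.exec_ini i j hij he
  exec_trans i j he h hj := by
    rw [hph] at he
    rw [hrst]
    by_cases ht : .transfer h j hj = t
    · subst ht
      rw [setRst_self]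
      exact (htr h j hj rfl).2.1 i he
    · rw [setRst_of_ne _ ht]
      exact W.exec_trans i j he h hj
  lock_idle k j hl l h := by
    rw [hph] at hl
    rw [hrst]
    by_cases ht : .transfer j l h = t
    · subst ht
      rw [setRst_self]
      exact (htr j l h rfl).2.2.1 k hl
    · rw [setRst_of_ne _ ht]
      exact W.lock_idle k j hl l h
  lock_unique := by rw [hph]; exact W.lock_unique
  lock_held k l hl h hl' := by
    rw [hph] at hl
    rw [hrst]
    by_cases ht : .transfer h l hl' = t
    · subst ht
      rw [setRst_self]
      exact fun hr => (htr h l hl' rfl).2.2.2 hr k hl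
    · rw [setRst_of_ne _ ht]
      exact W.lock_held k l hl h hl'
  tokens := by rw [hph, hact, hmt]; exact htok

/-- The invariant is preserved when an active transition proceeds to a later phase. -/
theorem of_setPh (W : C.WF) {i : N.T} {P : TPhase N} (hi : i ∈ C.act)
    (hrst : C'.rst = C.rst) (hph : C'.ph = (C.setPh i P).ph) (hact : C'.act = C.act)
    (hmt : C'.mt = C.mt) (hidle : P ≠ .idle)
    (hlock : ∀ j, P.Locks j → (C.ph i).Locks j) (hexec : ∀ j, ¬ P.ExecAt j)
    (hkept : ∀ t, (C.rst t).KeptBy i → P.Undo t)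
    (htok : ∀ p c, N.pre c p ≠ 0 →
      C'.orig p + C'.copy p c + N.pre i p * tok (P.Fetched p c) =
        C.orig p + C.copy p c + N.pre i p * tok ((C.ph i).Fetched p c)) : C'.WF := by
  have hlock' : ∀ k j, ((C.setPh i P).ph k).Locks j → (C.ph k).Locks j := by
    intro k j h
    by_cases hk : k = i
    · subst hk
      rw [setPh_self] at h
      exact hlock j h
    · rwa [setPh_of_ne _ hk] at h
  have hexec' : ∀ k j, ((C.setPh i P).ph k).ExecAt j → (C.ph k).ExecAt j := by
    intro k j h
    by_cases hk : k = i
    · subst hk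
      rw [setPh_self] at h
      exact absurd h (hexec j)
    · rwa [setPh_of_ne _ hk] at h
  exact {
    reach := hmt ▸ W.reach
    mem_act := by
      intro k
      rw [hact, hph]
      by_cases hk : k = i
      · subst hk
        simp [setPh_self, hi, hidle]
      · rw [setPh_of_ne _ hk]
        exact W.mem_act k
    act_le := by rw [hact, hmt]; exact W.act_le
    act_disj := by rw [hact]; exact W.act_disj
    loc := by
      rw [hph, hmt]
      exact fun k j h => W.loc k j (hlock' k j h)
    kept := by
      rw [hrst, hph]
      intro ω t h
      refine ⟨?_, (W.kept ω t h).2⟩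
      by_cases hk : ω = i
      · subst hk
        rw [setPh_self]
        exact hkept t h
      · rw [setPh_of_ne _ hk]
        exact (W.kept ω t h).1
    hold := by rw [hrst]; exact W.hold
    exec_ini := by
      rw [hrst, hph]
      exact fun i j hij h => W.exec_ini i j hij (hexec' i j h)
    exec_trans := by
      rw [hrst, hph]
      exact fun i j h => W.exec_trans i j (hexec' i j h)
    lock_idle := by
      rw [hrst, hph]
      exact fun k j h => W.lock_idle k j (hlock' k j h)
    lock_unique := by
      rw [hph]
      exact fun k k' j h h' => W.lock_unique k k' j (hlock' k j h) (hlock' k' j h')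
    lock_held := by
      rw [hrst, hph]
      exact fun k l h => W.lock_held k l (hlock' k l h)
    tokens := by
      intro p c hp
      rw [hrst, hph, hact, hmt, ← W.tokens p c hp]
      have h1 := Finset.sum_add_of_eq_off hi
        (f := fun k => N.pre k p * tok ((C.ph k).Fetched p c))
        (g := fun k => N.pre k p * tok (((C.setPh i P).ph k).Fetched p c))
        (fun k hk => by rw [setPh_of_ne _ hk])
      have h2 := htok p c hp
      rw [setPh_self] at h1
      lia }

end Config.WF
end PetriNet

namespace PetriNet

variable {Act : Type u} {N : PetriNet.{u, v, w} Act} [LT N.T] {C : Config N}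

theorem transfer_mem_undoSet {h j ω : N.T} {hj : N.LtC h j} :
    (.transfer h j hj : N.ImplTrans) ∈ N.undoSet ω ↔ N.ConflictEq j ω := by
  simp [undoSet, hj]

theorem initialise_mem_undoSet {j ω : N.T} :
    (.initialise j : N.ImplTrans) ∈ N.undoSet ω ↔ N.ConflictEq j ω := by
  simp [undoSet]

namespace Config.WF

theorem dist (W : C.WF) {p : N.S} (h : 1 ≤ C.orig p) : (C.dist p).WF where
  reach := W.reach
  mem_act := W.mem_act
  act_le := W.act_le
  act_disj := W.act_disj
  loc := W.loc
  kept := W.kept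
  hold := W.hold
  exec_ini := W.exec_ini
  exec_trans := W.exec_trans
  lock_idle := W.lock_idle
  lock_unique := W.lock_unique
  lock_held := W.lock_held
  tokens q c hc := by
    have h1 := W.tokens q c hc
    simp only [Config.dist]
    split_ifs with hq
    · subst hq
      lia
    · exact h1

theorem fireIni (W : C.WF) {j : N.T} (h1 : ∀ p, N.pre j p ≠ 0 → N.pre j p ≤ C.copy p j)
    (h2 : C.rst (.initialise j) = .idle) : (C.fireIni j).WF := by
  refine W.of_setRst (t := .initialise j) (r := .fired) rfl rfl rfl rfl ?_ ?_ ?_ ?_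
  · simp [RState.KeptBy]
  · simp [RState.Has]
  · simp
  · intro p c hc
    have h3 := W.tokens p c hc
    by_cases hcj : c = j
    -- The tokens taken from the copies `p_j` are those that `ini_j` holds from now on.
    · subst hcj
      have h4 := h1 p hc
      simp [Config.fireIni, setRst_self, h2, RState.Holding] at h3 ⊢
      lia
    · have h5 : (.initialise c : N.ImplTrans) ≠ .initialise j := by simpa using hcj
      simpa [Config.fireIni, setRst_of_ne _ h5, hcj] using h3

theorem fireTransfer (W : C.WF) {h j : N.T} {hj : N.LtC h j}
    (h1 : (C.rst (.initialise j)).Has (.transferIn h j hj)) (h3 : ∀ i, ¬ (C.ph i).Locks h) :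
    (C.setRst (.transfer h j hj) .fired).WF := by
  refine W.of_setRst rfl rfl rfl rfl ?_ ?_ ?_ ?_
  · simp [RState.KeptBy]
  · simp
  · rintro h' j' hj' ⟨⟩
    exact ⟨fun _ => h1, fun _ _ => trivial, fun k hk => absurd hk (h3 k), by simp⟩
  · intro p c hc
    have h5 : (.initialise c : N.ImplTrans) ≠ .transfer h j hj := by simp
    rw [setRst_of_ne _ h5]
    exact W.tokens p c hc

/-- The token balance is not affected by changes of control states that keep tokens held. -/
theorem tokens_setRst (W : C.WF) {t : N.ImplTrans} {r : RState N}
    (hr : (C.rst t).Holding ↔ r.Holding) (p : N.S) (c : N.T) (hc : N.pre c p ≠ 0) :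
    (C.setRst t r).orig p + (C.setRst t r).copy p c +
      N.pre c p * tok ((C.setRst t r).rst (.initialise c)).Holding +
        ∑ k ∈ C.act, N.pre k p * tok ((C.ph k).Fetched p c) = C.mt p := by
  rw [← W.tokens p c hc]
  by_cases ht : .initialise c = t
  · subst ht
    rw [setRst_self, hr]
    rfl
  · rw [setRst_of_ne _ ht]
    rfl

theorem undo (W : C.WF) {ω : N.T} {t : N.ImplTrans} (h : t ∈ N.undoSet ω)
    (h1 : (C.ph ω).Undo t) (h2 : C.rst t = .fired) : (C.setRst t (.undoing ω ∅)).WF := by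
  refine W.of_setRst rfl rfl rfl rfl ?_ ?_ ?_ (W.tokens_setRst (by simp [h2, RState.Holding]))
  · rintro ω' rfl
    exact ⟨h1, h⟩
  · rintro j rfl
    simp [RState.Has]
  · rintro h' j hj rfl
    refine ⟨fun _ => W.hold h' j hj (by simp [h2, RState.Holding]), by simp [RState.Has], ?_,
      by simp⟩
    intro k hk
    simpa [h2] using W.lock_idle k h' hk j hj

/-- A far place from which a token is taken back is marked, hence its token is not in use by another
transition. -/
theorem undoFar (W : C.WF) {ω : N.T} {t : N.ImplTrans} {A : Set N.ImplPlace} {f : N.ImplPlace}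
    (h1 : C.rst t = .undoing ω A) (h2 : 1 ≤ conc C (.base f)) :
    (C.setRst t (.undoing ω (insert f A))).WF := by
  have hkept : (C.rst t).KeptBy ω := by simp [h1, RState.KeptBy]
  refine W.of_setRst rfl rfl rfl rfl ?_ ?_ ?_ (W.tokens_setRst (by simp [h1, RState.Holding]))
  · rintro ω' rfl
    exact W.kept _ t hkept
  · rintro j rfl
    constructor
    · intro h hj hh
      have h3 := W.hold h j hj hh
      simp only [h1, RState.Has, Set.mem_insert_iff, not_or] at h3 ⊢
      refine ⟨?_, h3⟩
      rintro rfl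
      simp [conc, tok, hh] at h2
    · intro k hk he
      have h3 := W.exec_ini j k hk he
      simp only [h1, RState.Has, Set.mem_insert_iff, not_or] at h3 ⊢
      refine ⟨?_, h3⟩
      rintro rfl
      simp [conc, tok, he] at h2
  · rintro h j hj rfl
    refine ⟨fun _ => W.hold h j hj (by simp [h1, RState.Holding]), ?_, ?_, by simp⟩
    · intro i he
      have h3 := W.exec_trans i j he h hj
      simp only [h1, RState.Has, Set.mem_insert_iff, not_or] at h3 ⊢
      refine ⟨?_, h3⟩
      rintro rfl
      have h4 : ¬ ∀ i, ¬ (C.ph i).ExecAt j := fun h => h i he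
      simp [conc, tok, h4] at h2
    · intro k hk
      simpa [h1] using W.lock_idle k h hk j hj

theorem undoneIni (W : C.WF) {j ω : N.T} {A : Set N.ImplPlace}
    (h1 : C.rst (.initialise j) = .undoing ω A)
    (h2 : ∀ f, implFlow (.initialise j) .far f ≠ 0 → f ∈ A) : (C.undoneIni j ω).WF := by
  have hkept : (C.rst (.initialise j)).KeptBy ω := by simp [h1, RState.KeptBy]
  refine W.of_setRst (t := .initialise j) (r := .undone ω) rfl rfl rfl rfl ?_ ?_ ?_ ?_
  · rintro ω' rfl
    exact W.kept _ _ hkept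
  · rintro j' ⟨⟩
    constructor
    · intro h hj hh
      have h3 := W.hold h j hj hh
      simp only [h1, RState.Has] at h3
      exact absurd (h2 _ (by simp [implFlow, setMultiset_apply, tok, hj])) h3
    · intro k hk he
      have h3 := W.exec_ini j k hk he
      simp only [h1, RState.Has] at h3
      exact absurd (h2 _ (by simp [implFlow, setMultiset_apply, tok, hk])) h3
  · simp
  · intro p c hc
    have h3 := W.tokens p c hc
    by_cases hcj : c = j
    · subst hcj
      simp [Config.undoneIni, setRst_self, h1, RState.Holding] at h3 ⊢
      lia
    · have h5 : (.initialise c : N.ImplTrans) ≠ .initialise j := by simpa using hcj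
      simpa [Config.undoneIni, setRst_of_ne _ h5, hcj] using h3

theorem undoneTransfer (W : C.WF) {h j ω : N.T} {hj : N.LtC h j} {A : Set N.ImplPlace}
    (h1 : C.rst (.transfer h j hj) = .undoing ω A)
    (h2 : ∀ f, implFlow (.transfer h j hj) .far f ≠ 0 → f ∈ A) :
    (C.setRst (.transfer h j hj) (.undone ω)).WF := by
  have hkept : (C.rst (.transfer h j hj)).KeptBy ω := by simp [h1, RState.KeptBy]
  refine W.of_setRst rfl rfl rfl rfl ?_ ?_ ?_ ?_
  · rintro ω' rfl
    exact W.kept _ _ hkept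
  · simp
  · rintro h j hj ⟨⟩
    refine ⟨by simp [RState.Holding], ?_, ?_, by simp⟩
    · intro i he
      have h3 := W.exec_trans i j he h hj
      simp only [h1, RState.Has] at h3
      exact absurd (h2 _ (by simp [implFlow, setMultiset_apply, tok])) h3
    · intro k hk
      simpa [h1] using W.lock_idle k h hk j hj
  · intro p c hc
    have h5 : (.initialise c : N.ImplTrans) ≠ .transfer h j hj := by simp
    rw [setRst_of_ne _ h5]
    exact W.tokens p c hc

theorem reset (W : C.WF) (hfin : N.IsFinitary) (hM : ¬ N.HasFullyReachablePureM) {ω : N.T}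
    {t : N.ImplTrans} {A : Set N.ImplTrans} (ht : t ∈ N.undoSet ω)
    (h1 : C.ph ω = .resetting A) (h3 : C.rst t = .undone ω) : (C.reset ω t A).WF := by
  have hω : ω ∈ C.act := by simp [W.mem_act, h1]
  have W' : (C.setRst t .idle).WF := by
    refine W.of_setRst rfl rfl rfl rfl ?_ ?_ ?_ (W.tokens_setRst (by simp [h3, RState.Holding]))
    · simp [RState.KeptBy]
    · rintro j rfl
      constructor
      · intro h hj hh
        simpa [h3, RState.Has] using W.hold h j hj hh
      · intro k hk he
        simpa [h3, RState.Has] using W.exec_ini j k hk he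
    · rintro h j hj rfl
      refine ⟨by simp [RState.Holding], ?_, fun _ _ => rfl, ?_⟩
      · intro i he
        simpa [h3, RState.Has] using W.exec_trans i j he h hj
      · intro _ k hk
        -- A transition that owns the location `j` is the only active one in conflict with `j`.
        obtain ⟨h4, h5⟩ := W.loc k j hk
        have h6 : N.ConflictEq k j := h4.imp (fun h => h.2) id
        have h7 := W.act_unique hfin hM h5 (W.locks_mem hk) hω h6.symm
          (transfer_mem_undoSet.1 ht)
        subst h7
        simp [h1, TPhase.Locks] at hk
  refine W'.of_setPh hω rfl rfl rfl rfl (by simp) (by simp [TPhase.Locks])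
    (by simp [TPhase.ExecAt]) ?_ ?_
  · intro t' ht'
    by_cases htt : t' = t
    · subst htt
      rw [setRst_self] at ht'
      exact ht'.elim
    · have h4 := W'.kept ω t' ht'
      change (C.ph ω).Undo t' ∧ _ at h4
      simpa [h1, TPhase.Undo, htt] using h4.1
  · intro p c hc
    have h5 : (C.setRst t RState.idle).ph ω = .resetting A := h1
    simp [h5, TPhase.Fetched, Config.reset, Config.setPh]

theorem elide (W : C.WF) {ω : N.T} {t : N.ImplTrans} {A : Set N.ImplTrans}
    (h1 : C.ph ω = .resetting A) (h3 : ¬ (C.rst t).KeptBy ω) :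
    (C.setPh ω (.resetting (insert t A))).WF := by
  have hω : ω ∈ C.act := by simp [W.mem_act, h1]
  refine W.of_setPh hω rfl rfl rfl rfl (by simp) (by simp [TPhase.Locks])
    (by simp [TPhase.ExecAt]) ?_ ?_
  · intro t' ht'
    have h4 := (W.kept ω t' ht').1
    simp only [h1, TPhase.Undo, Set.mem_insert_iff, not_or] at h4 ⊢
    exact ⟨fun h => h3 (h ▸ ht'), h4⟩
  · intro p c hc
    simp [h1, TPhase.Fetched, Config.setPh]

theorem fetch (W : C.WF) {i j : N.T} {p : N.S} {c : N.T} {D : Set (N.S × N.T)}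
    (h1 : C.ph i = .fetching j D) (h2 : (p, c) ∉ D) (h3 : N.pre i p ≤ C.copy p c) :
    (C.fetch i j p c D).WF := by
  have hi : i ∈ C.act := by simp [W.mem_act, h1]
  refine W.of_setPh (P := .fetching j (insert (p, c) D)) hi rfl rfl rfl rfl (by simp) ?_
    (by simp [TPhase.ExecAt]) (by simp [TPhase.Undo]) ?_
  · simp [h1, TPhase.Locks]
  · intro q d hd
    simp only [Config.fetch, Config.setPh, h1, TPhase.Fetched, Set.mem_insert_iff, Prod.mk.injEq]
    by_cases hq : q = p ∧ d = c
    · obtain ⟨rfl, rfl⟩ := hq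
      simp [h2]
      lia
    · simp [hq]

/-- From now on `i` counts as having fetched from all copies of all places; at places that are not
preplaces of `i` this does not affect the token balance. -/
theorem fetched (W : C.WF) {i j : N.T} {D : Set (N.S × N.T)} (h1 : C.ph i = .fetching j D)
    (h2 : ∀ p c, N.pre i p ≠ 0 → N.pre c p ≠ 0 → (p, c) ∈ D) :
    (C.setPh i (.resetting ∅)).WF := by
  have hi : i ∈ C.act := by simp [W.mem_act, h1]
  refine W.of_setPh hi rfl rfl rfl rfl (by simp) (by simp [TPhase.Locks])
    (by simp [TPhase.ExecAt]) (by simp [TPhase.Undo]) ?_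
  intro p c hc
  by_cases hp : N.pre i p = 0
  · simp [hp, Config.setPh]
  · simp [h1, TPhase.Fetched, Config.setPh, h2 p c hp hc]

theorem finish (W : C.WF) {i j : N.T} (h1 : C.ph i = .exec j) :
    (C.setPh i (.fetching j ∅)).WF := by
  have hi : i ∈ C.act := by simp [W.mem_act, h1]
  refine W.of_setPh hi rfl rfl rfl rfl (by simp) (by simp [h1, TPhase.Locks])
    (by simp [TPhase.ExecAt]) (by simp [TPhase.Undo]) ?_
  intro p c hc
  simp [h1, TPhase.Fetched, Config.setPh]

/-- Completion of `i` replaces `mt` by the marking reached by firing `i`. The other active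
transitions and their locations stay enabled, as they are not in conflict with `i`. -/
theorem complete (W : C.WF) (hfin : N.IsFinitary) (hM : ¬ N.HasFullyReachablePureM) {i : N.T}
    {A : Set N.ImplTrans} (h1 : C.ph i = .resetting A) (h2 : ∀ t ∈ N.undoSet i, t ∈ A) :
    (C.complete i).WF := by
  have hi : i ∈ C.act := by simp [W.mem_act, h1]
  have hle := W.act_le i hi
  have hph : ∀ k, k ≠ i → (C.complete i).ph k = C.ph k := fun k hk => setPh_of_ne _ hk
  have hphi : (C.complete i).ph i = .idle := setPh_self _ _
  have hlock : ∀ k j, ((C.complete i).ph k).Locks j → k ≠ i ∧ (C.ph k).Locks j := by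
    intro k j hk
    by_cases hki : k = i
    · subst hki
      rw [hphi] at hk
      exact hk.elim
    · exact ⟨hki, hph k hki ▸ hk⟩
  have hexec : ∀ k j, ((C.complete i).ph k).ExecAt j → (C.ph k).ExecAt j := by
    intro k j hk
    have := (hlock k j hk.locks).1
    rwa [hph k this] at hk
  exact {
    reach := W.reach.step (step_single.2 ⟨hle, rfl⟩)
    mem_act := by
      intro k
      by_cases hk : k = i
      · subst hk
        simp [hphi, mem_complete_act]
      · simp [hph k hk, ← W.mem_act, hk, mem_complete_act]
    act_le := by
      intro k hk p
      have hk' : k ∈ C.act ∧ k ≠ i := by simpa [mem_complete_act, and_comm] using hk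
      have h3 := W.act_le k hk'.1 p
      simp only [Config.complete]
      by_cases hp : N.pre k p = 0
      · lia
      · by_cases hp' : N.pre i p = 0
        · lia
        · exact absurd (W.act_disj k hk'.1 i hi ((conflictEq_iff hfin).2 ⟨p, hp, hp'⟩)) hk'.2
    act_disj := by
      intro k hk k' hk'
      have h3 : k ∈ C.act := by simp_all [Config.complete]
      have h4 : k' ∈ C.act := by simp_all [Config.complete]
      exact W.act_disj k h3 k' h4
    loc := by
      intro k j hk
      obtain ⟨hki, hk⟩ := hlock k j hk
      obtain ⟨h3, h4⟩ := W.loc k j hk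
      refine ⟨h3, fun p => ?_⟩
      have h5 := h4 p
      simp only [Config.complete]
      by_cases hp : N.pre j p = 0
      · lia
      · by_cases hp' : N.pre i p = 0
        · lia
        · have h6 : N.ConflictEq k j := h3.imp (fun h => h.2) id
          exact absurd (W.act_unique hfin hM h4 (W.locks_mem hk) hi h6.symm
            ((conflictEq_iff hfin).2 ⟨p, hp, hp'⟩)) hki
    kept := by
      intro ω t ht
      have h3 := W.kept ω t ht
      have h4 : ω ≠ i := by
        rintro rfl
        simp [h1, TPhase.Undo, h2 t h3.2] at h3
      rwa [hph ω h4]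
    hold := W.hold
    exec_ini := fun k j hkj h => W.exec_ini k j hkj (hexec k j h)
    exec_trans := fun k j h => W.exec_trans k j (hexec k j h)
    lock_idle := fun k j h => W.lock_idle k j (hlock k j h).2
    lock_unique := fun k k' j h h' => W.lock_unique k k' j (hlock k j h).2 (hlock k' j h').2
    lock_held := fun k j h => W.lock_held k j (hlock k j h).2
    tokens := by
      classical
      intro p c hc
      have h3 := W.tokens p c hc
      rw [← Finset.add_sum_erase _ _ hi, tok_true (P := (C.ph i).Fetched p c)
        (by simp [h1, TPhase.Fetched])] at h3
      have h4 : ∑ k ∈ (C.complete i).act, N.pre k p * tok (((C.complete i).ph k).Fetched p c) =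
          ∑ k ∈ C.act.erase i, N.pre k p * tok ((C.ph k).Fetched p c) := by
        refine Finset.sum_congr ?_ fun k hk => ?_
        · ext; simp [Config.complete]
        · rw [hph k (by simp at hk; exact hk.1)]
      rw [h4]
      have h5 : (C.complete i).rst = C.rst := rfl
      rw [h5]
      simp only [Config.complete, setPh_copy]
      lia }

/-- The start of a visible transition preserves the invariant. -/
theorem exec (W : C.WF) {i j : N.T} {hij ht} (hle : N.pre i ≤ C.mt) (hle' : N.pre j ≤ C.mt)
    (hfree : ∀ k ∈ C.act, ¬ N.ConflictEq i k)
    (h : ipre (.std (.execute i j hij) ht) ≤ conc C) : (C.exec i j).WF := by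
  rw [le_conc_exec] at h
  obtain ⟨⟨h1, -⟩, h2, h3⟩ := h
  have hi : i ∉ C.act := fun hi => hfree i hi (Or.inr rfl)
  have hidle : C.ph i = .idle := by simpa [W.mem_act] using hi
  have hph : ∀ k, k ≠ i → (C.exec i j).ph k = C.ph k := fun k hk => setPh_of_ne _ hk
  have hphi : (C.exec i j).ph i = .exec j := setPh_self _ _
  have hlock : ∀ k l, ((C.exec i j).ph k).Locks l → (k = i ∧ l = j) ∨ (C.ph k).Locks l := by
    intro k l hk
    by_cases hki : k = i
    · subst hki
      rw [hphi] at hk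
      exact Or.inl ⟨rfl, hk.symm⟩
    · exact Or.inr (hph k hki ▸ hk)
  have hexec : ∀ k l, ((C.exec i j).ph k).ExecAt l → (k = i ∧ l = j) ∨ (C.ph k).ExecAt l := by
    intro k l hk
    by_cases hki : k = i
    · subst hki
      rw [hphi] at hk
      exact Or.inl ⟨rfl, hk.symm⟩
    · exact Or.inr (hph k hki ▸ hk)
  have hnl := (h3 j (Or.inr rfl)).2
  exact {
    reach := W.reach
    mem_act := by
      intro k
      rw [mem_exec_act]
      by_cases hk : k = i
      · subst hk
        simp [hphi]
      · simp [hph k hk, ← W.mem_act, hk]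
    act_le := by
      intro k hk
      rcases mem_exec_act.1 hk with rfl | hk
      · exact hle
      · exact W.act_le k hk
    act_disj := by
      intro k hk k' hk' hc
      rcases mem_exec_act.1 hk with rfl | hk₁ <;> rcases mem_exec_act.1 hk' with rfl | hk₂
      · rfl
      · exact absurd hc (hfree k' hk₂)
      · exact absurd hc.symm (hfree k hk₁)
      · exact W.act_disj k hk₁ k' hk₂ hc
    loc := by
      intro k l hk
      rcases hlock k l hk with ⟨rfl, rfl⟩ | hk
      · exact ⟨hij, hle'⟩
      · exact W.loc k l hk
    kept := by
      intro ω t ht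
      have h4 := W.kept ω t ht
      have h5 : ω ≠ i := by
        rintro rfl
        simp [hidle, TPhase.Undo] at h4
      rwa [hph ω h5]
    hold := W.hold
    exec_ini := by
      intro k l hkl hk
      rcases hexec k l hk with ⟨rfl, rfl⟩ | hk
      · exact h1
      · exact W.exec_ini k l hkl hk
    exec_trans := by
      intro k l hk
      rcases hexec k l hk with ⟨rfl, rfl⟩ | hk
      · exact fun h hj => (h2 h hj).1
      · exact W.exec_trans k l hk
    lock_idle := by
      intro k l hk
      rcases hlock k l hk with ⟨rfl, rfl⟩ | hk
      · exact fun m hm => RState.isIdle_iff.1 ((h3 m (Or.inl hm)).1 hm)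
      · exact W.lock_idle k l hk
    lock_unique := by
      intro k k' l hk hk'
      rcases hlock k l hk with ⟨h₁, rfl⟩ | hk₁ <;> rcases hlock k' _ hk' with ⟨h₂, h₃⟩ | hk₂
      · rw [h₁, h₂]
      · exact absurd hk₂ (hnl k')
      · exact absurd (h₃ ▸ hk₁) (hnl k)
      · exact W.lock_unique k k' l hk₁ hk₂
    lock_held := by
      intro k l hk
      rcases hlock k l hk with ⟨rfl, rfl⟩ | hk
      · intro h hl hidle'
        have h4 := (h2 h hl).1
        rw [show C.rst _ = .idle from hidle'] at h4
        exact h4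
      · exact W.lock_held k l hk
    tokens := by
      classical
      intro p c hc
      have h4 : ∑ k ∈ (C.exec i j).act, N.pre k p * tok (((C.exec i j).ph k).Fetched p c) =
          ∑ k ∈ C.act, N.pre k p * tok ((C.ph k).Fetched p c) := by
        have h5 : (C.exec i j).act = insert i C.act := by ext; simp [mem_exec_act]
        rw [h5, Finset.sum_insert hi, hphi]
        simp only [TPhase.Fetched, tok_False, mul_zero, zero_add]
        refine Finset.sum_congr rfl fun k hk => ?_
        rw [hph k (by rintro rfl; exact hi hk)]
      rw [h4]
      exact W.tokens p c hc }

end Config.WF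
end PetriNet

/-! ### Silent steps -/

namespace PetriNet

variable {Act : Type u} {N : PetriNet.{u, v, w} Act} [LT N.T] {C C' : Config N}

/-- The silent steps of configurations; each of them mirrors the firing of one silent transition
of the implementation. -/
inductive Config.Tau (C : Config N) : Config N → Prop
  | dist {p : N.S} : (∃ c, N.pre c p ≠ 0) → 1 ≤ C.orig p → Tau C (C.dist p)
  | fireIni {j : N.T} : (∀ p, N.pre j p ≠ 0 → N.pre j p ≤ C.copy p j) →
      C.rst (.initialise j) = .idle → Tau C (C.fireIni j)
  | fireTransfer {h j : N.T} {hj : N.LtC h j} :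
      (C.rst (.initialise j)).Has (.transferIn h j hj) → C.rst (.transfer h j hj) = .idle →
      (∀ i, ¬ (C.ph i).Locks h) → Tau C (C.setRst (.transfer h j hj) .fired)
  | undo {ω : N.T} {t : N.ImplTrans} : t ∈ N.undoSet ω → (C.ph ω).Undo t → C.rst t = .fired →
      Tau C (C.setRst t (.undoing ω ∅))
  | undoFar {ω : N.T} {t : N.ImplTrans} {A : Set N.ImplPlace} {f : N.ImplPlace} :
      implFlow t .far f ≠ 0 → C.rst t = .undoing ω A → f ∉ A → 1 ≤ conc C (.base f) →
      Tau C (C.setRst t (.undoing ω (insert f A)))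
  | undoneIni {j ω : N.T} {A : Set N.ImplPlace} : C.rst (.initialise j) = .undoing ω A →
      (∀ f, implFlow (.initialise j) .far f ≠ 0 → f ∈ A) → Tau C (C.undoneIni j ω)
  | undoneTransfer {h j ω : N.T} {hj : N.LtC h j} {A : Set N.ImplPlace} :
      C.rst (.transfer h j hj) = .undoing ω A →
      (∀ f, implFlow (.transfer h j hj) .far f ≠ 0 → f ∈ A) →
      Tau C (C.setRst (.transfer h j hj) (.undone ω))
  | reset {ω : N.T} {t : N.ImplTrans} {A : Set N.ImplTrans} : t ∈ N.undoSet ω →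
      C.ph ω = .resetting A → t ∉ A → C.rst t = .undone ω → Tau C (C.reset ω t A)
  | elide {ω : N.T} {t : N.ImplTrans} {A : Set N.ImplTrans} : t ∈ N.undoSet ω →
      C.ph ω = .resetting A → t ∉ A → ¬ (C.rst t).KeptBy ω →
      Tau C (C.setPh ω (.resetting (insert t A)))
  | fetch {i j : N.T} {p : N.S} {c : N.T} {D : Set (N.S × N.T)} : N.pre i p ≠ 0 →
      N.pre c p ≠ 0 → C.ph i = .fetching j D → (p, c) ∉ D → N.pre i p ≤ C.copy p c →
      Tau C (C.fetch i j p c D)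
  | fetched {i j : N.T} {D : Set (N.S × N.T)} : C.ph i = .fetching j D →
      (∀ p c, N.pre i p ≠ 0 → N.pre c p ≠ 0 → (p, c) ∈ D) → Tau C (C.setPh i (.resetting ∅))
  | complete {i : N.T} {A : Set N.ImplTrans} : C.ph i = .resetting A →
      (∀ t ∈ N.undoSet i, t ∈ A) → Tau C (C.complete i)

theorem Config.Tau.wf (h : C.Tau C') (W : C.WF) (hfin : N.IsFinitary)
    (hM : ¬ N.HasFullyReachablePureM) : C'.WF := by
  cases h with
  | dist _ h => exact W.dist h
  | fireIni h1 h2 => exact W.fireIni h1 h2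
  | fireTransfer h1 _ h3 => exact W.fireTransfer h1 h3
  | undo h h1 h2 => exact W.undo h h1 h2
  | undoFar _ h1 _ h2 => exact W.undoFar h1 h2
  | undoneIni h1 h2 => exact W.undoneIni h1 h2
  | undoneTransfer h1 h2 => exact W.undoneTransfer h1 h2
  | reset h h1 _ h3 => exact W.reset hfin hM h h1 h3
  | elide _ h1 _ h3 => exact W.elide h1 h3
  | fetch _ _ h1 h2 h3 => exact W.fetch h1 h2 h3
  | fetched h1 h2 => exact W.fetched h1 h2
  | complete h1 h2 => exact W.complete hfin hM h1 h2

theorem impl_pre (t : N.implRev.Trans) : N.impl.pre t = ipre t := expandPre_eq t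

theorem impl_post (t : N.implRev.Trans) : N.impl.post t = ipost t := expandPost_eq t

/-- The effect lemmas in subtractive form. -/
theorem fire_eq {X : Type*} {a b c d : X → ℕ} (h : ∀ s, d s + b s = a s + c s) (hb : b ≤ a) :
    a - b + c = d := by
  funext s
  have h1 := h s
  have h2 := hb s
  simp only [Pi.add_apply, Pi.sub_apply]
  lia

theorem setMultiset_ne_zero {X : Type*} {A : Set X} {x : X} (h : x ∈ A) :
    setMultiset A x ≠ 0 := by
  simp [setMultiset, h]

theorem far_enabling {j k : N.T} (hk : N.LeC j k) :
    implFlow (.initialise j) .far (.enabling j k hk) ≠ 0 :=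
  setMultiset_ne_zero (Or.inl ⟨k, hk, rfl⟩)

theorem far_transferOut {h j : N.T} (hj : N.LtC h j) :
    implFlow (.transfer h j hj) .far (.transferOut h j hj) ≠ 0 :=
  setMultiset_ne_zero rfl

theorem far_initialise {j : N.T} {f : N.ImplPlace} (hf : implFlow (.initialise j) .far f ≠ 0) :
    (∃ k hk, f = .enabling j k hk) ∨ ∃ h hh, f = .transferIn h j hh := by
  by_contra h
  exact hf ((setMultiset_apply _ _).trans (tok_false h))

theorem far_transfer {h j : N.T} {hj : N.LtC h j} {f : N.ImplPlace}
    (hf : implFlow (.transfer h j hj) .far f ≠ 0) : f = .transferOut h j hj := by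
  by_contra h
  exact hf ((setMultiset_apply _ _).trans (tok_false h))

theorem exists_far {t : N.ImplTrans} (h : N.implRev.Reversible t) :
    ∃ f, implFlow t .far f ≠ 0 := by
  rcases reversible_iff.1 h with ⟨j, rfl⟩ | ⟨h, j, hj, rfl⟩
  · exact ⟨_, far_enabling (Or.inr rfl)⟩
  · exact ⟨_, far_transferOut hj⟩

theorem RState.Take.eq_undoing {r : RState N} {f : N.ImplPlace} (h : r.Take f) :
    ∃ ω A, r = .undoing ω A ∧ f ∉ A := by
  cases r <;> simp_all [RState.Take]

theorem RState.Took.eq_undoing {r : RState N} {f : N.ImplPlace} (h : r.Took f) :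
    ∃ ω A, r = .undoing ω A ∧ f ∈ A := by
  cases r <;> simp_all [RState.Took]

theorem TPhase.Reset.eq_resetting {P : TPhase N} {t : N.ImplTrans} (h : P.Reset t) :
    ∃ A, P = .resetting A ∧ t ∉ A := by
  cases P <;> simp_all [TPhase.Reset]

theorem TPhase.Ack.eq_resetting {P : TPhase N} {t : N.ImplTrans} (h : P.Ack t) :
    ∃ A, P = .resetting A ∧ t ∈ A := by
  cases P <;> simp_all [TPhase.Ack]

theorem TPhase.FetchIn.eq_fetching {P : TPhase N} {j : N.T} {p : N.S} {c : N.T}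
    (h : P.FetchIn j p c) : ∃ D, P = .fetching j D ∧ (p, c) ∉ D := by
  cases P <;> simp_all [TPhase.FetchIn]

theorem TPhase.FetchOut.eq_fetching {P : TPhase N} {j : N.T} {p : N.S} {c : N.T}
    (h : P.FetchOut j p c) : ∃ D, P = .fetching j D ∧ (p, c) ∈ D := by
  cases P <;> simp_all [TPhase.FetchOut]

/-- Each firing of a silent transition of the implementation is a silent step of
configurations. -/
theorem exists_tau (W : C.WF) (hfin : N.IsFinitary) (hplain : N.IsPlain) {t : N.implRev.Trans}
    (hl : N.impl.label t = none) (ht : ipre t ≤ conc C) :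
    ∃ C', C.Tau C' ∧ conc C - ipre t + ipost t = conc C' := by
  rcases t with ⟨t, hr⟩ | ⟨t, hr⟩ | ⟨ω, t, hr⟩ | ⟨f, t, hr, hf⟩ | ⟨t, hr⟩ | ⟨ω, t, hr⟩ |
    ⟨ω, t, hr⟩
  · rcases t with ⟨p, hp⟩ | j | ⟨h, j, hj⟩ | ⟨i, j, hij⟩ | ⟨i, j, hij, p, c, hi, hc⟩ |
      ⟨i, j, hij⟩ | i
    · have h1 := le_conc_dist.1 ht
      exact ⟨_, .dist hp h1, fire_eq (effect_dist h1) ht⟩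
    · exact absurd (reversible_iff.2 (Or.inl ⟨j, rfl⟩)) hr
    · exact absurd (reversible_iff.2 (Or.inr ⟨h, j, hj, rfl⟩)) hr
    · exact absurd hl (hplain.2 i)
    · obtain ⟨h1, h2⟩ := le_conc_fetch.1 ht
      obtain ⟨D, h3, h4⟩ := h1.eq_fetching
      exact ⟨_, .fetch hi hc h3 h4 h2, fire_eq (effect_fetch h3 h4 h2) ht⟩
    · have h1 := le_conc_fetched.1 ht
      obtain ⟨p, hp⟩ := Function.ne_iff.1 (hfin.1 i)
      obtain ⟨D, h3, -⟩ := (h1 p i hp hp).eq_fetching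
      have h4 : ∀ p c, N.pre i p ≠ 0 → N.pre c p ≠ 0 → (p, c) ∈ D := by
        intro p c hp hc
        have h5 := h1 p c hp hc
        rw [h3] at h5
        exact h5.2
      exact ⟨_, .fetched h3 h4, fire_eq (effect_fetched W h3 h4) ht⟩
    · have h1 := le_conc_complete.1 ht
      obtain ⟨A, h3, -⟩ := (h1 (.initialise i)
        (initialise_mem_undoSet.2 (Or.inr rfl))).eq_resetting
      have h4 : ∀ t ∈ N.undoSet i, t ∈ A := by
        intro t ht
        have h5 := h1 t ht
        rw [h3] at h5
        exact h5
      exact ⟨_, .complete h3 h4, fire_eq (effect_complete h3 h4) ht⟩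
  · rcases reversible_iff.1 hr with ⟨j, rfl⟩ | ⟨h, j, hj, rfl⟩
    · obtain ⟨h1, h2⟩ := le_conc_fire_ini.1 ht
      have h3 := RState.isIdle_iff.1 h2
      exact ⟨_, .fireIni h1 h3, fire_eq (effect_fire_ini W h1 h3) ht⟩
    · obtain ⟨⟨h1, -⟩, h2, h4⟩ := le_conc_fire_trans.1 ht
      have h3 := RState.isIdle_iff.1 h2
      exact ⟨_, .fireTransfer h1 h3 h4, fire_eq (effect_fire_trans W h1 h3 h4) ht⟩
  · obtain ⟨⟨h1, -⟩, h2⟩ := le_conc_undo.1 ht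
    have h3 := RState.isFired_iff.1 h2
    exact ⟨_, .undo hr h1 h3, fire_eq (effect_undo h1 h3) ht⟩
  · obtain ⟨h1, h2⟩ := le_conc_undoFar.1 ht
    obtain ⟨ω, A, h3, h4⟩ := h1.eq_undoing
    refine ⟨_, .undoFar hf h3 h4 h2, fire_eq ?_ ht⟩
    rcases reversible_iff.1 hr with ⟨j, rfl⟩ | ⟨h, j, hj, rfl⟩
    · rcases far_initialise hf with ⟨k, hk, rfl⟩ | ⟨h, hj, rfl⟩
      · refine effect_undoFar_enabling h3 h4 ?_
        intro h5
        simp [conc, tok, h5] at h2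
      · refine effect_undoFar_transferIn h3 h4 ?_
        intro h5
        simp [conc, tok, h5] at h2
    · have h5 : f = .transferOut h j hj := far_transfer hf
      subst h5
      refine effect_undoFar_transferOut h3 h4 ?_
      intro i hi
      have h6 : ¬ ∀ i, ¬ (C.ph i).ExecAt j := fun h => h i hi
      simp [conc, tok, h6] at h2
  · have h1 := le_conc_undone.1 ht
    obtain ⟨f, hf⟩ := exists_far hr
    obtain ⟨ω, A, h3, -⟩ := (h1 f hf).eq_undoing
    have h4 : ∀ f, implFlow t .far f ≠ 0 → f ∈ A := by
      intro f hf
      have h5 := h1 f hf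
      rw [h3] at h5
      exact h5
    rcases reversible_iff.1 hr with ⟨j, rfl⟩ | ⟨h, j, hj, rfl⟩
    · exact ⟨_, .undoneIni h3 h4, fire_eq (effect_undone_ini h3 h4) ht⟩
    · exact ⟨_, .undoneTransfer h3 h4, fire_eq (effect_undone_trans W h3 h4) ht⟩
  · obtain ⟨h1, h2⟩ := le_conc_reset.1 ht
    obtain ⟨A, h3, h4⟩ := h1.eq_resetting
    refine ⟨_, .reset hr h3 h4 h2, fire_eq ?_ ht⟩
    rcases reversible_iff.1 ⟨ω, hr⟩ with ⟨j, rfl⟩ | ⟨h, j, hj, rfl⟩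
    · exact effect_reset_ini h3 h4 h2
    · exact effect_reset_trans W h3 h4 h2
  · obtain ⟨h1, h2⟩ := le_conc_elide.1 ht
    obtain ⟨A, h3, h4⟩ := h1.eq_resetting
    exact ⟨_, .elide hr h3 h4 h2, fire_eq (effect_elide h3 h4 h2) ht⟩

end PetriNet

/-! ### Finiteness and termination -/

theorem finsum_mem_add_of_eq_off {ι : Type*} {s : Set ι} (hs : s.Finite) {i : ι} (hi : i ∈ s)
    {f g : ι → ℕ} (h : ∀ k ≠ i, g k = f k) :
    ∑ᶠ k ∈ s, g k + f i = ∑ᶠ k ∈ s, f k + g i := by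
  rw [finsum_mem_eq_finite_toFinset_sum _ hs, finsum_mem_eq_finite_toFinset_sum _ hs]
  exact Finset.sum_add_of_eq_off (hs.mem_toFinset.2 hi) h

namespace PetriNet

theorem finite_conflictEq {Act : Type u} {N : PetriNet.{u, v, w} Act}
    (hconf : N.IsConflictFinite) (i : N.T) :
    {c | N.ConflictEq c i}.Finite := by
  refine ((hconf i).union (Set.finite_singleton i)).subset ?_
  intro c hc
  rcases hc.symm with h | h
  · exact Or.inl h
  · exact Or.inr h.symm

variable {Act : Type u} {N : PetriNet.{u, v, w} Act} [LT N.T] {C C' : Config N}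

/-- The reversible transitions that belong to the location `c`. -/
def revAt (c : N.T) : Set N.ImplTrans :=
  {t | t = .initialise c ∨ ∃ h hj, t = .transfer h c hj}

theorem finite_ltC (hconf : N.IsConflictFinite) (c : N.T) : Finite {h // N.LtC h c} :=
  ((hconf c).subset fun h (hh : N.LtC h c) => (⟨hh.2.1.symm, by
    rw [inf_comm]; exact hh.2.2⟩ : N.Conflict c h)).to_subtype

theorem finite_leC (hconf : N.IsConflictFinite) (c : N.T) : Finite {k // N.LeC c k} :=
  ((finite_conflictEq hconf c).subset fun k (hh : N.LeC c k) =>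
    (ConflictEq.symm (hh.imp (fun h => h.2) id) : N.ConflictEq k c)).to_subtype

theorem finite_revAt (hconf : N.IsConflictFinite) (c : N.T) : (revAt c).Finite := by
  have := finite_ltC hconf c
  refine ((Set.finite_singleton (.initialise c)).union
    (Set.finite_range fun x : {h // N.LtC h c} => ImplTrans.transfer x.1 c x.2)).subset ?_
  rintro t (rfl | ⟨h, hj, rfl⟩)
  · exact Or.inl rfl
  · exact Or.inr ⟨⟨h, hj⟩, rfl⟩

theorem mem_undoSet {t : N.ImplTrans} {i : N.T} :
    t ∈ N.undoSet i ↔ ∃ c, N.ConflictEq c i ∧ t ∈ revAt c := by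
  constructor
  · rintro (⟨c, hc, rfl⟩ | ⟨b, c, h, hc, rfl⟩)
    · exact ⟨c, hc, Or.inl rfl⟩
    · exact ⟨c, hc, Or.inr ⟨b, h, rfl⟩⟩
  · rintro ⟨c, hc, rfl | ⟨h, hj, rfl⟩⟩
    · exact Or.inl ⟨c, hc, rfl⟩
    · exact Or.inr ⟨h, c, hj, hc, rfl⟩

theorem finite_undoSet (hconf : N.IsConflictFinite) (i : N.T) : (N.undoSet i).Finite := by
  refine ((finite_conflictEq hconf i).biUnion fun c _ => finite_revAt hconf c).subset ?_
  intro t ht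
  obtain ⟨c, hc, htc⟩ := mem_undoSet.1 ht
  exact Set.mem_biUnion hc htc

/-- The far places of a transition. -/
def farSet (t : N.ImplTrans) : Set N.ImplPlace := {f | implFlow t .far f ≠ 0}

theorem finite_farSet (hconf : N.IsConflictFinite) {t : N.ImplTrans}
    (ht : N.implRev.Reversible t) : (farSet t).Finite := by
  rcases reversible_iff.1 ht with ⟨j, rfl⟩ | ⟨h, j, hj, rfl⟩
  · have := finite_ltC hconf j
    have := finite_leC hconf j
    refine ((Set.finite_range fun x : {k // N.LeC j k} => ImplPlace.enabling j x.1 x.2).union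
      (Set.finite_range fun x : {h // N.LtC h j} => ImplPlace.transferIn x.1 j x.2)).subset ?_
    intro f hf
    rcases far_initialise hf with ⟨k, hk, rfl⟩ | ⟨h, hj, rfl⟩
    · exact Or.inl ⟨⟨k, hk⟩, rfl⟩
    · exact Or.inr ⟨⟨h, hj⟩, rfl⟩
  · exact (Set.finite_singleton _).subset fun f hf => far_transfer hf

/-- The number of silent steps that `t` can make until its next reset, with that reset included.
A reset increases this number, which is compensated by a decrease of `phWeight`. -/
noncomputable def rstWeight (t : N.ImplTrans) : RState N → ℕ
  | .idle => (farSet t).ncard + 4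
  | .fired => (farSet t).ncard + 3
  | .undoing _ A => (farSet t \ A).ncard + 2
  | .undone _ => 1

/-- The number of fetches that `i` still has to do, plus one for `fetched`, plus the weight that an
idle `t` has, for each `t` in `Ω_i` that has not been acknowledged. The last summands make up for
the increase of `rstWeight` when `t` becomes idle again. -/
noncomputable def phWeight (i : N.T) : TPhase N → ℕ
  | .fetching _ D => ({x : N.S × N.T | N.pre i x.1 ≠ 0 ∧ N.pre x.2 x.1 ≠ 0} \ D).ncard + 1 +
      ∑ᶠ t ∈ N.undoSet i, ((farSet t).ncard + 4)
  | .resetting A => ∑ᶠ t ∈ N.undoSet i \ A, ((farSet t).ncard + 4)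
  | _ => 0

theorem phWeight_insert (hconf : N.IsConflictFinite) {ω : N.T} {t : N.ImplTrans}
    {A : Set N.ImplTrans} (ht : t ∈ N.undoSet ω) (hA : t ∉ A) :
    phWeight ω (.resetting A) =
      (farSet t).ncard + 4 + phWeight ω (.resetting (insert t A)) := by
  have h1 : N.undoSet ω \ A = insert t (N.undoSet ω \ insert t A) := by
    ext x
    by_cases hx : x = t
    · subst hx
      simp [ht, hA]
    · simp [hx]
  simp only [phWeight]
  rw [h1, finsum_mem_insert _ (by simp) ((finite_undoSet hconf ω).subset Set.sdiff_subset)]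

namespace Config

/-- The reversible transitions that belong to a location that is enabled or in conflict with an
active transition. Silent steps other than completions leave this set fixed and change the control
state of its elements only. -/
def relevant (C : Config N) : Set N.ImplTrans :=
  {t | ∃ c, (N.pre c ≤ C.mt ∨ ∃ k ∈ C.act, N.ConflictEq c k) ∧ t ∈ revAt c}

/-- The number that silent steps other than completions decrease. All its sums are finite, by
`finite_relevant` and as `mt` is a finite marking. -/
noncomputable def weight (C : Config N) : ℕ :=
  ∑ᶠ p ∈ {p | C.mt p ≠ 0}, C.orig p + ∑ i ∈ C.act, phWeight i (C.ph i) +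
    ∑ᶠ t ∈ C.relevant, rstWeight t (C.rst t)

theorem finite_relevant (hfin : N.IsFinitary) (hconf : N.IsConflictFinite) (W : C.WF) :
    C.relevant.Finite := by
  have h1 : {c | N.pre c ≤ C.mt}.Finite := by
    simpa [enabled_single] using (hfin.2 C.mt W.reach).2
  have h2 : (⋃ k ∈ C.act, {c | N.ConflictEq c k}).Finite :=
    C.act.finite_toSet.biUnion fun k _ => finite_conflictEq hconf k
  refine ((h1.union h2).biUnion fun c _ => finite_revAt hconf c).subset ?_
  rintro t ⟨c, hc, ht⟩
  refine Set.mem_biUnion ?_ ht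
  simpa using hc

theorem weight_setRst (hX : C.relevant.Finite) {t : N.ImplTrans} (ht : t ∈ C.relevant)
    {r : RState N} : (C.setRst t r).weight + rstWeight t (C.rst t) = C.weight + rstWeight t r := by
  have h1 := finsum_mem_add_of_eq_off hX ht (f := fun t => rstWeight t (C.rst t))
    (g := fun t' => rstWeight t' ((C.setRst t r).rst t')) (fun k hk => by rw [setRst_of_ne _ hk])
  rw [setRst_self] at h1
  have h2 : (C.setRst t r).weight = ∑ᶠ p ∈ {p | C.mt p ≠ 0}, C.orig p +
    ∑ i ∈ C.act, phWeight i (C.ph i) +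
      ∑ᶠ t' ∈ C.relevant, rstWeight t' ((C.setRst t r).rst t') := rfl
  have h3 : C.weight = ∑ᶠ p ∈ {p | C.mt p ≠ 0}, C.orig p + ∑ i ∈ C.act, phWeight i (C.ph i) +
    ∑ᶠ t ∈ C.relevant, rstWeight t (C.rst t) := rfl
  lia

theorem weight_setPh {i : N.T} (hi : i ∈ C.act) {P : TPhase N} :
    (C.setPh i P).weight + phWeight i (C.ph i) = C.weight + phWeight i P := by
  have h1 := Finset.sum_add_of_eq_off hi (f := fun k => phWeight k (C.ph k))
    (g := fun k => phWeight k ((C.setPh i P).ph k)) (fun k hk => by rw [setPh_of_ne _ hk])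
  rw [setPh_self] at h1
  have h2 : (C.setPh i P).weight = ∑ᶠ p ∈ {p | C.mt p ≠ 0}, C.orig p +
    ∑ k ∈ C.act, phWeight k ((C.setPh i P).ph k) +
      ∑ᶠ t ∈ C.relevant, rstWeight t (C.rst t) := rfl
  have h3 : C.weight = ∑ᶠ p ∈ {p | C.mt p ≠ 0}, C.orig p + ∑ i ∈ C.act, phWeight i (C.ph i) +
    ∑ᶠ t ∈ C.relevant, rstWeight t (C.rst t) := rfl
  lia

theorem mem_relevant_of_undoSet {ω : N.T} (hω : ω ∈ C.act) {t : N.ImplTrans}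
    (ht : t ∈ N.undoSet ω) : t ∈ C.relevant := by
  obtain ⟨c, hc, htc⟩ := mem_undoSet.1 ht
  exact ⟨c, Or.inr ⟨ω, hω, hc⟩, htc⟩

/-- Silent steps of configurations decrease the number of active transitions or else the
weight. -/
theorem Tau.decreases (h : C.Tau C') (W : C.WF) (hfin : N.IsFinitary)
    (hM : ¬ N.HasFullyReachablePureM) (hconf : N.IsConflictFinite) :
    C'.act.card < C.act.card ∨ (C'.act.card = C.act.card ∧ C'.weight < C.weight) := by
  have hX := C.finite_relevant hfin hconf W
  have hW' := h.wf W hfin hM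
  cases h with
  | @dist p hp h =>
    obtain ⟨c, hc⟩ := hp
    refine Or.inr ⟨rfl, ?_⟩
    have hmt : p ∈ {p | C.mt p ≠ 0} := by
      have := W.tokens p c hc
      simp only [Set.mem_ofPred_eq]
      lia
    have h1 := finsum_mem_add_of_eq_off (hfin.2 C.mt W.reach).1 hmt (f := C.orig)
      (g := (C.dist p).orig) (fun q hq => by simp [Config.dist, hq])
    have h2 : (C.dist p).orig p = C.orig p - 1 := by simp [Config.dist]
    have h3 : (C.dist p).weight = ∑ᶠ q ∈ {p | C.mt p ≠ 0}, (C.dist p).orig q +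
      ∑ k ∈ C.act, phWeight k (C.ph k) + ∑ᶠ t ∈ C.relevant, rstWeight t (C.rst t) := rfl
    have h4 : C.weight = ∑ᶠ p ∈ {p | C.mt p ≠ 0}, C.orig p +
      ∑ i ∈ C.act, phWeight i (C.ph i) + ∑ᶠ t ∈ C.relevant, rstWeight t (C.rst t) := rfl
    lia
  | @fireIni j h1 h2 =>
    refine Or.inr ⟨rfl, ?_⟩
    have h3 : N.pre j ≤ C.mt := hW'.pre_le_of_holding (c := j) (by
      simp [Config.fireIni, setRst_self, RState.Holding])
    have h4 := C.weight_setRst hX (r := .fired) ⟨j, Or.inl h3, Or.inl rfl⟩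
    rw [h2] at h4
    simp only [rstWeight] at h4
    change (C.setRst (.initialise j) .fired).weight < _
    lia
  | @fireTransfer h j hj h1 h2 h3 =>
    refine Or.inr ⟨rfl, ?_⟩
    have h3 : N.pre j ≤ C.mt := W.pre_le_of_holding h1.holding
    have h4 := C.weight_setRst hX (r := .fired) ⟨j, Or.inl h3, Or.inr ⟨h, hj, rfl⟩⟩
    rw [h2] at h4
    simp only [rstWeight] at h4
    lia
  | @undo ω t ht h1 h2 =>
    refine Or.inr ⟨rfl, ?_⟩
    have h4 := C.weight_setRst hX (r := .undoing ω ∅)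
      (mem_relevant_of_undoSet (W.undo_mem h1) ht)
    rw [h2] at h4
    simp only [rstWeight, Set.sdiff_empty] at h4
    lia
  | @undoFar ω t A f hf h1 h2 h3 =>
    refine Or.inr ⟨rfl, ?_⟩
    obtain ⟨h5, h6⟩ := W.kept ω t (by simp [h1, RState.KeptBy])
    have h4 := C.weight_setRst hX (r := .undoing ω (insert f A))
      (mem_relevant_of_undoSet (W.undo_mem h5) h6)
    have h7 : (farSet t \ insert f A).ncard < (farSet t \ A).ncard := by
      refine Set.ncard_lt_ncard ?_ ((finite_farSet hconf ⟨ω, h6⟩).subset Set.sdiff_subset)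
      refine ⟨fun x hx => ⟨hx.1, fun hA => hx.2 (Or.inr hA)⟩, fun hsub => ?_⟩
      exact (hsub ⟨hf, h2⟩).2 (Or.inl rfl)
    rw [h1] at h4
    simp only [rstWeight] at h4
    lia
  | @undoneIni j ω A h1 h2 =>
    refine Or.inr ⟨rfl, ?_⟩
    obtain ⟨h5, h6⟩ := W.kept ω (.initialise j) (by simp [h1, RState.KeptBy])
    have h4 := C.weight_setRst hX (r := .undone ω) (mem_relevant_of_undoSet (W.undo_mem h5) h6)
    rw [h1] at h4
    simp only [rstWeight] at h4
    change (C.setRst (.initialise j) (.undone ω)).weight < _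
    lia
  | @undoneTransfer h j ω hj A h1 h2 =>
    refine Or.inr ⟨rfl, ?_⟩
    obtain ⟨h5, h6⟩ := W.kept ω (.transfer h j hj) (by simp [h1, RState.KeptBy])
    have h4 := C.weight_setRst hX (r := .undone ω) (mem_relevant_of_undoSet (W.undo_mem h5) h6)
    rw [h1] at h4
    simp only [rstWeight] at h4
    lia
  | @reset ω t A ht h1 h2 h3 =>
    refine Or.inr ⟨rfl, ?_⟩
    have hω : ω ∈ C.act := by simp [W.mem_act, h1]
    have h4 := C.weight_setRst hX (r := .idle) (mem_relevant_of_undoSet hω ht)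
    have h5 := (C.setRst t .idle).weight_setPh hω (P := .resetting (insert t A))
    have h6 : (C.setRst t .idle).ph ω = .resetting A := h1
    have h7 : phWeight ω (.resetting A) =
        (farSet t).ncard + 4 + phWeight ω (.resetting (insert t A)) := phWeight_insert hconf ht h2
    rw [h3] at h4
    rw [h6, h7] at h5
    simp only [rstWeight] at h4
    change ((C.setRst t .idle).setPh ω (.resetting (insert t A))).weight < _
    lia
  | @elide ω t A ht h1 h2 h3 =>
    refine Or.inr ⟨rfl, ?_⟩
    have hω : ω ∈ C.act := by simp [W.mem_act, h1]
    have h5 := C.weight_setPh hω (P := .resetting (insert t A))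
    have h7 : phWeight ω (.resetting A) =
        (farSet t).ncard + 4 + phWeight ω (.resetting (insert t A)) := phWeight_insert hconf ht h2
    rw [h1, h7] at h5
    lia
  | @fetch i j p c D hi hc h1 h2 h3 =>
    refine Or.inr ⟨rfl, ?_⟩
    have hia : i ∈ C.act := by simp [W.mem_act, h1]
    have h5 := C.weight_setPh hia (P := .fetching j (insert (p, c) D))
    have h6 : ({x : N.S × N.T | N.pre i x.1 ≠ 0 ∧ N.pre x.2 x.1 ≠ 0} \ insert (p, c) D).ncard <
        ({x : N.S × N.T | N.pre i x.1 ≠ 0 ∧ N.pre x.2 x.1 ≠ 0} \ D).ncard := by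
      refine Set.ncard_lt_ncard ?_ ?_
      · refine ⟨fun x hx => ⟨hx.1, fun hA => hx.2 (Or.inr hA)⟩, fun hsub => ?_⟩
        exact (hsub (a := (p, c)) ⟨⟨hi, hc⟩, h2⟩).2 (Or.inl rfl)
      · refine (((hfin.2 C.mt W.reach).1.prod (finite_conflictEq hconf i)).subset ?_).subset
          Set.sdiff_subset
        rintro ⟨q, d⟩ ⟨hq, hd⟩
        refine ⟨fun h => hq ?_, (conflictEq_iff hfin).2 ⟨q, hd, hq⟩⟩
        have := W.act_le i hia q
        simp only at h hq
        lia
    rw [h1] at h5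
    simp only [phWeight] at h5
    change (C.setPh i (.fetching j (insert (p, c) D))).weight < _
    lia
  | @fetched i j D h1 h2 =>
    refine Or.inr ⟨rfl, ?_⟩
    have hia : i ∈ C.act := by simp [W.mem_act, h1]
    have h5 := C.weight_setPh hia (P := .resetting ∅)
    rw [h1] at h5
    simp only [phWeight, Set.sdiff_empty] at h5
    lia
  | @complete i A h1 h2 =>
    have hia : i ∈ C.act := by simp [W.mem_act, h1]
    refine Or.inl (Finset.card_lt_card ⟨fun k hk => (mem_complete_act.1 hk).2, fun hsub => ?_⟩)
    exact (mem_complete_act.1 (hsub hia)).1 rfl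

end Config
end PetriNet

/-! ### Quiet configurations -/

namespace PetriNet.Config

variable {Act : Type u} {N : PetriNet.{u, v, w} Act} [LinearOrder N.T] {C : Config N}

/-- No silent transition of the implementation is enabled. -/
def Quiet (C : Config N) : Prop :=
  ∀ t : N.implRev.Trans, N.impl.label t = none → ¬ ipre t ≤ conc C

namespace WF

/-- If the tokens of a preplace `p` of `c` have been distributed, and no active transition has
fetched from the copy `p_c`, then all tokens of `p` are on `p_c`, unless `c` is initialised. -/
theorem copy_eq (W : C.WF) {p : N.S} {c : N.T} (hc : N.pre c p ≠ 0) (ho : C.orig p = 0)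
    (hh : ¬ (C.rst (.initialise c)).Holding)
    (hk : ∀ k ∈ C.act, N.pre k p ≠ 0 → ¬ (C.ph k).Fetched p c) : C.copy p c = C.mt p := by
  have h1 := W.tokens p c hc
  rw [tok_false hh, Finset.sum_eq_zero] at h1
  · lia
  · intro k hka
    by_cases hp : N.pre k p = 0
    · simp [hp]
    · simp [tok_false (hk k hka hp)]

theorem std_of_quiet {t : N.ImplTrans} (h : ∀ j, t ≠ .initialise j)
    (h' : ∀ h j hj, t ≠ .transfer h j hj) : ¬ N.implRev.Reversible t := by
  rw [reversible_iff]
  rintro (⟨j, rfl⟩ | ⟨i, j, hj, rfl⟩)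
  exacts [h j rfl, h' _ _ _ rfl]

theorem orig_eq_zero_of_quiet (hquiet : C.Quiet) {p : N.S} {c : N.T} (hc : N.pre c p ≠ 0) :
    C.orig p = 0 := by
  have h1 := hquiet (.std (.distribute p ⟨c, hc⟩) (std_of_quiet (by simp) (by simp))) rfl
  rw [le_conc_dist] at h1
  lia

/-- In a quiet configuration all active transitions are visibly firing. A resetting transition
could reset or elide some transition, or be completed. If a transition `k` that is fetching
cannot fetch from `p_c`, then the missing tokens are held by `ini_c`, which then can be undone on
behalf of `k`, as no token that it or `trans^b_c` produced is in use by a firing transition. -/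
theorem exists_exec_of_quiet (W : C.WF) (hquiet : C.Quiet) (hfin : N.IsFinitary)
    (hM : ¬ N.HasFullyReachablePureM)
    (hscn : N.IsStructuralConflictNet) {k : N.T} (hk : k ∈ C.act) : ∃ j, C.ph k = .exec j := by
  cases h : C.ph k with
  | idle => exact absurd h ((W.mem_act k).1 hk)
  | exec j => exact ⟨j, rfl⟩
  | resetting A =>
    exfalso
    have h1 := hquiet (.std (.complete k) (std_of_quiet (by simp) (by simp))) rfl
    rw [le_conc_complete] at h1
    push Not at h1
    obtain ⟨t, ht, hA⟩ := h1
    have h2 : (C.ph k).Reset t := by simpa [h, TPhase.Ack, TPhase.Reset] using hA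
    have h3 := hquiet (.reset k t ht) rfl
    have h4 := hquiet (.elide k t ht) rfl
    rw [le_conc_reset] at h3
    rw [le_conc_elide] at h4
    have h5 : (C.rst t).KeptBy k := by
      by_contra h5
      exact h4 ⟨h2, h5⟩
    have h6 : (C.rst t).Holding := by
      cases hr : C.rst t <;> simp_all [RState.KeptBy, RState.Holding]
    obtain ⟨c, hc, rfl | ⟨b, hb, rfl⟩⟩ := mem_undoSet.1 ht
    · exact W.not_holding_of_resetting hfin hscn h hc h6
    · exact W.not_holding_of_resetting hfin hscn h hc (W.hold b c hb h6).holding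
  | fetching l D =>
    exfalso
    have hundo : ∀ t, (C.ph k).Undo t := by simp [h, TPhase.Undo]
    have hloc := W.loc k l (by simp [h, TPhase.Locks])
    have hexec : ∀ i m, (C.ph i).ExecAt m → i ≠ k := by
      rintro i m hi rfl
      simp [h, TPhase.ExecAt] at hi
    have h1 := hquiet (.std (.fetched k l hloc.1) (std_of_quiet (by simp) (by simp))) rfl
    rw [le_conc_fetched] at h1
    push Not at h1
    obtain ⟨p, c, hp, hc, hD⟩ := h1
    have h2 : (C.ph k).FetchIn l p c := by simpa [h, TPhase.FetchOut, TPhase.FetchIn] using hD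
    have h3 := hquiet (.std (.fetch k l hloc.1 p c hp hc) (std_of_quiet (by simp) (by simp))) rfl
    rw [le_conc_fetch] at h3
    have hck : N.ConflictEq c k := (conflictEq_iff hfin).2 ⟨p, hc, hp⟩
    -- The tokens that `k` still has to fetch are held by `ini_c`.
    have hhold : (C.rst (.initialise c)).Holding := by
      by_contra hh
      have h4 := W.copy_eq hc (orig_eq_zero_of_quiet hquiet hc) hh (by
        intro k' hk' hp'
        obtain rfl := W.act_disj k hk k' hk' ((conflictEq_iff hfin).2 ⟨p, hp, hp'⟩)
        simpa [h, TPhase.FetchOut, TPhase.Fetched] using hD)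
      exact h3 ⟨h2, h4 ▸ W.act_le k hk p⟩
    have hle := W.pre_le_of_holding hhold
    have hnexec : ∀ m, ¬ (C.ph c).ExecAt m := by
      intro m hm
      exact hexec c m hm (W.act_disj c (W.locks_mem hm.locks) k hk hck)
    have hnexec' : ∀ i, ¬ (C.ph i).ExecAt c := by
      intro i hi
      have h5 : N.ConflictEq i c := (W.loc i c hi.locks).1.imp (fun h => h.2) id
      exact hexec i c hi (W.act_unique hfin hM hle (W.locks_mem hi.locks) hk h5.symm hck)
    have hnfired : ∀ t ∈ N.undoSet k, ¬ (C.rst t).IsFired := by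
      intro t ht hf
      have h5 := hquiet (.undo k t ht) rfl
      rw [le_conc_undo] at h5
      refine h5 ⟨⟨hundo t, ?_⟩, hf⟩
      rw [RState.isFired_iff.1 hf]
      simp [RState.KeptBy]
    have hundoing : ∀ t ∈ N.undoSet k, (C.rst t).Holding →
        ∃ f, implFlow t .far f ≠ 0 ∧ (C.rst t).Has f ∧ ¬ 1 ≤ conc C (.base f) := by
      intro t ht hh
      have hr : N.implRev.Reversible t := ⟨k, ht⟩
      have h5 := hquiet (.undone t hr) rfl
      rw [le_conc_undone] at h5
      push Not at h5
      obtain ⟨f, hf, hA⟩ := h5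
      have h6 : ¬ ((C.rst t).Take f ∧ 1 ≤ conc C (.base f)) := fun h8 =>
        hquiet (.undoFar f t hr hf) rfl (le_conc_undoFar.2 h8)
      have h7 : (C.rst t).Take f ∧ (C.rst t).Has f := by
        have := hnfired t ht
        cases hr : C.rst t <;>
          simp_all [RState.Take, RState.Took, RState.Has, RState.Holding, RState.IsFired]
      exact ⟨f, hf, h7.2, fun h8 => h6 ⟨h7.1, h8⟩⟩
    obtain ⟨f, hf, hhas, hconc⟩ := hundoing _ (initialise_mem_undoSet.2 hck) hhold
    rcases far_initialise hf with ⟨m, hm, rfl⟩ | ⟨b, hb, rfl⟩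
    · exact hconc (by simp [conc, tok, hhas, hnexec m])
    · have hhold' : (C.rst (.transfer b c hb)).Holding := by
        by_contra hh
        exact hconc (by simp [conc, tok, hhas, hh])
      obtain ⟨f, hf, hhas', hconc'⟩ := hundoing _ (transfer_mem_undoSet.2 hck) hhold'
      obtain rfl := far_transfer hf
      exact hconc' (by simp [conc, tok, hhas', hnexec'])

/-- In a quiet configuration the implementation can start each transition that
the original net can start: at the largest location among the enabled transitions it is in
conflict with. By maximality no `trans^j_l` competes for the places `π_{j#l}`. -/
theorem exists_exec_le_conc_of_quiet (W : C.WF) (hquiet : C.Quiet) (hfin : N.IsFinitary)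
    (hM : ¬ N.HasFullyReachablePureM)
    (hscn : N.IsStructuralConflictNet) (hconf : N.IsConflictFinite) {i : N.T}
    (hi : N.pre i ≤ C.mt) (hfree : ∀ k ∈ C.act, ¬ N.ConflictEq i k) :
    ∃ j hij ht, ipre (.std (.execute i j hij) ht) ≤ conc C := by
  have hexec : ∀ k ∈ C.act, ∃ j, C.ph k = .exec j :=
    fun k hk => W.exists_exec_of_quiet hquiet hfin hM hscn hk
  have hkept : ∀ t ω, ¬ (C.rst t).KeptBy ω := by
    intro t ω h
    have h1 := (W.kept ω t h).1
    obtain ⟨j, hj⟩ := hexec ω (W.undo_mem h1)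
    simp [hj, TPhase.Undo] at h1
  have hrst : ∀ t, C.rst t = .idle ∨ C.rst t = .fired := by
    intro t
    have h1 := hkept t
    cases hr : C.rst t <;> simp_all [RState.KeptBy]
  -- The conflict class of `i` among the enabled transitions; its maximum is the location.
  let K : Set N.T := {c | N.ConflictEq c i ∧ N.pre c ≤ C.mt}
  have hKfin : K.Finite := (finite_conflictEq hconf i).subset fun c hc => hc.1
  have hiK : i ∈ K := ⟨Or.inr rfl, hi⟩
  obtain ⟨j, hjK, hmax⟩ := Set.exists_max_image K id hKfin ⟨i, hiK⟩
  have hKfree : ∀ c ∈ K, ∀ k ∈ C.act, ¬ N.ConflictEq c k := by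
    intro c hc k hk hck
    exact hfree k hk (hc.1.symm.trans hfin hM W.reach hi hc.2 (W.act_le k hk) hck)
  have hKmem : ∀ c, N.ConflictEq c j → N.pre c ≤ C.mt → c ∈ K := fun c hc hle =>
    ⟨hc.trans hfin hM W.reach hle hjK.2 hi hjK.1, hle⟩
  have hKlock : ∀ c ∈ K, ∀ k, ¬ (C.ph k).Locks c := by
    intro c hc k hk
    have h1 : N.ConflictEq k c := (W.loc k c hk).1.imp (fun h => h.2) id
    exact hKfree c hc k (W.locks_mem hk) h1.symm
  have hKfired : ∀ c ∈ K, C.rst (.initialise c) = .fired := by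
    intro c hc
    refine (hrst _).resolve_left fun hidle => ?_
    have h1 := hquiet (.fire (.initialise c) (reversible_iff.2 (Or.inl ⟨c, rfl⟩))) rfl
    rw [le_conc_fire_ini] at h1
    refine h1 ⟨fun p hp => ?_, by simp [hidle, RState.IsIdle]⟩
    rw [W.copy_eq hp (orig_eq_zero_of_quiet hquiet hp) (by simp [hidle, RState.Holding])]
    · exact hc.2 p
    · intro k hk hp'
      exact absurd ((conflictEq_iff hfin).2 ⟨p, hp, hp'⟩) (hKfree c hc k hk)
  have hij : N.LeC i j := by
    rcases (hmax i hiK).lt_or_eq with hlt | heq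
    · exact Or.inl ⟨hlt, hjK.1.symm.resolve_right hlt.ne⟩
    · exact Or.inr heq
  refine ⟨j, hij, std_of_quiet (by simp) (by simp), le_conc_exec.2 ⟨⟨?_, ?_⟩, ?_, ?_⟩⟩
  · rw [hKfired i hiK]
    trivial
  · exact fun h => hKlock j hjK i h.locks
  · intro h hj
    refine ⟨?_, fun k hk => hKlock j hjK k hk.locks⟩
    have h1 : C.rst (.transfer h j hj) = .fired := by
      refine (hrst _).resolve_left fun hidle => ?_
      have h1 := hquiet
        (.fire (.transfer h j hj) (reversible_iff.2 (Or.inr ⟨h, j, hj, rfl⟩))) rfl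
      rw [le_conc_fire_trans, hKfired j hjK, hidle] at h1
      refine h1 ⟨⟨trivial, by simp [RState.Holding]⟩, trivial, fun k hk => ?_⟩
      obtain ⟨-, h2⟩ := W.loc k h hk
      exact hKlock h (hKmem h (Or.inl hj.2) h2) k hk
    rw [h1]
    trivial
  · intro l hl
    refine ⟨fun hlt => ?_, fun k => hKlock j hjK k⟩
    rcases hrst (.transfer j l hlt) with h1 | h1
    · rw [h1]
      trivial
    · have h2 := W.pre_le_of_transfer_holding (hj := hlt) (by simp [h1, RState.Holding])
      exact absurd (hmax l (hKmem l (ConflictEq.symm (Or.inl hlt.2)) h2)) (not_le.2 hlt.1)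

end WF

end PetriNet.Config

/-! ### The bisimulation -/

namespace PetriNet

variable {Act : Type u} {N : PetriNet.{u, v, w} Act} [LinearOrder N.T]

/-- The relation between the ST-markings of the implementation and those of the original net,
with the configuration that witnesses it. The marking of the original net is the one obtained from
`mt` by removing the preplaces of all active transitions and adding the postplaces of those that
have visibly terminated. Silent steps do not change it. -/
structure Simulates (C : Config N) (s : N.impl.stLTS.State) (q : N.stLTS.State) : Prop where
  wf : C.WF
  marking : s.1 = conc C
  /-- the currently firing transitions are the same, in the same order -/
  firing : List.Forall₂ (fun t i => ∃ j hij ht,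
    t = RevNet.Trans.std (R := N.implRev) (.execute i j hij) ht ∧ C.ph i = .exec j) s.2 q.2
  nodup : q.2.Nodup
  mem_iff : ∀ i, i ∈ q.2 ↔ ∃ j, C.ph i = .exec j
  tokens : ∀ p, q.1 p + ∑ k ∈ C.act, N.pre k p =
    C.mt p + ∑ k ∈ C.act, N.post k p * tok (C.ph k).Pending

variable (N) in
/-- The configuration of the initial marking. -/
def initConfig : Config N where
  orig := N.M₀
  copy _ _ := 0
  rst _ := .idle
  ph _ := .idle
  mt := N.M₀
  act := ∅

variable {C C' : Config N}

theorem initConfig_wf : (N.initConfig).WF where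
  reach := .init
  mem_act := by simp [initConfig]
  act_le := by simp [initConfig]
  act_disj := by simp [initConfig]
  loc := by simp [initConfig, TPhase.Locks]
  kept := by simp [initConfig, RState.KeptBy]
  hold := by simp [initConfig, RState.Holding]
  exec_ini := by simp [initConfig, TPhase.ExecAt]
  exec_trans := by simp [initConfig, TPhase.ExecAt]
  lock_idle := by simp [initConfig]
  lock_unique := by simp [initConfig, TPhase.Locks]
  lock_held := by simp [initConfig, TPhase.Locks]
  tokens := by simp [initConfig, RState.Holding]

theorem conc_initConfig : N.impl.M₀ = conc N.initConfig := by
  have h : ∀ s, RevNet.lift (R := N.implRev) implM₀ s = conc N.initConfig s := by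
    rw [forall_place]
    simp [RevNet.lift, implM₀, conc, initConfig, RState.IsIdle, RState.Has, TPhase.Locks,
      TPhase.FetchIn, TPhase.FetchOut, TPhase.Undo, TPhase.Reset, TPhase.Ack, RState.IsFired,
      RState.KeptBy, RState.Take, RState.Took, RState.IsUndone]
  exact funext h

theorem simulates_init : Simulates N.initConfig N.impl.stLTS.start N.stLTS.start where
  wf := initConfig_wf
  marking := conc_initConfig
  firing := .nil
  nodup := List.nodup_nil
  mem_iff := by simp [stLTS, initConfig]
  tokens := by simp [stLTS, initConfig]

theorem Config.Tau.exec_iff (h : C.Tau C') (i j : N.T) : C'.ph i = .exec j ↔ C.ph i = .exec j := by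
  have key : ∀ (k : N.T) (P : TPhase N), (∀ j, C.ph k ≠ .exec j) → (∀ j, P ≠ .exec j) →
      ((C.setPh k P).ph i = .exec j ↔ C.ph i = .exec j) := by
    intro k P h1 h2
    by_cases hk : i = k
    · subst hk
      simp [setPh_self, h1, h2]
    · rw [setPh_of_ne _ hk]
  cases h
  case reset ω t A h1 h2 h3 h4 => exact key ω (.resetting (insert t A)) (by simp [h2]) (by simp)
  case elide ω t A h1 h2 h3 h4 => exact key _ _ (by simp [h2]) (by simp)
  case fetch i j p c D h1 h2 h3 h4 h5 =>
    exact key i (.fetching j (insert (p, c) D)) (by simp [h3]) (by simp)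
  case fetched h1 h2 => exact key _ _ (by simp [h1]) (by simp)
  case complete i A h1 h2 => exact key i .idle (by simp [h1]) (by simp)
  all_goals exact Iff.rfl

theorem Config.Tau.tokens (h : C.Tau C') (W : C.WF) {M : N.S → ℕ}
    (hM : ∀ p, M p + ∑ k ∈ C.act, N.pre k p =
      C.mt p + ∑ k ∈ C.act, N.post k p * tok (C.ph k).Pending) (p : N.S) :
    M p + ∑ k ∈ C'.act, N.pre k p =
      C'.mt p + ∑ k ∈ C'.act, N.post k p * tok (C'.ph k).Pending := by
  have h0 := hM p
  have key : ∀ (k : N.T) (P : TPhase N), (C.ph k).Pending → P.Pending →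
      ∀ i, ((C.setPh k P).ph i).Pending = (C.ph i).Pending := by
    intro k P h1 h2 i
    by_cases hk : i = k
    · subst hk
      simp [setPh_self, h1, h2]
    · rw [setPh_of_ne _ hk]
  cases h
  case reset ω t A h1 h2 h3 h4 =>
    have h5 := key ω (.resetting (insert t A)) (by simp [h2, TPhase.Pending])
      (by simp [TPhase.Pending])
    change M p + ∑ k ∈ C.act, N.pre k p = C.mt p + ∑ k ∈ C.act,
      N.post k p * tok ((C.setPh ω (.resetting (insert t A))).ph k).Pending
    simpa only [h5] using h0
  case elide ω t A h1 h2 h3 h4 =>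
    have h5 := key ω (.resetting (insert t A)) (by simp [h2, TPhase.Pending])
      (by simp [TPhase.Pending])
    change M p + ∑ k ∈ C.act, N.pre k p = C.mt p + ∑ k ∈ C.act,
      N.post k p * tok ((C.setPh ω (.resetting (insert t A))).ph k).Pending
    simpa only [h5] using h0
  case fetch i j q c D h1 h2 h3 h4 h5 =>
    have h5 := key i (.fetching j (insert (q, c) D)) (by simp [h3, TPhase.Pending])
      (by simp [TPhase.Pending])
    change M p + ∑ k ∈ C.act, N.pre k p = C.mt p + ∑ k ∈ C.act,
      N.post k p * tok ((C.setPh i (.fetching j (insert (q, c) D))).ph k).Pending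
    simpa only [h5] using h0
  case fetched i j D h1 h2 =>
    have h5 := key i (.resetting ∅) (by simp [h1, TPhase.Pending]) (by simp [TPhase.Pending])
    change M p + ∑ k ∈ C.act, N.pre k p = C.mt p + ∑ k ∈ C.act,
      N.post k p * tok ((C.setPh i (.resetting ∅)).ph k).Pending
    simpa only [h5] using h0
  case complete i A h1 h2 =>
    classical
    have hi : i ∈ C.act := by simp [W.mem_act, h1]
    have h3 : (C.complete i).act = C.act.erase i := by ext; simp [mem_complete_act]
    have h4 : ∑ k ∈ C.act.erase i, N.post k p * tok ((C.complete i).ph k).Pending =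
        ∑ k ∈ C.act.erase i, N.post k p * tok (C.ph k).Pending := by
      refine Finset.sum_congr rfl fun k hk => ?_
      rw [show (C.complete i).ph k = C.ph k from setPh_of_ne _ (Finset.ne_of_mem_erase hk)]
    have h5 : (C.complete i).mt p = C.mt p - N.pre i p + N.post i p := rfl
    have h6 := W.act_le i hi p
    rw [← Finset.add_sum_erase _ _ hi, ← Finset.add_sum_erase _ _ hi, tok_true (by
      simp [h1, TPhase.Pending])] at h0
    rw [h3, h4, h5]
    lia
  all_goals exact h0

/-- The relation is invariant under silent steps of the implementation. -/
theorem Simulates.tau {s : N.impl.stLTS.State} {q : N.stLTS.State} (h : Simulates C s q)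
    (hfin : N.IsFinitary) (hplain : N.IsPlain) (hM : ¬ N.HasFullyReachablePureM)
    {s' : N.impl.stLTS.State} (hs : N.impl.stLTS.Tr s none s') :
    ∃ C', C.Tau C' ∧ Simulates C' s' q := by
  obtain ⟨M, U⟩ := s
  obtain rfl : M = conc C := h.marking
  cases hs with
  | @tau _ M' _ t hl hstep =>
    obtain ⟨hle, hM'⟩ := step_single.1 hstep
    replace hle : ipre t ≤ conc C := fun x => (congrFun (impl_pre t) x).ge.trans (hle x)
    replace hM' : M' = conc C - ipre t + ipost t :=
      hM'.trans (congrArg₂ (fun a b => conc C - a + b) (impl_pre t) (impl_post t))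
    obtain ⟨C', hC', heq⟩ := exists_tau h.wf hfin hplain hl hle
    refine ⟨C', hC', hC'.wf h.wf hfin hM, hM'.trans heq, ?_, h.nodup, ?_, hC'.tokens h.wf h.tokens⟩
    · simpa only [hC'.exec_iff] using h.firing
    · simpa only [hC'.exec_iff] using h.mem_iff

/-- There are no infinite sequences of silent steps. -/
theorem Simulates.acc {s : N.impl.stLTS.State} {q : N.stLTS.State} (h : Simulates C s q)
    (hfin : N.IsFinitary) (hplain : N.IsPlain) (hM : ¬ N.HasFullyReachablePureM)
    (hconf : N.IsConflictFinite) : Acc (fun s' s => N.impl.stLTS.Tr s none s') s := by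
  suffices H : ∀ (x : ℕ ×ₗ ℕ) (C : Config N) (s : N.impl.stLTS.State),
      toLex (C.act.card, C.weight) = x → Simulates C s q →
      Acc (fun s' s => N.impl.stLTS.Tr s none s') s from H _ C s rfl h
  intro x
  induction x using WellFoundedLT.induction with
  | ind x ih =>
    rintro C s rfl h
    refine ⟨s, fun s' hs => ?_⟩
    obtain ⟨C', hC', h'⟩ := h.tau hfin hplain hM hs
    refine ih _ ?_ C' s' rfl h'
    rw [Prod.Lex.toLex_lt_toLex]
    exact hC'.decreases h.wf hfin hM hconf

/-- Silent steps lead to a quiet configuration related to the same marking of the original net. -/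
theorem exists_quiet {s : N.impl.stLTS.State} {q : N.stLTS.State} (h : Simulates C s q)
    (hfin : N.IsFinitary) (hplain : N.IsPlain) (hM : ¬ N.HasFullyReachablePureM)
    (hconf : N.IsConflictFinite) :
    ∃ s' C', N.impl.stLTS.TauStar s s' ∧ Simulates C' s' q ∧ C'.Quiet := by
  induction h.acc hfin hplain hM hconf generalizing C with
  | intro s _ ih =>
    by_cases hq : C.Quiet
    · exact ⟨s, C, .refl, h, hq⟩
    · unfold Config.Quiet at hq
      push Not at hq
      obtain ⟨t, hl, hle⟩ := hq
      have hs : N.impl.stLTS.Tr s none (s.1 - N.impl.pre t + N.impl.post t, s.2) := by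
        refine STTr.tau hl (step_single.2 ⟨?_, rfl⟩)
        rw [h.marking]
        exact fun x => (congrFun (impl_pre t) x).le.trans (hle x)
      obtain ⟨C', -, h'⟩ := h.tau hfin hplain hM hs
      obtain ⟨s', C'', h1, h2, h3⟩ := ih _ hs h'
      exact ⟨s', C'', .head hs h1, h2, h3⟩

end PetriNet

theorem List.Forall₂.exists_getElem?_right {α β : Type*} {R : α → β → Prop} {l : List α}
    {l' : List β} (h : List.Forall₂ R l l') {n : ℕ} {a : α} (ha : l[n]? = some a) :
    ∃ b, l'[n]? = some b ∧ R a b := by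
  induction h generalizing n with
  | nil => simp at ha
  | cons hab _ ih =>
    cases n with
    | zero => simp_all
    | succ n => simpa using ih (by simpa using ha)

theorem List.Forall₂.eraseIdx {α β : Type*} {R : α → β → Prop} {l : List α}
    {l' : List β} (h : List.Forall₂ R l l') (n : ℕ) :
    List.Forall₂ R (l.eraseIdx n) (l'.eraseIdx n) := by
  induction h generalizing n with
  | nil => exact .nil
  | cons hab hl ih =>
    cases n with
    | zero => exact hl
    | succ n => exact .cons hab (ih n)

theorem List.Nodup.mem_eraseIdx_iff_ne {α : Type*} {l : List α} (h : l.Nodup) {n : ℕ} {a b : α}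
    (ha : l[n]? = some a) : b ∈ l.eraseIdx n ↔ b ≠ a ∧ b ∈ l := by
  classical
  obtain ⟨hn, rfl⟩ := List.getElem?_eq_some_iff.1 ha
  rw [← h.erase_getElem n hn, h.mem_erase_iff]

namespace PetriNet

variable {Act : Type u} {N : PetriNet.{u, v, w} Act} [LinearOrder N.T] {C C' : Config N}
  {s : N.impl.stLTS.State} {q : N.stLTS.State}

/-- The transition `exec^i_j` of the implementation. -/
abbrev execTrans (i j : N.T) (hij : N.LeC i j)
    (ht : ¬ N.implRev.Reversible (ImplTrans.execute i j hij)) : N.impl.T :=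
  RevNet.Trans.std (R := N.implRev) (ImplTrans.execute i j hij) ht

namespace Simulates

theorem sum_pre_eq_zero (hfin : N.IsFinitary) {i : N.T}
    (hfree : ∀ k ∈ C.act, ¬ N.ConflictEq i k) {p : N.S} (hp : N.pre i p ≠ 0) :
    ∑ k ∈ C.act, N.pre k p = 0 := by
  refine Finset.sum_eq_zero fun k hk => ?_
  by_contra h
  exact hfree k hk ((conflictEq_iff hfin).2 ⟨p, hp, h⟩)

/-- Whenever a transition `exec^i_j` is enabled, so is `i` in the original net. -/
theorem pre_le (h : Simulates C s q) (hfin : N.IsFinitary) (hM : ¬ N.HasFullyReachablePureM)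
    (hscn : N.IsStructuralConflictNet) {i j : N.T} {hij ht}
    (he : ipre (.std (.execute i j hij) ht) ≤ conc C) : N.pre i ≤ q.1 := by
  intro p
  by_cases hp : N.pre i p = 0
  · simp [hp]
  · have h1 := h.tokens p
    rw [sum_pre_eq_zero hfin (fun k hk => h.wf.exec_conflict_free hfin hM hscn he hk) hp] at h1
    have h2 := h.wf.pre_le_of_holding (h.wf.holding_of_exec he).1 p
    lia

/-- The start of `exec^i_j` is matched by the start of `i`. -/
theorem start (h : Simulates C s q) (hfin : N.IsFinitary) (hM : ¬ N.HasFullyReachablePureM)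
    (hscn : N.IsStructuralConflictNet) {i j : N.T} {hij ht}
    (he : ipre (.std (.execute i j hij) ht) ≤ conc C) :
    Simulates (C.exec i j)
      (s.1 - N.impl.pre (execTrans i j hij ht),
        s.2 ++ [execTrans i j hij ht])
      (q.1 - N.pre i, q.2 ++ [i]) := by
  have hfree : ∀ k ∈ C.act, ¬ N.ConflictEq i k :=
    fun k hk => h.wf.exec_conflict_free hfin hM hscn he hk
  have hi : i ∉ C.act := fun hi => hfree i hi (.inr rfl)
  have hidle : C.ph i = .idle := by simpa [h.wf.mem_act] using hi
  have hpre := h.pre_le hfin hM hscn he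
  obtain ⟨hi1, hj1⟩ := h.wf.holding_of_exec he
  have hnot : ∀ j, C.ph i ≠ .exec j := by simp [hidle]
  have hph : ∀ k, k ≠ i → (C.exec i j).ph k = C.ph k := fun k hk => Config.setPh_of_ne _ hk
  have hphi : (C.exec i j).ph i = .exec j := Config.setPh_self ..
  refine ⟨h.wf.exec (h.wf.pre_le_of_holding hi1) (h.wf.pre_le_of_holding hj1) hfree he, ?_, ?_,
    ?_, ?_, ?_⟩
  · funext x
    have h1 := effect_exec hidle he x
    have h2 : (N.impl.pre (execTrans i j hij ht)) x =
      ipre (.std (.execute i j hij) ht) x := congrFun (impl_pre _) x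
    have h3 := congrFun h.marking x
    change s.1 x - N.impl.pre (execTrans i j hij ht) x = _
    rw [h2, h3]
    exact (Nat.eq_sub_of_add_eq h1).symm
  · refine List.rel_append (h.firing.imp ?_) (.cons ⟨j, hij, ht, rfl, hphi⟩ .nil)
    rintro t k ⟨j', hij', ht', rfl, hk⟩
    refine ⟨j', hij', ht', rfl, ?_⟩
    rwa [hph k (by rintro rfl; exact hnot _ hk)]
  · have : i ∉ q.2 := by simpa [h.mem_iff] using hnot
    simpa [List.nodup_append, h.nodup] using fun a ha (hai : a = i) => this (hai ▸ ha)
  · intro k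
    by_cases hk : k = i
    · subst hk
      simp [hphi]
    · simp [hph k hk, hk, h.mem_iff]
  · intro p
    have h1 := h.tokens p
    have h2 : (C.exec i j).act = insert i C.act := by ext; simp [Config.mem_exec_act]
    have h3 : ∑ k ∈ C.act, N.post k p * tok ((C.exec i j).ph k).Pending =
        ∑ k ∈ C.act, N.post k p * tok (C.ph k).Pending :=
      Finset.sum_congr rfl fun k hk => by rw [hph k (by rintro rfl; exact hi hk)]
    have h4 := hpre p
    rw [h2, Finset.sum_insert hi, Finset.sum_insert hi, hphi, h3]
    have h5 : (C.exec i j).mt = C.mt := rfl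
    rw [tok_false (by simp [TPhase.Pending]), h5]
    simp only [Pi.sub_apply]
    lia

/-- The end of `exec^i_j` is matched by the end of `i`. -/
theorem finish (h : Simulates C s q) {i j : N.T} {hij ht} {n : ℕ} (hi : C.ph i = .exec j)
    (hn : q.2[n]? = some i) :
    Simulates (C.setPh i (.fetching j ∅))
      (s.1 + N.impl.post (execTrans i j hij ht),
        s.2.eraseIdx n)
      (q.1 + N.post i, q.2.eraseIdx n) := by
  have hact : i ∈ C.act := by simp [h.wf.mem_act, hi]
  have hph : ∀ k, k ≠ i → (C.setPh i (.fetching j ∅)).ph k = C.ph k :=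
    fun k hk => Config.setPh_of_ne _ hk
  have hphi : (C.setPh i (.fetching j ∅)).ph i = .fetching j ∅ := Config.setPh_self ..
  have hmem : ∀ k, k ∈ q.2.eraseIdx n ↔ k ≠ i ∧ k ∈ q.2 :=
    fun k => h.nodup.mem_eraseIdx_iff_ne hn
  refine ⟨h.wf.finish hi, ?_, ?_, h.nodup.eraseIdx n, ?_, ?_⟩
  · funext x
    have h1 := effect_finish (hij := hij) (ht := ht) h.wf hi x
    have h2 : (N.impl.post (execTrans i j hij ht)) x =
      ipost (.std (.execute i j hij) ht) x := congrFun (impl_post _) x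
    have h3 := congrFun h.marking x
    change s.1 x + N.impl.post (execTrans i j hij ht) x = _
    rw [h2, h3]
    exact h1.symm
  · have h1 := h.firing.eraseIdx n
    rw [List.forall₂_iff_get] at h1
    refine List.forall₂_iff_get.2 ⟨h1.1, fun m hm hm' => ?_⟩
    obtain ⟨j', hij', ht', h2, h3⟩ := h1.2 m hm hm'
    refine ⟨j', hij', ht', h2, ?_⟩
    rwa [hph _ ((hmem _).1 (List.get_mem _ _)).1]
  · intro k
    rw [hmem]
    by_cases hk : k = i
    · subst hk
      simp [hphi]
    · simp [hph k hk, hk, h.mem_iff]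
  · intro p
    have h1 := h.tokens p
    have h3 : ∑ k ∈ C.act.erase i, N.post k p * tok ((C.setPh i (.fetching j ∅)).ph k).Pending =
        ∑ k ∈ C.act.erase i, N.post k p * tok (C.ph k).Pending :=
      Finset.sum_congr rfl fun k hk => by rw [hph k (Finset.ne_of_mem_erase hk)]
    have h2 : ∀ f : N.T → ℕ, ∑ k ∈ C.act, f k = f i + ∑ k ∈ C.act.erase i, f k :=
      fun f => (Finset.add_sum_erase _ f hact).symm
    change q.1 p + N.post i p + ∑ k ∈ C.act, N.pre k p = C.mt p +
      ∑ k ∈ C.act, N.post k p * tok ((C.setPh i (.fetching j ∅)).ph k).Pending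
    rw [h2 fun k => N.post k p * tok ((C.setPh i (.fetching j ∅)).ph k).Pending, h3, hphi,
      tok_true (by simp [TPhase.Pending])]
    rw [h2 fun k => N.post k p * tok (C.ph k).Pending, hi, tok_false (by simp [TPhase.Pending])]
      at h1
    lia

/-- In a quiet configuration no transition is between its visible end and its completion, so that
a transition enabled in the original net is in conflict with no active transition and can be
started by the implementation. -/
theorem exists_exec (h : Simulates C s q) (hquiet : C.Quiet) (hfin : N.IsFinitary)
    (hM : ¬ N.HasFullyReachablePureM) (hscn : N.IsStructuralConflictNet)
    (hconf : N.IsConflictFinite) {i : N.T} (hi : N.pre i ≤ q.1) :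
    ∃ j hij ht, ipre (.std (.execute i j hij) ht) ≤ conc C := by
  -- The preplaces of `i` are available in addition to those of the active transitions.
  have h1 : ∀ p, q.1 p + ∑ k ∈ C.act, N.pre k p = C.mt p := by
    intro p
    have h2 : ∑ k ∈ C.act, N.post k p * tok (C.ph k).Pending = 0 := by
      refine Finset.sum_eq_zero fun k hk => ?_
      obtain ⟨j, hj⟩ := h.wf.exists_exec_of_quiet hquiet hfin hM hscn hk
      rw [hj, tok_false (by simp [TPhase.Pending]), mul_zero]
    rw [h.tokens p, h2, add_zero]
  refine h.wf.exists_exec_le_conc_of_quiet hquiet hfin hM hscn hconf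
    (fun p => (hi p).trans ((Nat.le_add_right _ _).trans (h1 p).le)) fun k hk => ?_
  refine not_conflictEq_of_add_le hfin hscn h.wf.reach fun p => ?_
  rw [← h1 p]
  exact add_le_add (hi p) (Finset.single_le_sum (f := fun k => N.pre k p)
    (fun _ _ => Nat.zero_le _) hk)

end Simulates

theorem exists_execTrans_of_label {t : N.impl.T} {a : Act} (ht : N.impl.label t = some a) :
    ∃ i j hij hr, t = execTrans i j hij hr := by
  rcases t with ⟨t, hr⟩ | ⟨t, hr⟩ | _ | _ | _ | _ | _
  · cases t with
    | execute i j hij => exact ⟨i, j, hij, hr, rfl⟩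
    | _ => cases ht
  · cases t with
    | execute i j hij => exact absurd hr (by simp [reversible_iff])
    | _ => cases ht
  all_goals cases ht

theorem IsPlain.not_tau {N : PetriNet.{u, v, w} Act} (hplain : N.IsPlain)
    {q q' : N.stLTS.State} : ¬ N.stLTS.Tr q none q' := by
  rintro (_ | _ | ⟨hl, -⟩)
  exact hplain.2 _ hl

/-- The visible transitions of the implementation are matched by the original net. -/
theorem Simulates.forth (h : Simulates C s q) (hfin : N.IsFinitary)
    (hM : ¬ N.HasFullyReachablePureM) (hscn : N.IsStructuralConflictNet) {α : Phase Act}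
    {s' : N.impl.stLTS.State} (hs : N.impl.stLTS.Tr s (some α) s') :
    ∃ q' C', N.stLTS.Tr q (some α) q' ∧ Simulates C' s' q' := by
  cases hs with
  | @start M U t a hl hen =>
    obtain ⟨i, j, hij, hr, rfl⟩ := exists_execTrans_of_label hl
    have he : ipre (.std (.execute i j hij) hr) ≤ conc C := fun x =>
      (congrFun (impl_pre _) x).ge.trans ((enabled_single.1 hen x).trans (congrFun h.marking x).le)
    exact ⟨_, _, STTr.start hl (enabled_single.2 (h.pre_le hfin hM hscn he)),
      h.start hfin hM hscn he⟩
  | @finish M U t a n hn hl =>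
    obtain ⟨i, hi, j, hij, hr, rfl, hph⟩ := h.firing.exists_getElem?_right hn
    exact ⟨_, _, STTr.finish hi hl, h.finish hph hi⟩

/-- The transitions of the original net are matched by the implementation, after silent steps
that lead to a quiet configuration. -/
theorem Simulates.back (h : Simulates C s q) (hfin : N.IsFinitary) (hplain : N.IsPlain)
    (hM : ¬ N.HasFullyReachablePureM) (hscn : N.IsStructuralConflictNet)
    (hconf : N.IsConflictFinite) {α : Option (Phase Act)}
    {q' : N.stLTS.State} (hq : N.stLTS.Tr q α q') :
    ∃ s₁ s' C₁ C', N.impl.stLTS.TauStar s s₁ ∧ N.impl.stLTS.Tr s₁ α s' ∧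
      Simulates C₁ s₁ q ∧ Simulates C' s' q' := by
  cases hq with
  | @start M U i a hl hen =>
    obtain ⟨s₁, C₁, hs, h₁, hquiet⟩ := exists_quiet h hfin hplain hM hconf
    obtain ⟨j, hij, hr, he⟩ := h₁.exists_exec hquiet hfin hM hscn hconf (enabled_single.1 hen)
    exact ⟨s₁, _, C₁, _, hs, STTr.start (t := execTrans i j hij hr) hl
      (enabled_single.2 fun x => (congrFun (impl_pre _) x).le.trans ((he x).trans
        (congrFun h₁.marking x).ge)), h₁, h₁.start hfin hM hscn he⟩
  | @finish M U i a n hn hl =>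
    obtain ⟨t, ht, j, hij, hr, rfl, hph⟩ :=
      h.firing.flip.exists_getElem?_right hn
    exact ⟨s, _, C, _, .refl, STTr.finish ht hl, h, h.finish hph hn⟩
  | tau hl => exact absurd hl (hplain.2 _)

end PetriNet

open PetriNet in
theorem mainTheorem3 {Act : Type u} (N : PetriNet.{u, v, w} Act)
    [LinearOrder N.T] [WellFoundedLT N.T]
    (hfin : N.IsFinitary) (hconf : N.IsConflictFinite) (hplain : N.IsPlain)
    (hscn : N.IsStructuralConflictNet) (hM : ¬ N.HasFullyReachablePureM) :
    BranchingSTBisimilarDiv N.impl N := by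
  refine ⟨fun s q => ∃ C, Simulates C s q, ⟨⟨_, simulates_init⟩, ?_, ?_⟩, ⟨?_, ?_⟩⟩
  · rintro s q (_ | α) s' ⟨C, h⟩ hs
    · obtain ⟨C', -, h'⟩ := h.tau hfin hplain hM hs
      exact ⟨q, q, .refl, .inr ⟨rfl, rfl⟩, ⟨C, h⟩, ⟨C', h'⟩⟩
    · obtain ⟨q', C', hq, h'⟩ := h.forth hfin hM hscn hs
      exact ⟨q, q', .refl, .inl hq, ⟨C, h⟩, ⟨C', h'⟩⟩
  · rintro s q α q' ⟨C, h⟩ hq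
    obtain ⟨s₁, s', C₁, C', h1, h2, h3, h4⟩ := h.back hfin hplain hM hscn hconf hq
    exact ⟨s₁, s', h1, .inl h2, ⟨C₁, h3⟩, ⟨C', h4⟩⟩
  · intro σ q hσ hB
    obtain ⟨C, h⟩ := hB 0
    exact ((acc_iff_isEmpty_descending_chain.1 (h.acc hfin hplain hM hconf)).false
      ⟨σ, rfl, hσ⟩).elim
  · intro s ρ hρ _
    exact absurd (hρ 0) hplain.not_tau
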